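/- Let $\Gamma(1)=\mathrm{PSL}_2(\mathbb Z)$ with generators $S=\pm\begin{pmatrix}0&1\\-1&0\end{pmatrix}$, $T=\pm\begin{pmatrix}1&1\\0&1\end{pmatrix}$, let $\Gamma\subset\Gamma(1)$ be a torsion-free normal subgroup of finite index, and let $\Gamma_{\rm par}$ be the subgroup of $\Gamma$ generated by its parabolic elements. Let $(\eta,V_\eta)$ be a finite dimensional complex representation of $\Gamma(1)$ which is trivial on $\Gamma_{\rm par}$ and whose restriction to $\Gamma$ is unipotent of length $q$, i.e. there are $\Gamma$-stable subspaces $0=V_{-1}\subset V_{0}\subset\dots\subset V_{q}=V_\eta$ such that $\Gamma$ acts trivially on each $V_k/V_{k-1}$. Let $\nu\in\mathbb C$. A $V_\eta$-valued hyperfunction on an open set $\Omega\subset\mathbb P_1(\mathbb R)$ is an element of $\mathcal O(U\smallsetminus\Omega)/\mathcal O(U)$, where $\mathcal O$ is the sheaf of $V_\eta$-valued holomorphic functions and $U\subset\mathbb P_1(\mathbb C)$ is open with $U\cap\mathbb P_1(\mathbb R)=\Omega$ (the choice of $U$ is immaterial, and $U$ may be shrunk). For $g=\pm\begin{pmatrix}a&b\\c&d\end{pmatrix}\in\mathrm{PSL}_2(\mathbb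 R)$, a hyperfunction on $\mathbb P_1(\mathbb R)$ represented by $f$ is sent by $\pi_\nu(g)$ to the one represented by $$\pi_\nu(g)f(z)=\left(\frac{1+z^2}{(cz-a)^2+(dz-b)^2}\right)^{\nu+\frac12} f\left(\frac{dz-b}{-cz+a}\right),$$ with the principal power near $\mathbb P_1(\mathbb R)$. Let $A^{-\omega}_{\nu,\eta}=(\pi_\nu^{-\omega}\otimes\eta)^{\Gamma(1)}$ be the space of $\eta$-automorphic hyperfunctions, i.e. of the $V_\eta$-valued hyperfunctions $\alpha$ on $\mathbb P_1(\mathbb R)$ with $\eta(\gamma)\,\pi_\nu(\gamma)\alpha=\alpha$ for all $\gamma\in\Gamma(1)$. Let $\mathcal F_{\nu,\eta}$ be the space of holomorphic functions $f:\mathbb C\smallsetminus\mathbb R\to V_\eta$ such that $f(z+1)=\eta(T)f(z)$; $f(z)=O(1)$ as $|\mathrm{Im}\, z|\to\infty$; $f(i\infty)+f(-i\infty)=0$, where $f(\pm i\infty)=\lim_{\mathrm{Im}\,z\to\pm\infty}f(z)$; and the function $$z\mapsto f(z)-z^{-2\nu-1}\,\eta(S)f\left(\frac{-1}{z}\right)\qquad(\text{principal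 branch of }z^{-2\nu-1})$$ extends holomorphically to $\mathbb C\smallsetminus(-\infty,0]$. Then there is exactly one bijective linear map $A^{-\omega}_{\nu,\eta}\to\mathcal F_{\nu,\eta}$, $\alpha\mapsto f_\alpha$, such that for every $\alpha\in A^{-\omega}_{\nu,\eta}$ the function $z\mapsto(1+z^2)^{\nu+\frac12}f_\alpha(z)$ (principal power near $\mathbb R$) represents the restriction $\alpha|_{\mathbb R}$. -/

import Mathlib

open scoped Topology MatrixGroups OnePoint

namespace LewisHyp

noncomputable section

variable {V : Type*} [NormedAddCommGroup V] [NormedSpace ℂ V]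

/-! ### Holomorphic functions on open subsets of the complex projective line

`OnePoint ℂ` is the complex projective line `ℂ ∪ {∞}`, with Mathlib's action of `GL(2, ℂ)` by
fractional linear transformations. -/

/-- The real projective line `ℝ ∪ {∞}` inside the complex projective line. -/
def realProj : Set (OnePoint ℂ) := Set.range (OnePoint.map (fun x : ℝ => (x : ℂ)))

/-- The real line `ℝ` inside the complex projective line. -/
def realLine : Set (OnePoint ℂ) := Set.range (fun x : ℝ => ((x : ℂ) : OnePoint ℂ))

/-- The coordinate `w = 1 / z` around `∞`: it sends `0` to `∞` and `w ≠ 0` to `1 / w`. -/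
def chartInfty (w : ℂ) : OnePoint ℂ := if w = 0 then ∞ else ((w⁻¹ : ℂ) : OnePoint ℂ)

/-- `f` is holomorphic in a neighbourhood of the point `p` of the complex projective line. -/
def HolAt (f : OnePoint ℂ → V) (p : OnePoint ℂ) : Prop :=
  p.elim (AnalyticAt ℂ (fun w : ℂ => f (chartInfty w)) 0)
    (fun z => AnalyticAt ℂ (fun w : ℂ => f (w : OnePoint ℂ)) z)

theorem holAt_infty {f : OnePoint ℂ → V} :
    HolAt f ∞ ↔ AnalyticAt ℂ (fun w : ℂ => f (chartInfty w)) 0 := Iff.rfl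

theorem holAt_coe {f : OnePoint ℂ → V} {z : ℂ} :
    HolAt f (z : OnePoint ℂ) ↔ AnalyticAt ℂ (fun w : ℂ => f (w : OnePoint ℂ)) z := Iff.rfl

theorem HolAt.zero (p : OnePoint ℂ) : HolAt (0 : OnePoint ℂ → V) p := by
  cases p with
  | infty => exact holAt_infty.2 analyticAt_const
  | coe z => exact holAt_coe.2 analyticAt_const

theorem HolAt.add {f g : OnePoint ℂ → V} {p : OnePoint ℂ} (hf : HolAt f p) (hg : HolAt g p) :
    HolAt (f + g) p := by
  cases p with
  | infty => exact AnalyticAt.add hf hg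
  | coe z => exact AnalyticAt.add hf hg

theorem HolAt.smul {s : OnePoint ℂ → ℂ} {f : OnePoint ℂ → V} {p : OnePoint ℂ}
    (hs : HolAt s p) (hf : HolAt f p) : HolAt (fun q => s q • f q) p := by
  cases p with
  | infty => exact AnalyticAt.smul hs hf
  | coe z => exact AnalyticAt.smul hs hf

theorem HolAt.const_smul (c : ℂ) {f : OnePoint ℂ → V} {p : OnePoint ℂ} (hf : HolAt f p) :
    HolAt (c • f) p := by
  cases p with
  | infty => exact AnalyticAt.const_smul hf
  | coe z => exact AnalyticAt.const_smul hf

theorem HolAt.linear [FiniteDimensional ℂ V] (L : V →ₗ[ℂ] V) {f : OnePoint ℂ → V} {p : OnePoint ℂ}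
    (hf : HolAt f p) : HolAt (fun q => L (f q)) p := by
  cases p with
  | infty =>
    exact AnalyticAt.fun_comp ((LinearMap.toContinuousLinearMap L).analyticAt _) (holAt_infty.1 hf)
  | coe z =>
    exact AnalyticAt.fun_comp ((LinearMap.toContinuousLinearMap L).analyticAt _) (holAt_coe.1 hf)

/-! ### Hyperfunctions -/

/-- The functions that are holomorphic on `U ∖ ℙ¹(ℝ)` for some open neighbourhood `U` of `Ω` in
`ℙ¹(ℂ)`. Their values elsewhere are irrelevant. -/
def boundaryFunctions (Ω : Set (OnePoint ℂ)) (V : Type*) [NormedAddCommGroup V]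
    [NormedSpace ℂ V] : Submodule ℂ (OnePoint ℂ → V) where
  carrier := {f | ∀ᶠ p in 𝓝ˢ Ω, p ∉ realProj → HolAt f p}
  zero_mem' := by
    change ∀ᶠ p in 𝓝ˢ Ω, p ∉ realProj → HolAt (0 : OnePoint ℂ → V) p
    exact Filter.Eventually.of_forall fun p _ => HolAt.zero p
  add_mem' := by
    intro f g hf hg
    change ∀ᶠ p in 𝓝ˢ Ω, p ∉ realProj → HolAt (f + g) p
    filter_upwards [hf, hg] with p h1 h2 hp using (h1 hp).add (h2 hp)
  smul_mem' := by
    intro c f hf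
    change ∀ᶠ p in 𝓝ˢ Ω, p ∉ realProj → HolAt (c • f) p
    filter_upwards [hf] with p h1 hp using (h1 hp).const_smul c

/-- The functions whose restriction to `U ∖ ℙ¹(ℝ)`, for some open neighbourhood `U` of `Ω`, extends
to a holomorphic function on `U`. -/
def extendableFunctions (Ω : Set (OnePoint ℂ)) (V : Type*) [NormedAddCommGroup V]
    [NormedSpace ℂ V] : Submodule ℂ (OnePoint ℂ → V) where
  carrier := {f | ∃ h : OnePoint ℂ → V, (∀ p ∈ Ω, HolAt h p) ∧
    ∀ᶠ p in 𝓝ˢ Ω, p ∉ realProj → f p = h p}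
  zero_mem' := ⟨0, fun p _ => HolAt.zero p, Filter.Eventually.of_forall fun _ _ => rfl⟩
  add_mem' := by
    rintro f g ⟨h, hh, hf⟩ ⟨k, hk, hg⟩
    refine ⟨h + k, fun p hp => (hh p hp).add (hk p hp), ?_⟩
    filter_upwards [hf, hg] with p h1 h2 hp
    simp [h1 hp, h2 hp]
  smul_mem' := by
    rintro c f ⟨h, hh, hf⟩
    refine ⟨c • h, fun p hp => (hh p hp).const_smul c, ?_⟩
    filter_upwards [hf] with p h1 hp
    simp [h1 hp]

/-- The space of `V`-valued hyperfunctions on an open subset `Ω` of `ℙ¹(ℝ)`: the quotient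
`𝒪(U ∖ Ω) / 𝒪(U)`, for `U` running through the (arbitrarily small) open sets of `ℙ¹(ℂ)` with
`U ∩ ℙ¹(ℝ) = Ω`. -/
abbrev Hyperfunction (Ω : Set (OnePoint ℂ)) (V : Type*) [NormedAddCommGroup V]
    [NormedSpace ℂ V] : Type _ :=
  boundaryFunctions Ω V ⧸ (extendableFunctions Ω V).submoduleOf (boundaryFunctions Ω V)

/-- The function `F` represents the hyperfunction `β` on `Ω`. -/
def Represents {Ω : Set (OnePoint ℂ)} (F : OnePoint ℂ → V) (β : Hyperfunction Ω V) : Prop :=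
  ∃ hF : F ∈ boundaryFunctions Ω V, Submodule.Quotient.mk ⟨F, hF⟩ = β

/-- A linear operator on functions induces one on hyperfunctions as soon as it respects
boundary functions and extendable functions. -/
def inducedMap {Ω Ω' : Set (OnePoint ℂ)} (A : (OnePoint ℂ → V) →ₗ[ℂ] (OnePoint ℂ → V))
    (h1 : ∀ f ∈ boundaryFunctions Ω V, A f ∈ boundaryFunctions Ω' V)
    (h2 : ∀ f ∈ extendableFunctions Ω V, A f ∈ extendableFunctions Ω' V) :
    Hyperfunction Ω V →ₗ[ℂ] Hyperfunction Ω' V :=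
  Submodule.mapQ _ _ (A.restrict h1) fun f hf => h2 f.1 hf

/-- The restriction of hyperfunctions to a smaller set. -/
def restrictHyp (V : Type*) [NormedAddCommGroup V] [NormedSpace ℂ V] {Ω Ω' : Set (OnePoint ℂ)} (h : Ω' ⊆ Ω) :
    Hyperfunction Ω V →ₗ[ℂ] Hyperfunction Ω' V :=
  inducedMap LinearMap.id (fun _ hf => hf.filter_mono (nhdsSet_mono h))
    fun _ ⟨k, hk, hf⟩ => ⟨k, fun p hp => hk p (h hp), hf.filter_mono (nhdsSet_mono h)⟩

/-- The action of a linear endomorphism of `V` on the values of a `V`-valued hyperfunction. -/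
def valueMap [FiniteDimensional ℂ V] {Ω : Set (OnePoint ℂ)} (L : V →ₗ[ℂ] V) :
    Hyperfunction Ω V →ₗ[ℂ] Hyperfunction Ω V :=
  inducedMap (L.compLeft (OnePoint ℂ))
    (fun f hf => by
      change ∀ᶠ p in 𝓝ˢ Ω, p ∉ realProj → HolAt (fun q => L (f q)) p
      filter_upwards [hf] with p h1 hp using (h1 hp).linear L)
    fun f ⟨k, hk, hf⟩ => ⟨fun q => L (k q), fun p hp => (hk p hp).linear L, by
      filter_upwards [hf] with p h1 hp
      simp [h1 hp]⟩

theorem realLine_subset_realProj : realLine ⊆ realProj := by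
  rintro _ ⟨x, rfl⟩
  exact ⟨(x : OnePoint ℝ), rfl⟩

/-! ### The principal series on hyperfunctions -/

/-- For `g = (a, b; c, d)` the function `(1 + z²) / ((c z - a)² + (d z - b)²)` on `ℙ¹(ℂ)`, whose
value at `∞` is `1 / (c² + d²)`. It is positive on `ℙ¹(ℝ)`. -/
def autFactor (g : SL(2, ℝ)) (p : OnePoint ℂ) : ℂ :=
  p.elim (1 / ((g 1 0 : ℂ) ^ 2 + (g 1 1 : ℂ) ^ 2))
    (fun z => (1 + z ^ 2) / (((g 1 0 : ℂ) * z - g 0 0) ^ 2 + ((g 1 1 : ℂ) * z - g 0 1) ^ 2))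

/-- The operator `(π_ν(g) f)(z) = ((1+z²) / ((cz-a)²+(dz-b)²))^(ν+1/2) f((dz-b)/(-cz+a))` on
functions, `g = (a, b; c, d)`. Here `(dz-b)/(-cz+a) = g⁻¹ • z`, and the power is the principal one,
which is holomorphic around `ℙ¹(ℝ)`. -/
def principalSeriesFun (ν : ℂ) (g : SL(2, ℝ)) : (OnePoint ℂ → V) →ₗ[ℂ] (OnePoint ℂ → V) where
  toFun f p := autFactor g p ^ (ν + 1 / 2) •
    f ((Matrix.SpecialLinearGroup.mapGL ℂ g)⁻¹ • p)
  map_add' f f' := by ext p; simp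
  map_smul' c f := by ext p; simp [smul_comm c]

/-- The element `g⁻¹` acts by the fractional linear transformation `z ↦ (dz-b)/(-cz+a)`. -/
theorem inv_smul_coe (g : SL(2, ℝ)) (z : ℂ) :
    (Matrix.SpecialLinearGroup.mapGL ℂ g)⁻¹ • (z : OnePoint ℂ) =
      if -(g 1 0 : ℂ) * z + g 0 0 = 0 then ∞
      else ((((g 1 1 : ℂ) * z - g 0 1) / (-(g 1 0 : ℂ) * z + g 0 0) : ℂ) : OnePoint ℂ) := by
  have e (i j : Fin 2) : (Matrix.SpecialLinearGroup.mapGL ℂ g⁻¹) i j = ((g⁻¹ i j : ℝ) : ℂ) := rfl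
  have e00 : g⁻¹ 0 0 = g 1 1 := by rw [Matrix.SpecialLinearGroup.SL2_inv_expl]; rfl
  have e01 : g⁻¹ 0 1 = -g 0 1 := by rw [Matrix.SpecialLinearGroup.SL2_inv_expl]; rfl
  have e10 : g⁻¹ 1 0 = -g 1 0 := by rw [Matrix.SpecialLinearGroup.SL2_inv_expl]; rfl
  have e11 : g⁻¹ 1 1 = g 0 0 := by rw [Matrix.SpecialLinearGroup.SL2_inv_expl]; rfl
  rw [← map_inv, OnePoint.smul_some_eq_ite]
  simp only [e, e00, e01, e10, e11, Complex.ofReal_neg, sub_eq_add_neg]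

/-- The chart around `p`. -/
def chart (p : OnePoint ℂ) : ℂ → OnePoint ℂ := p.elim chartInfty (fun _ w => (w : OnePoint ℂ))

/-- The coordinate of `p` in the chart around `p`. -/
def base (p : OnePoint ℂ) : ℂ := p.elim 0 id

theorem holAt_iff {f : OnePoint ℂ → V} {p : OnePoint ℂ} :
    HolAt f p ↔ AnalyticAt ℂ (fun w => f (chart p w)) (base p) := by
  cases p <;> exact Iff.rfl

theorem chart_base (p : OnePoint ℂ) : chart p (base p) = p := by
  cases p
  · simp [chart, base, chartInfty]
  · rfl

theorem chartInfty_of_ne {w : ℂ} (hw : w ≠ 0) : chartInfty w = ((w⁻¹ : ℂ) : OnePoint ℂ) := by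
  simp [chartInfty, hw]

theorem nhds_eq_map_chart (p : OnePoint ℂ) : 𝓝 p = Filter.map (chart p) (𝓝 (base p)) := by
  cases p with
  | coe z => exact OnePoint.nhds_coe_eq z
  | infty =>
    change 𝓝 ∞ = Filter.map chartInfty (𝓝 0)
    rw [OnePoint.nhds_infty_eq, Filter.coclosedCompact_eq_cocompact, ← Metric.cobounded_eq_cocompact,
      ← pure_sup_nhdsNE, Filter.map_sup, Filter.map_pure, sup_comm]
    congr 1
    · simp [chartInfty]
    · rw [← Filter.inv_nhdsNE_zero, ← Filter.map_inv, Filter.map_map]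
      refine Filter.map_congr ?_
      filter_upwards [self_mem_nhdsWithin] with w hw
      exact (chartInfty_of_ne hw).symm

theorem HolAt.eventually [FiniteDimensional ℂ V] {f : OnePoint ℂ → V} {p : OnePoint ℂ} (hf : HolAt f p) :
    ∀ᶠ q in 𝓝 p, HolAt f q := by
  have := FiniteDimensional.complete ℂ V
  rw [nhds_eq_map_chart p, Filter.eventually_map]
  cases p with
  | coe z => exact (holAt_coe.1 hf).eventually_analyticAt
  | infty =>
    filter_upwards [(holAt_infty.1 hf).eventually_analyticAt] with w hw
    change HolAt f (chartInfty w)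
    by_cases h0 : w = 0
    · simpa [h0, chartInfty] using hf
    · rw [chartInfty_of_ne h0, holAt_coe]
      have h1 : AnalyticAt ℂ (fun u : ℂ => u⁻¹) w⁻¹ := analyticAt_inv (inv_ne_zero h0)
      have h2 : AnalyticAt ℂ (fun w : ℂ => f (chartInfty w)) ((fun u : ℂ => u⁻¹) w⁻¹) := by
        simpa using hw
      refine (AnalyticAt.fun_comp h2 h1).congr ?_
      filter_upwards [isOpen_ne.mem_nhds (inv_ne_zero h0)] with u hu
      rw [chartInfty_of_ne (inv_ne_zero hu), inv_inv]

theorem exists_chart_smul (m : GL (Fin 2) ℂ) (p : OnePoint ℂ) :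
    ∃ φ : ℂ → ℂ, AnalyticAt ℂ φ (base p) ∧ φ (base p) = base (m • p) ∧
      ∀ᶠ w in 𝓝 (base p), m • chart p w = chart (m • p) (φ w) := by
  have hdet : m 0 0 * m 1 1 - m 0 1 * m 1 0 ≠ 0 := by
    simpa [Matrix.det_fin_two] using m.det_ne_zero
  cases p with
  | coe z =>
    change ∃ φ : ℂ → ℂ, AnalyticAt ℂ φ z ∧ φ z = base (m • (z : OnePoint ℂ)) ∧
      ∀ᶠ w : ℂ in 𝓝 z, m • (w : OnePoint ℂ) = chart (m • (z : OnePoint ℂ)) (φ w)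
    have a1 : AnalyticAt ℂ (fun w : ℂ => m 0 0 * w + m 0 1) z := by fun_prop
    have a2 : AnalyticAt ℂ (fun w : ℂ => m 1 0 * w + m 1 1) z := by fun_prop
    by_cases h : m 1 0 * z + m 1 1 = 0
    · have h' : m 0 0 * z + m 0 1 ≠ 0 := by
        intro h'
        apply hdet
        by_cases hc : m 1 0 = 0
        · have hd : m 1 1 = 0 := by simpa [hc] using h
          simp [hc, hd]
        · have : m 1 0 * (m 0 0 * m 1 1 - m 0 1 * m 1 0) = 0 := by
            linear_combination m 0 0 * m 1 0 * h - m 1 0 * m 1 0 * h'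
          exact (mul_eq_zero.1 this).resolve_left hc
      have hp : m • (z : OnePoint ℂ) = ∞ := by rw [OnePoint.smul_some_eq_ite, if_pos h]
      rw [hp]
      refine ⟨fun w => (m 1 0 * w + m 1 1) / (m 0 0 * w + m 0 1), a2.div a1 h', ?_, ?_⟩
      · simp [h, base]
      · filter_upwards [a1.continuousAt.eventually_ne h'] with w hw
        change _ = chartInfty _
        rw [OnePoint.smul_some_eq_ite]
        by_cases h0 : m 1 0 * w + m 1 1 = 0
        · simp [h0, chartInfty]
        · rw [if_neg h0, chartInfty_of_ne (div_ne_zero h0 hw), inv_div]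
    · have hp : m • (z : OnePoint ℂ) =
          (((m 0 0 * z + m 0 1) / (m 1 0 * z + m 1 1) : ℂ) : OnePoint ℂ) := by
        rw [OnePoint.smul_some_eq_ite, if_neg h]
      rw [hp]
      refine ⟨fun w => (m 0 0 * w + m 0 1) / (m 1 0 * w + m 1 1), a1.div a2 h, rfl, ?_⟩
      filter_upwards [a2.continuousAt.eventually_ne h] with w hw
      rw [OnePoint.smul_some_eq_ite, if_neg hw]
      rfl
  | infty =>
    change ∃ φ : ℂ → ℂ, AnalyticAt ℂ φ 0 ∧ φ 0 = base (m • (∞ : OnePoint ℂ)) ∧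
      ∀ᶠ w in 𝓝 (0 : ℂ), m • chartInfty w = chart (m • (∞ : OnePoint ℂ)) (φ w)
    have a1 : AnalyticAt ℂ (fun w : ℂ => m 0 0 + m 0 1 * w) 0 := by fun_prop
    have a2 : AnalyticAt ℂ (fun w : ℂ => m 1 0 + m 1 1 * w) 0 := by fun_prop
    have e1 (w : ℂ) (hw : w ≠ 0) : m 0 0 * w⁻¹ + m 0 1 = (m 0 0 + m 0 1 * w) / w := by
      field_simp
    have e2 (w : ℂ) (hw : w ≠ 0) : m 1 0 * w⁻¹ + m 1 1 = (m 1 0 + m 1 1 * w) / w := by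
      field_simp
    by_cases h : m 1 0 = 0
    · have h' : m 0 0 ≠ 0 := by
        intro h'
        simp [h, h'] at hdet
      have hp : m • (∞ : OnePoint ℂ) = ∞ := by rw [OnePoint.smul_infty_eq_ite, if_pos h]
      rw [hp]
      refine ⟨fun w => (m 1 0 + m 1 1 * w) / (m 0 0 + m 0 1 * w), a2.div a1 (by simpa using h'),
        by simp [h, base], ?_⟩
      filter_upwards [a1.continuousAt.eventually_ne (by simpa using h')] with w hw
      change _ = chartInfty _
      by_cases h0 : w = 0
      · simp [h0, h, chartInfty, hp]
      · have hd : m 1 1 ≠ 0 := by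
          intro hd
          simp [h, hd] at hdet
        have hn : m 1 0 + m 1 1 * w ≠ 0 := by simp [h, hd, h0]
        rw [chartInfty_of_ne h0, OnePoint.smul_some_eq_ite, e1 w h0, e2 w h0,
          if_neg (div_ne_zero hn h0), chartInfty_of_ne (div_ne_zero hn hw), inv_div,
          div_div_div_cancel_right₀ h0]
    · have hp : m • (∞ : OnePoint ℂ) = ((m 0 0 / m 1 0 : ℂ) : OnePoint ℂ) := by
        rw [OnePoint.smul_infty_eq_ite, if_neg h]
      rw [hp]
      refine ⟨fun w => (m 0 0 + m 0 1 * w) / (m 1 0 + m 1 1 * w), a1.div a2 (by simpa using h),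
        by simp [base], ?_⟩
      filter_upwards [a2.continuousAt.eventually_ne (by simpa using h)] with w hw
      by_cases h0 : w = 0
      · simp [h0, chartInfty, hp, chart]
      · rw [chartInfty_of_ne h0, OnePoint.smul_some_eq_ite, e1 w h0, e2 w h0,
          if_neg (div_ne_zero hw h0), div_div_div_cancel_right₀ h0]
        rfl

theorem tendsto_smul (m : GL (Fin 2) ℂ) (p : OnePoint ℂ) :
    Filter.Tendsto (fun q => m • q) (𝓝 p) (𝓝 (m • p)) := by
  obtain ⟨φ, h1, h2, h3⟩ := exists_chart_smul m p
  rw [nhds_eq_map_chart p, nhds_eq_map_chart (m • p), Filter.tendsto_map'_iff]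
  refine Filter.Tendsto.congr' (f₁ := chart (m • p) ∘ φ) ?_ ?_
  · filter_upwards [h3] with w hw using hw.symm
  · rw [← h2]
    exact Filter.tendsto_map.comp h1.continuousAt

theorem HolAt.comp_smul {m : GL (Fin 2) ℂ} {f : OnePoint ℂ → V} {p : OnePoint ℂ}
    (hf : HolAt f (m • p)) : HolAt (fun q => f (m • q)) p := by
  obtain ⟨φ, h1, h2, h3⟩ := exists_chart_smul m p
  rw [holAt_iff] at hf ⊢
  rw [← h2] at hf
  refine (hf.comp h1).congr ?_
  filter_upwards [h3] with w hw
  simp [hw]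

theorem smul_mem_realProj (g : SL(2, ℝ)) {p : OnePoint ℂ} (hp : p ∈ realProj) :
    Matrix.SpecialLinearGroup.mapGL ℂ g • p ∈ realProj := by
  obtain ⟨c, rfl⟩ := hp
  refine ⟨Matrix.SpecialLinearGroup.mapGL ℝ g • c, ?_⟩
  have := OnePoint.map_smul Complex.ofRealHom (Matrix.SpecialLinearGroup.mapGL ℝ g) c
  exact this

theorem inv_smul_mem_realProj_iff (g : SL(2, ℝ)) {p : OnePoint ℂ} :
    (Matrix.SpecialLinearGroup.mapGL ℂ g)⁻¹ • p ∈ realProj ↔ p ∈ realProj := by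
  constructor
  · intro h
    simpa using smul_mem_realProj g h
  · intro h
    simpa using smul_mem_realProj g⁻¹ h

theorem holAt_autFactor_cpow (s : ℂ) (g : SL(2, ℝ)) {p : OnePoint ℂ} (hp : p ∈ realProj) :
    HolAt (fun q => autFactor g q ^ s) p := by
  have hdet : g 0 0 * g 1 1 - g 0 1 * g 1 0 = 1 := by
    have := g.det_coe
    rwa [Matrix.det_fin_two] at this
  obtain ⟨c, rfl⟩ := hp
  cases c with
  | coe x =>
    change AnalyticAt ℂ (fun z : ℂ => ((1 + z ^ 2) /
      (((g 1 0 : ℂ) * z - g 0 0) ^ 2 + ((g 1 1 : ℂ) * z - g 0 1) ^ 2)) ^ s) (x : ℂ)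
    have hpos : 0 < (g 1 0 * x - g 0 0) ^ 2 + (g 1 1 * x - g 0 1) ^ 2 := by
      by_contra hneg
      have h1 : g 1 0 * x - g 0 0 = 0 := by
        nlinarith [sq_nonneg (g 1 0 * x - g 0 0), sq_nonneg (g 1 1 * x - g 0 1)]
      have h2 : g 1 1 * x - g 0 1 = 0 := by
        nlinarith [sq_nonneg (g 1 0 * x - g 0 0), sq_nonneg (g 1 1 * x - g 0 1)]
      have : (0 : ℝ) = 1 := by linear_combination hdet + g 1 1 * h1 - g 1 0 * h2
      norm_num at this
    have e : (((1 + x ^ 2) / ((g 1 0 * x - g 0 0) ^ 2 + (g 1 1 * x - g 0 1) ^ 2) : ℝ) : ℂ) =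
        (1 + (x : ℂ) ^ 2) / (((g 1 0 : ℂ) * x - g 0 0) ^ 2 + ((g 1 1 : ℂ) * x - g 0 1) ^ 2) := by
      push_cast
      rfl
    refine AnalyticAt.cpow (AnalyticAt.div (by fun_prop) (by fun_prop) ?_) analyticAt_const ?_
    · exact_mod_cast hpos.ne'
    · rw [← e]
      exact Complex.ofReal_mem_slitPlane.2 (by positivity)
  | infty =>
    have hpos : 0 < g 1 0 ^ 2 + g 1 1 ^ 2 := by
      by_contra hneg
      have h1 : g 1 0 = 0 := by nlinarith [sq_nonneg (g 1 0), sq_nonneg (g 1 1)]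
      have h2 : g 1 1 = 0 := by nlinarith [sq_nonneg (g 1 0), sq_nonneg (g 1 1)]
      simp [h1, h2] at hdet
    have key : AnalyticAt ℂ (fun w : ℂ => ((w ^ 2 + 1) /
        (((g 1 0 : ℂ) - g 0 0 * w) ^ 2 + ((g 1 1 : ℂ) - g 0 1 * w) ^ 2)) ^ s) 0 := by
      have e : ((1 / (g 1 0 ^ 2 + g 1 1 ^ 2) : ℝ) : ℂ) = ((0 : ℂ) ^ 2 + 1) /
          (((g 1 0 : ℂ) - g 0 0 * 0) ^ 2 + ((g 1 1 : ℂ) - g 0 1 * 0) ^ 2) := by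
        push_cast
        simp
      refine AnalyticAt.cpow (AnalyticAt.div (by fun_prop) (by fun_prop) ?_) analyticAt_const ?_
      · simpa using (by exact_mod_cast hpos.ne' : (g 1 0 : ℂ) ^ 2 + (g 1 1 : ℂ) ^ 2 ≠ 0)
      · rw [← e]
        exact Complex.ofReal_mem_slitPlane.2 (by positivity)
    refine holAt_infty.2 (key.congr (Filter.Eventually.of_forall fun w => ?_))
    by_cases h0 : w = 0
    · simp [h0, chartInfty, autFactor]
    · change _ = autFactor g (chartInfty w) ^ s
      rw [chartInfty_of_ne h0]
      change _ = ((1 + w⁻¹ ^ 2) /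
        (((g 1 0 : ℂ) * w⁻¹ - g 0 0) ^ 2 + ((g 1 1 : ℂ) * w⁻¹ - g 0 1) ^ 2)) ^ s
      have e1 : (1 + w⁻¹ ^ 2) = (w ^ 2 + 1) / w ^ 2 := by field_simp
      have e2 : ((g 1 0 : ℂ) * w⁻¹ - g 0 0) ^ 2 + ((g 1 1 : ℂ) * w⁻¹ - g 0 1) ^ 2 =
          (((g 1 0 : ℂ) - g 0 0 * w) ^ 2 + ((g 1 1 : ℂ) - g 0 1 * w) ^ 2) / w ^ 2 := by
        field_simp
      rw [e1, e2, div_div_div_cancel_right₀ (pow_ne_zero 2 h0)]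

theorem principalSeriesFun_boundary [FiniteDimensional ℂ V] (ν : ℂ) (g : SL(2, ℝ)) {f : OnePoint ℂ → V}
    (hf : f ∈ boundaryFunctions realProj V) :
    principalSeriesFun ν g f ∈ boundaryFunctions realProj V := by
  refine eventually_nhdsSet_iff_forall.2 fun p hp => ?_
  have h := eventually_nhdsSet_iff_forall.1 hf _ ((inv_smul_mem_realProj_iff g).2 hp)
  filter_upwards [(tendsto_smul _ p).eventually h,
    (holAt_autFactor_cpow (ν + 1 / 2) g hp).eventually] with q h1 h2 hq
  exact h2.smul (h1 (by rwa [inv_smul_mem_realProj_iff])).comp_smul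

theorem principalSeriesFun_extendable (ν : ℂ) (g : SL(2, ℝ)) {f : OnePoint ℂ → V}
    (hf : f ∈ extendableFunctions realProj V) :
    principalSeriesFun ν g f ∈ extendableFunctions realProj V := by
  obtain ⟨h, hh, hf⟩ := hf
  refine ⟨principalSeriesFun ν g h, fun p hp => ?_, eventually_nhdsSet_iff_forall.2 fun p hp => ?_⟩
  · exact (holAt_autFactor_cpow (ν + 1 / 2) g hp).smul
      (hh _ ((inv_smul_mem_realProj_iff g).2 hp)).comp_smul
  · have h := eventually_nhdsSet_iff_forall.1 hf _ ((inv_smul_mem_realProj_iff g).2 hp)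
    filter_upwards [(tendsto_smul _ p).eventually h] with q h1 hq
    simp [principalSeriesFun, h1 (by rwa [inv_smul_mem_realProj_iff])]

/-- The operator `π_ν(g)` on `V`-valued hyperfunctions on `ℙ¹(ℝ)`. -/
def principalSeries (V : Type*) [NormedAddCommGroup V] [NormedSpace ℂ V]
    [FiniteDimensional ℂ V] (ν : ℂ) (g : SL(2, ℝ)) :
    Hyperfunction realProj V →ₗ[ℂ] Hyperfunction realProj V :=
  inducedMap (principalSeriesFun ν g) (fun _ => principalSeriesFun_boundary ν g)
    (fun _ => principalSeriesFun_extendable ν g)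

/-! ### The modular group and the representation `η` -/

/-- The class `±γ` in `PSL(2, ℤ)`. -/
def cls (γ : SL(2, ℤ)) : PSL(2, ℤ) := QuotientGroup.mk γ

/-- `S = ±(0, 1; -1, 0)`. -/
def modS : PSL(2, ℤ) := cls ⟨!![0, 1; -1, 0], by simp [Matrix.det_fin_two]⟩

/-- `T = ±(1, 1; 0, 1)`. -/
def modT : PSL(2, ℤ) := cls ⟨!![1, 1; 0, 1], by simp [Matrix.det_fin_two]⟩

/-- The subgroup `Γ_par` of `Γ` generated by all parabolic elements of `Γ`. -/
def parabolicSubgroup (Γ : Subgroup PSL(2, ℤ)) : Subgroup PSL(2, ℤ) :=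
  Subgroup.closure {x | x ∈ Γ ∧ ∃ γ : SL(2, ℤ), cls γ = x ∧ γ.val.IsParabolic}

/-- The restriction of `η` to `Γ` is a unipotent length `q` representation: there is a filtration
`0 = W 0 ⊆ W 1 ⊆ … ⊆ W (q + 1) = V` by `Γ`-stable subspaces such that `Γ` acts trivially on each
quotient `W (k + 1) / W k`. -/
def IsUnipotentOn {V : Type*} [AddCommGroup V] [Module ℂ V] (η : Representation ℂ PSL(2, ℤ) V)
    (Γ : Subgroup PSL(2, ℤ)) (q : ℕ) : Prop :=
  ∃ W : ℕ → Submodule ℂ V, Monotone W ∧ W 0 = ⊥ ∧ W (q + 1) = ⊤ ∧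
    (∀ k, ∀ γ ∈ Γ, ∀ v ∈ W k, η γ v ∈ W k) ∧
    (∀ k, ∀ γ ∈ Γ, ∀ v ∈ W (k + 1), η γ v - v ∈ W k)

/-- The space of `η`-automorphic hyperfunctions: the `Γ(1)`-invariants of `π_ν^{-ω} ⊗ η`, realised
as `V`-valued hyperfunctions on `ℙ¹(ℝ)`. -/
def automorphicHyperfunctions [FiniteDimensional ℂ V] (ν : ℂ)
    (η : Representation ℂ PSL(2, ℤ) V) : Submodule ℂ (Hyperfunction realProj V) where
  carrier := {α | ∀ γ : SL(2, ℤ), valueMap (η (cls γ))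
    (principalSeries V ν (Matrix.SpecialLinearGroup.map (Int.castRingHom ℝ) γ) α) = α}
  zero_mem' := by intro γ; simp
  add_mem' := by
    intro α β hα hβ γ
    rw [map_add, map_add, hα γ, hβ γ]
  smul_mem' := by
    intro c α hα γ
    rw [map_smul, map_smul, hα γ]

/-- The space of holomorphic functions `f : ℂ ∖ ℝ → V` (encoded as functions on `ℂ` that are
extended by `0` to the real line) with `f(z+1) = η(T) f(z)`, `f(z) = O(1)` as `|Im z| → ∞`,
`f(i∞) + f(-i∞) = 0`, and such that `f(z) - z^(-2ν-1) η(S) f(-1/z)` extends holomorphically to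
`ℂ ∖ (-∞, 0]`. -/
def periodicFunctions (ν : ℂ) (η : Representation ℂ PSL(2, ℤ) V) : Submodule ℂ (ℂ → V) where
  carrier := {f | (∀ x : ℝ, f x = 0) ∧
    DifferentiableOn ℂ f {z | z.im ≠ 0} ∧
    (∀ z : ℂ, z.im ≠ 0 → f (z + 1) = η modT (f z)) ∧
    (∃ A C : ℝ, ∀ z : ℂ, A ≤ |z.im| → ‖f z‖ ≤ C) ∧
    (∃ v₁ v₂ : V, Filter.Tendsto f (Filter.comap Complex.im Filter.atTop) (𝓝 v₁) ∧
      Filter.Tendsto f (Filter.comap Complex.im Filter.atBot) (𝓝 v₂) ∧ v₁ + v₂ = 0) ∧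
    ∃ ψ : ℂ → V, DifferentiableOn ℂ ψ Complex.slitPlane ∧
      ∀ z : ℂ, z.im ≠ 0 → ψ z = f z - z ^ (-2 * ν - 1) • η modS (f (-1 / z))}
  zero_mem' := by
    refine ⟨fun _ => rfl, differentiableOn_const 0, by simp, ⟨0, 0, by simp⟩,
      ⟨0, 0, tendsto_const_nhds, tendsto_const_nhds, by simp⟩, 0, differentiableOn_const 0, by simp⟩
  add_mem' := by
    rintro f g ⟨f0, f1, f2, ⟨A, C, f3⟩, ⟨v, w, f4, f5, f6⟩, ψ, f7, f8⟩
      ⟨g0, g1, g2, ⟨A', C', g3⟩, ⟨v', w', g4, g5, g6⟩, ψ', g7, g8⟩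
    refine ⟨fun x => by simp [f0 x, g0 x], f1.add g1, fun z hz => by simp [f2 z hz, g2 z hz],
      ⟨max A A', C + C', fun z hz => ?_⟩,
      ⟨v + v', w + w', f4.add g4, f5.add g5, ?_⟩, ψ + ψ', f7.add g7, fun z hz => ?_⟩
    · exact (norm_add_le _ _).trans
        (add_le_add (f3 z ((le_max_left _ _).trans hz)) (g3 z ((le_max_right _ _).trans hz)))
    · rw [add_add_add_comm, f6, g6, add_zero]
    · simp only [Pi.add_apply, f8 z hz, g8 z hz, map_add, smul_add]
      abel
  smul_mem' := by
    rintro c f ⟨f0, f1, f2, ⟨A, C, f3⟩, ⟨v, w, f4, f5, f6⟩, ψ, f7, f8⟩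
    refine ⟨fun x => by simp [f0 x], f1.const_smul c, fun z hz => by simp [f2 z hz],
      ⟨A, ‖c‖ * C, fun z hz => ?_⟩,
      ⟨c • v, c • w, f4.const_smul c, f5.const_smul c, ?_⟩, c • ψ, f7.const_smul c, fun z hz => ?_⟩
    · rw [Pi.smul_apply, norm_smul]
      exact mul_le_mul_of_nonneg_left (f3 z hz) (norm_nonneg c)
    · rw [← smul_add, f6, smul_zero]
    · simp only [Pi.smul_apply, f8 z hz, map_smul, smul_sub, smul_comm c]

/-- The function `z ↦ (1 + z²)^(ν + 1/2) f(z)` (principal power, holomorphic around `ℝ`). -/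
def weighted (ν : ℂ) (f : ℂ → V) (p : OnePoint ℂ) : V :=
  p.elim 0 fun z => (1 + z ^ 2) ^ (ν + 1 / 2) • f z

end

end LewisHyp

/-!
Since `Γ` has finite index and `η` is trivial on its parabolic elements, `η (T ^ N) = 1` for some
`N > 0`. The restriction to `ℝ` of an automorphic hyperfunction, divided by the weight, is then
invariant under `z ↦ z + N` and descends along `q = exp (2πiz / N)` to the unit circle. There a
Laurent splitting, given by Cauchy integrals over two circles, produces a boundary function
holomorphic off the circle, which pulls back to a function holomorphic on `ℂ ∖ ℝ` with limits at
`±i∞`; adding a constant makes these limits opposite. Two such functions for the same hyperfunction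
differ by a bounded periodic entire function whose limits at `±i∞` are opposite, hence by `0`. This
uniqueness gives the equivariance under `z ↦ z + 1`, and invariance under `S` on `(0, ∞)` is the
extension of `f(z) - z^(-2ν-1) η(S) f(-1/z)` to the slit plane.

Conversely, let `f` satisfy these conditions. The extension condition says that `f` is compatible
with `S` on `(0, ∞)`, hence, `S` being an involution, on `ℝ ∖ {0}`. As hyperfunctions glue, `f`
and its image under `S`, which lives near `∞`, define one `S`-invariant hyperfunction `α` on
`ℙ¹(ℝ)`. Then `β = Tα - α` is supported at `∞`. The translates of `Tα - α` under the powers of `TS`,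
which has order three, sum to zero as `Sα = α`; of these only `β` itself can be nonzero near `∞`,
so `β = 0`. Finally `α` is determined by its restriction to `ℝ`, because `S` maps `∞` to `0`.
-/

namespace LewisHyp

section Cauchy

variable {V : Type*} [NormedAddCommGroup V] [NormedSpace ℂ V]
  {α : Type*} [MeasurableSpace α] {μ : MeasureTheory.Measure α} {γ : α → ℂ} {φ : α → V}

/-- The Cauchy transform `z ↦ ∫ φ / (γ - z) dμ` of the density `φ` along the map `γ`. With `γ` a
parametrised curve and `μ` Lebesgue measure on an interval, this is a Cauchy integral along the
curve. -/
noncomputable def cauchyTransform (μ : MeasureTheory.Measure α) (γ : α → ℂ) (φ : α → V) (z : ℂ) :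
    V :=
  ∫ a, (γ a - z)⁻¹ • φ a ∂μ

theorem aestronglyMeasurable_inv_sub_smul (hγ : AEMeasurable γ μ)
    (hφ : MeasureTheory.AEStronglyMeasurable φ μ) (z : ℂ) :
    MeasureTheory.AEStronglyMeasurable (fun a => (γ a - z)⁻¹ • φ a) μ :=
  (hγ.sub_const z).inv.aestronglyMeasurable.smul hφ

theorem integrable_inv_sub_smul (hγ : AEMeasurable γ μ) (hφ : MeasureTheory.Integrable φ μ)
    {z : ℂ} {δ : ℝ} (hδ : 0 < δ) (hfar : ∀ᵐ a ∂μ, δ ≤ ‖γ a - z‖) :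
    MeasureTheory.Integrable (fun a => (γ a - z)⁻¹ • φ a) μ := by
  refine (hφ.norm.const_mul δ⁻¹).mono' (aestronglyMeasurable_inv_sub_smul hγ hφ.1 z) ?_
  filter_upwards [hfar] with a ha
  rw [norm_smul, norm_inv]
  gcongr

theorem differentiableAt_cauchyTransform (hγ : AEMeasurable γ μ)
    (hφ : MeasureTheory.Integrable φ μ) {z : ℂ} {δ : ℝ} (hδ : 0 < δ)
    (hfar : ∀ᵐ a ∂μ, ∀ w ∈ Metric.ball z δ, δ ≤ ‖γ a - w‖) :
    DifferentiableAt ℂ (cauchyTransform μ γ φ) z := by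
  refine (hasDerivAt_integral_of_dominated_loc_of_deriv_le
    (F := fun w a => (γ a - w)⁻¹ • φ a) (F' := fun w a => ((γ a - w) ^ 2)⁻¹ • φ a)
    (bound := fun a => (δ ^ 2)⁻¹ * ‖φ a‖) (Metric.ball_mem_nhds z hδ)
    (.of_forall (aestronglyMeasurable_inv_sub_smul hγ hφ.1))
    (integrable_inv_sub_smul hγ hφ hδ (hfar.mono fun a ha => ha z (Metric.mem_ball_self hδ)))
    (((hγ.sub_const z).pow_const 2).inv.aestronglyMeasurable.smul hφ.1) ?_
    (hφ.norm.const_mul _) ?_).2.differentiableAt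
  · filter_upwards [hfar] with a ha w hw
    rw [norm_smul, norm_inv, norm_pow]
    have := ha w hw
    gcongr
  · filter_upwards [hfar] with a ha w hw
    have hne : γ a - w ≠ 0 := norm_pos_iff.1 (hδ.trans_le (ha w hw))
    have h : HasDerivAt (fun w : ℂ => (γ a - w)⁻¹) (((γ a - w) ^ 2)⁻¹) w := by
      simpa using ((hasDerivAt_id w).const_sub (γ a)).fun_inv hne
    exact h.smul_const (φ a)

theorem analyticAt_cauchyTransform [CompleteSpace V] (hγ : AEMeasurable γ μ)
    (hφ : MeasureTheory.Integrable φ μ) {K : Set ℂ} (hK : IsClosed K) (hγK : ∀ᵐ a ∂μ, γ a ∈ K)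
    {z : ℂ} (hz : z ∉ K) : AnalyticAt ℂ (cauchyTransform μ γ φ) z := by
  have hd : DifferentiableOn ℂ (cauchyTransform μ γ φ) Kᶜ := fun w hw => by
    obtain ⟨ε, hε, hball⟩ := Metric.isOpen_iff.1 hK.isOpen_compl w hw
    refine (differentiableAt_cauchyTransform hγ hφ (half_pos hε)
      (hγK.mono fun a ha v hv => ?_)).differentiableWithinAt
    have h1 : ε ≤ dist (γ a) w := not_lt.1 fun h => hball (Metric.mem_ball.2 h) ha
    rw [← dist_eq_norm]
    linarith [dist_triangle (γ a) v w, Metric.mem_ball.1 hv]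
  exact hd.analyticAt (hK.isOpen_compl.mem_nhds hz)

theorem tendsto_cauchyTransform_cobounded (hγ : AEMeasurable γ μ)
    (hφ : MeasureTheory.Integrable φ μ) {R : ℝ} (hR : ∀ᵐ a ∂μ, ‖γ a‖ ≤ R) :
    Filter.Tendsto (cauchyTransform μ γ φ) (Bornology.cobounded ℂ) (𝓝 0) := by
  have hgen : (Bornology.cobounded ℂ).IsCountablyGenerated := by
    rw [← comap_norm_atTop]
    infer_instance
  have hlim : ∀ a, Filter.Tendsto (fun z : ℂ => (γ a - z)⁻¹ • φ a) (Bornology.cobounded ℂ)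
      (𝓝 0) := fun a => by
    simpa using (Filter.tendsto_inv₀_cobounded.comp
      (tendsto_const_sub_cobounded (γ a))).smul_const (φ a)
  rw [← MeasureTheory.integral_zero α V (μ := μ)]
  refine MeasureTheory.tendsto_integral_filter_of_dominated_convergence (fun a => ‖φ a‖)
    (.of_forall (aestronglyMeasurable_inv_sub_smul hγ hφ.1)) ?_ hφ.norm (.of_forall hlim)
  filter_upwards [tendsto_norm_cobounded_atTop.eventually (Filter.eventually_ge_atTop (R + 1))]
    with z hz
  filter_upwards [hR] with a ha
  have h1 : 1 ≤ ‖γ a - z‖ := by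
    linarith [norm_sub_norm_le z (γ a), norm_sub_rev z (γ a)]
  rw [norm_smul, norm_inv]
  exact mul_le_of_le_one_left (norm_nonneg _) (inv_le_one_of_one_le₀ h1)

end Cauchy

section CircleCauchy

variable {V : Type*} [NormedAddCommGroup V] [NormedSpace ℂ V] {c z : ℂ} {r R : ℝ} {h : ℂ → V}

/-- The Cauchy integral of `h` along the circle of centre `c` and radius `R`. -/
noncomputable def circleCauchy (c : ℂ) (R : ℝ) (h : ℂ → V) (z : ℂ) : V :=
  (2 * Real.pi * Complex.I : ℂ)⁻¹ • ∮ w in C(c, R), (w - z)⁻¹ • h w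

/-- The density of the Cauchy integral along a circle with respect to the angle. -/
noncomputable def circleDensity (c : ℂ) (R : ℝ) (h : ℂ → V) (θ : ℝ) : V :=
  (2 * Real.pi * Complex.I : ℂ)⁻¹ • deriv (circleMap c R) θ • h (circleMap c R θ)

theorem circleCauchy_eq_cauchyTransform (c : ℂ) (R : ℝ) (h : ℂ → V) :
    circleCauchy c R h = cauchyTransform
      (MeasureTheory.volume.restrict (Set.Ioc 0 (2 * Real.pi))) (circleMap c R)
      (circleDensity c R h) := by
  ext z
  rw [circleCauchy, circleIntegral, intervalIntegral.integral_of_le Real.two_pi_pos.le,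
    ← MeasureTheory.integral_smul, cauchyTransform]
  congr 1
  ext θ
  rw [circleDensity, smul_comm (deriv (circleMap c R) θ), smul_comm (_⁻¹ : ℂ) (_ : ℂ)]

theorem continuous_circleDensity (hR : 0 ≤ R) (hh : ContinuousOn h (Metric.sphere c R)) :
    Continuous (circleDensity c R h) := by
  have h1 : Continuous fun θ => h (circleMap c R θ) :=
    hh.comp_continuous (continuous_circleMap c R) (circleMap_mem_sphere c hR)
  have h2 : Continuous (deriv (circleMap c R)) := by
    simp only [funext (deriv_circleMap c R)]
    fun_prop
  exact (h2.smul h1).const_smul _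

theorem integrableOn_circleDensity (hR : 0 ≤ R) (hh : ContinuousOn h (Metric.sphere c R)) :
    MeasureTheory.IntegrableOn (circleDensity c R h) (Set.Ioc 0 (2 * Real.pi)) :=
  (continuous_circleDensity hR hh).integrableOn_Ioc

theorem analyticAt_circleCauchy [CompleteSpace V] (hR : 0 ≤ R)
    (hh : ContinuousOn h (Metric.sphere c R)) (hz : ‖z - c‖ ≠ R) :
    AnalyticAt ℂ (circleCauchy c R h) z := by
  rw [circleCauchy_eq_cauchyTransform]
  exact analyticAt_cauchyTransform (continuous_circleMap c R).aemeasurable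
    (integrableOn_circleDensity hR hh) Metric.isClosed_sphere
    (.of_forall (circleMap_mem_sphere c hR)) (by rwa [mem_sphere_iff_norm])

theorem tendsto_circleCauchy_cobounded (hR : 0 ≤ R) (hh : ContinuousOn h (Metric.sphere c R)) :
    Filter.Tendsto (circleCauchy c R h) (Bornology.cobounded ℂ) (𝓝 0) := by
  rw [circleCauchy_eq_cauchyTransform]
  refine tendsto_cauchyTransform_cobounded (R := ‖c‖ + R) (continuous_circleMap c R).aemeasurable
    (integrableOn_circleDensity hR hh) (.of_forall fun θ => ?_)
  have h1 := mem_sphere_iff_norm.1 (circleMap_mem_sphere c hR θ)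
  linarith [norm_le_norm_add_norm_sub' (circleMap c R θ) c]

theorem circleCauchy_of_mem_ball [CompleteSpace V]
    (hh : ∀ w ∈ Metric.closedBall c R, AnalyticAt ℂ h w) (hz : z ∈ Metric.ball c R) :
    circleCauchy c R h z = h z :=
  Complex.two_pi_I_inv_smul_circleIntegral_sub_inv_smul_of_differentiable_on_off_countable
    Set.countable_empty hz (fun w hw => (hh w hw).continuousAt.continuousWithinAt)
    fun w hw => (hh w (Metric.ball_subset_closedBall hw.1)).differentiableAt

theorem circleIntegral_sub_inv_smul_of_notMem_closedBall (hR : 0 ≤ R)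
    (hh : ∀ w ∈ Metric.closedBall c R, AnalyticAt ℂ h w) (hz : z ∉ Metric.closedBall c R) :
    ∮ w in C(c, R), (w - z)⁻¹ • h w = 0 := by
  have ha : ∀ w ∈ Metric.closedBall c R, AnalyticAt ℂ (fun w => (w - z)⁻¹ • h w) w := fun w hw =>
    ((analyticAt_id.sub analyticAt_const).inv (sub_ne_zero.2 (ne_of_mem_of_not_mem hw hz))).smul
      (hh w hw)
  exact Complex.circleIntegral_eq_zero_of_differentiable_on_off_countable hR
    Set.countable_empty (fun w hw => (ha w hw).continuousAt.continuousWithinAt)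
    fun w hw => (ha w (Metric.ball_subset_closedBall hw.1)).differentiableAt

theorem circleCauchy_of_notMem_closedBall (hR : 0 ≤ R)
    (hh : ∀ w ∈ Metric.closedBall c R, AnalyticAt ℂ h w) (hz : z ∉ Metric.closedBall c R) :
    circleCauchy c R h z = 0 := by
  rw [circleCauchy, circleIntegral_sub_inv_smul_of_notMem_closedBall hR hh hz, smul_zero]

theorem circleIntegral_dslope [CompleteSpace V] (hR : 0 ≤ R)
    (hh : ContinuousOn h (Metric.sphere c R)) (hz : z ∉ Metric.sphere c R) :
    ∮ w in C(c, R), dslope h z w =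
      (∮ w in C(c, R), (w - z)⁻¹ • h w) - (∮ w in C(c, R), (w - z)⁻¹) • h z := by
  have hcz : ∀ w ∈ Metric.sphere c R, w ≠ z := fun w hw => ne_of_mem_of_not_mem hw hz
  have hinv : ContinuousOn (fun w : ℂ => (w - z)⁻¹) (Metric.sphere c R) :=
    ContinuousOn.inv₀ (by fun_prop) fun w hw => sub_ne_zero.2 (hcz w hw)
  have hi₁ : CircleIntegrable (fun w => (w - z)⁻¹ • h w) c R := (hinv.smul hh).circleIntegrable hR
  have hi₂ : CircleIntegrable (fun w => (w - z)⁻¹ • h z) c R :=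
    (hinv.smul continuousOn_const).circleIntegrable hR
  rw [← circleIntegral.integral_smul_const, ← circleIntegral.integral_sub hi₁ hi₂]
  refine circleIntegral.integral_congr hR fun w hw => ?_
  rw [dslope_of_ne _ (hcz w hw), slope_def_module, smul_sub]

theorem circleIntegral_dslope_eq_of_annulus (hr : 0 < r) (hrz : r < ‖z - c‖)
    (hzR : ‖z - c‖ < R) (hh : ∀ w, r ≤ ‖w - c‖ → ‖w - c‖ ≤ R → AnalyticAt ℂ h w) :
    ∮ w in C(c, R), dslope h z w = ∮ w in C(c, r), dslope h z w := by
  have han : ∀ w ∈ Metric.closedBall c R \ Metric.ball c r, AnalyticAt ℂ h w := fun w hw =>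
    hh w (by simpa [dist_eq_norm] using hw.2) (mem_closedBall_iff_norm.1 hw.1)
  have hnhds : Metric.closedBall c R \ Metric.ball c r ∈ 𝓝 z := by
    filter_upwards [Metric.isOpen_ball.mem_nhds (mem_ball_iff_norm.2 hzR),
      Metric.isClosed_closedBall.isOpen_compl.mem_nhds
        (show z ∉ Metric.closedBall c r by rw [mem_closedBall_iff_norm]; exact hrz.not_ge)]
      with w h1 h2
    exact ⟨Metric.ball_subset_closedBall h1, fun h3 => h2 (Metric.ball_subset_closedBall h3)⟩
  refine Complex.circleIntegral_eq_of_differentiable_on_annulus_off_countable hr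
    (hrz.trans hzR).le (Set.countable_singleton z) ?_ ?_
  · exact (continuousOn_dslope hnhds).2 ⟨fun w hw => (han w hw).continuousAt.continuousWithinAt,
      (han z (mem_of_mem_nhds hnhds)).differentiableAt⟩
  · rintro w ⟨⟨hw1, hw2⟩, hw3⟩
    exact (differentiableAt_dslope_of_ne (by simpa using hw3)).2
      (han w ⟨Metric.ball_subset_closedBall hw1, fun hw' =>
        hw2 (Metric.ball_subset_closedBall hw')⟩).differentiableAt

theorem circleCauchy_sub_of_mem_annulus [CompleteSpace V] (hr : 0 < r) (hrz : r < ‖z - c‖)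
    (hzR : ‖z - c‖ < R) (hh : ∀ w, r ≤ ‖w - c‖ → ‖w - c‖ ≤ R → AnalyticAt ℂ h w) :
    circleCauchy c R h z - circleCauchy c r h z = h z := by
  have hrR : r < R := hrz.trans hzR
  have hcont : ∀ ρ, r ≤ ρ → ρ ≤ R → ContinuousOn h (Metric.sphere c ρ) := fun ρ h1 h2 w hw => by
    rw [mem_sphere_iff_norm] at hw
    exact (hh w (hw ▸ h1) (hw ▸ h2)).continuousAt.continuousWithinAt
  have houter : ∮ w in C(c, R), (w - z)⁻¹ = 2 * Real.pi * Complex.I :=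
    circleIntegral.integral_sub_inv_of_mem_ball (mem_ball_iff_norm.2 hzR)
  have hinner : ∮ w in C(c, r), (w - z)⁻¹ = 0 := by
    simpa using circleIntegral_sub_inv_smul_of_notMem_closedBall (h := fun _ => (1 : ℂ)) hr.le
      (fun _ _ => analyticAt_const) (by rw [mem_closedBall_iff_norm]; exact hrz.not_ge)
  have key := circleIntegral_dslope_eq_of_annulus hr hrz hzR hh
  rw [circleIntegral_dslope (hr.trans hrR).le (hcont R hrR.le le_rfl)
      (by rw [mem_sphere_iff_norm]; exact hzR.ne),
    circleIntegral_dslope hr.le (hcont r le_rfl hrR.le)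
      (by rw [mem_sphere_iff_norm]; exact hrz.ne'), houter, hinner, zero_smul, sub_zero] at key
  rw [circleCauchy, circleCauchy, ← smul_sub, ← key, sub_sub_cancel,
    inv_smul_smul₀ (by simp [Real.pi_ne_zero])]

end CircleCauchy

section HalfPlaneSplitting

variable {V : Type*} [NormedAddCommGroup V] [NormedSpace ℂ V] {c : ℂ} {h : ℂ → V}

/-- The part of the Cauchy integral along a circle that comes from the angles in `s`. -/
noncomputable def arcCauchy (c : ℂ) (R : ℝ) (h : ℂ → V) (s : Set ℝ) : ℂ → V :=
  cauchyTransform (MeasureTheory.volume.restrict (Set.Ioc 0 (2 * Real.pi) ∩ s)) (circleMap c R)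
    (circleDensity c R h)

theorem arcCauchy_add_arcCauchy_compl {R : ℝ} (hR : 0 ≤ R)
    (hh : ContinuousOn h (Metric.sphere c R)) {s : Set ℝ} (hs : MeasurableSet s) {z : ℂ}
    (hz : ‖z - c‖ ≠ R) : arcCauchy c R h s z + arcCauchy c R h sᶜ z = circleCauchy c R h z := by
  rw [circleCauchy_eq_cauchyTransform]
  have hcont : Continuous fun θ => (circleMap c R θ - z)⁻¹ • circleDensity c R h θ :=
    Continuous.smul (Continuous.inv₀ (by fun_prop) fun θ => sub_ne_zero.2 (ne_of_mem_of_not_mem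
      (circleMap_mem_sphere c hR θ) (by rwa [mem_sphere_iff_norm])))
      (continuous_circleDensity hR hh)
  exact MeasureTheory.integral_inter_add_sdiff hs hcont.integrableOn_Ioc

theorem analyticAt_arcCauchy [CompleteSpace V] {R : ℝ} (hR : 0 ≤ R)
    (hh : ContinuousOn h (Metric.sphere c R)) {s : Set ℝ} (hs : MeasurableSet s) {K : Set ℂ}
    (hK : IsClosed K) (hsK : ∀ θ ∈ s, circleMap c R θ ∈ K) {z : ℂ}
    (hz : z ∈ K → ‖z - c‖ ≠ R) : AnalyticAt ℂ (arcCauchy c R h s) z := by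
  refine analyticAt_cauchyTransform (continuous_circleMap c R).aemeasurable
    ((integrableOn_circleDensity hR hh).mono_set Set.inter_subset_left)
    (hK.inter (Metric.isClosed_sphere (x := c) (ε := R))) ?_ fun hz' =>
      hz hz'.1 (mem_sphere_iff_norm.1 hz'.2)
  filter_upwards [MeasureTheory.ae_restrict_mem (measurableSet_Ioc.inter hs)] with θ hθ
  exact ⟨hsK θ hθ.2, circleMap_mem_sphere c hR θ⟩

/-- Cut the Cauchy integral along a small circle around `c` into its right and left halves. -/
theorem exists_halfPlane_splitting [CompleteSpace V] (hh : AnalyticAt ℂ h c) {ε : ℝ}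
    (hε : 0 < ε) : ∃ A B : ℂ → V,
      (∀ z, z.re < c.re ∨ z = c ∨ ε ≤ ‖z - c‖ → AnalyticAt ℂ A z) ∧
      (∀ z, c.re < z.re ∨ z = c ∨ ε ≤ ‖z - c‖ → AnalyticAt ℂ B z) ∧
      (∀ᶠ z in 𝓝 c, A z + B z = h z) ∧ ∀ z, ε ≤ ‖z - c‖ → A z + B z = 0 := by
  obtain ⟨δ, hδ, hball⟩ := Metric.eventually_nhds_iff_ball.1 hh.eventually_analyticAt
  obtain ⟨ρ, hρ, hρlt⟩ := exists_between (lt_min hδ hε)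
  obtain ⟨hρδ, hρε⟩ := lt_min_iff.1 hρlt
  have han : ∀ w ∈ Metric.closedBall c ρ, AnalyticAt ℂ h w := fun w hw =>
    hball w (Metric.closedBall_subset_ball hρδ hw)
  have hcont : ContinuousOn h (Metric.sphere c ρ) := fun w hw =>
    (han w (Metric.sphere_subset_closedBall hw)).continuousAt.continuousWithinAt
  have hre : Continuous fun θ => (circleMap c ρ θ).re :=
    Complex.continuous_re.comp (continuous_circleMap c ρ)
  have hs : MeasurableSet {θ | c.re ≤ (circleMap c ρ θ).re} :=
    (isClosed_le continuous_const hre).measurableSet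
  have hoff : ∀ {z}, z = c ∨ ε ≤ ‖z - c‖ → ‖z - c‖ ≠ ρ := by
    rintro z (rfl | hz)
    · simpa using hρ.ne
    · exact (hρε.trans_le hz).ne'
  refine ⟨arcCauchy c ρ h {θ | c.re ≤ (circleMap c ρ θ).re},
    arcCauchy c ρ h {θ | c.re ≤ (circleMap c ρ θ).re}ᶜ, fun z hz => ?_, fun z hz => ?_, ?_,
    fun z hz => ?_⟩
  · exact analyticAt_arcCauchy hρ.le hcont hs (isClosed_le continuous_const Complex.continuous_re)
      (fun _ hθ => hθ) fun hzK => hoff (hz.resolve_left (not_lt.2 hzK))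
  · exact analyticAt_arcCauchy hρ.le hcont hs.compl
      (isClosed_le Complex.continuous_re continuous_const)
      (fun θ hθ => (not_le.1 hθ : (circleMap c ρ θ).re < c.re).le) fun hzK =>
        hoff (hz.resolve_left (not_lt.2 hzK))
  · filter_upwards [Metric.ball_mem_nhds c hρ] with z hz
    rw [arcCauchy_add_arcCauchy_compl hρ.le hcont hs (mem_ball_iff_norm.1 hz).ne,
      circleCauchy_of_mem_ball han hz]
  · rw [arcCauchy_add_arcCauchy_compl hρ.le hcont hs (hoff (.inr hz)),
      circleCauchy_of_notMem_closedBall hρ.le han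
        (by rw [mem_closedBall_iff_norm]; exact (hρε.trans_le hz).not_ge)]

end HalfPlaneSplitting

section Local

variable {V W : Type*} [NormedAddCommGroup V] [NormedSpace ℂ V] [NormedAddCommGroup W]
  [NormedSpace ℂ W]

/-- Off the set `C`, the function `φ` agrees near `u` with a function that is analytic at `u`. With
`C` a curve, this says that the boundary function `φ` represents the zero hyperfunction near `u`. -/
def ExtAt (C : Set ℂ) (φ : ℂ → V) (u : ℂ) : Prop :=
  ∃ h : ℂ → V, AnalyticAt ℂ h u ∧ ∀ᶠ w in 𝓝 u, w ∉ C → φ w = h w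

/-- Near `u`, the function `φ` is analytic off the set `C`. With `C` a curve, this says that `φ` is
a boundary function near `u`. -/
def AnalyticOffAt (C : Set ℂ) (φ : ℂ → V) (u : ℂ) : Prop :=
  ∀ᶠ w in 𝓝 u, w ∉ C → AnalyticAt ℂ φ w

variable {C D : Set ℂ} {φ ψ : ℂ → V} {u : ℂ}

theorem ExtAt.of_analyticAt (h : AnalyticAt ℂ φ u) : ExtAt C φ u :=
  ⟨φ, h, .of_forall fun _ _ => rfl⟩

theorem ExtAt.congr (h : ExtAt C φ u) (e : ∀ᶠ w in 𝓝 u, w ∉ C → ψ w = φ w) : ExtAt C ψ u := by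
  obtain ⟨k, hk, h⟩ := h
  refine ⟨k, hk, ?_⟩
  filter_upwards [h, e] with w h1 h2 hw using (h2 hw).trans (h1 hw)

theorem ExtAt.add (h : ExtAt C φ u) (h' : ExtAt C ψ u) : ExtAt C (fun w => φ w + ψ w) u := by
  obtain ⟨k, hk, h⟩ := h
  obtain ⟨k', hk', h'⟩ := h'
  refine ⟨fun w => k w + k' w, hk.add hk', ?_⟩
  filter_upwards [h, h'] with w h1 h2 hw
  rw [h1 hw, h2 hw]

theorem ExtAt.smul {s : ℂ → ℂ} (hs : AnalyticAt ℂ s u) (h : ExtAt C φ u) :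
    ExtAt C (fun w => s w • φ w) u := by
  obtain ⟨k, hk, h⟩ := h
  refine ⟨fun w => s w • k w, hs.smul hk, ?_⟩
  filter_upwards [h] with w h1 hw
  rw [h1 hw]

theorem ExtAt.neg (h : ExtAt C φ u) : ExtAt C (fun w => -φ w) u := by
  simpa using h.smul (s := fun _ => -1) analyticAt_const

theorem ExtAt.sub (h : ExtAt C φ u) (h' : ExtAt C ψ u) : ExtAt C (fun w => φ w - ψ w) u := by
  simpa only [sub_eq_add_neg] using h.add h'.neg

theorem ExtAt.linear [FiniteDimensional ℂ V] (L : V →ₗ[ℂ] W) (h : ExtAt C φ u) :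
    ExtAt C (fun w => L (φ w)) u := by
  obtain ⟨k, hk, h⟩ := h
  refine ⟨fun w => L (k w), ((LinearMap.toContinuousLinearMap L).analyticAt _).fun_comp hk, ?_⟩
  filter_upwards [h] with w h1 hw
  rw [h1 hw]

theorem ExtAt.comp {k : ℂ → ℂ} (h : ExtAt C φ (k u)) (hk : AnalyticAt ℂ k u)
    (hD : ∀ᶠ w in 𝓝 u, w ∉ D → k w ∉ C) : ExtAt D (fun w => φ (k w)) u := by
  obtain ⟨l, hl, h⟩ := h
  refine ⟨fun w => l (k w), hl.fun_comp hk, ?_⟩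
  filter_upwards [hk.continuousAt.eventually h, hD] with w h1 h2 hw using h1 (h2 hw)

theorem ExtAt.analyticOffAt [CompleteSpace V] (hC : IsClosed C) (h : ExtAt C φ u) :
    AnalyticOffAt C φ u := by
  obtain ⟨k, hk, h⟩ := h
  filter_upwards [hk.eventually_analyticAt, h.eventually_nhds] with w h1 h2 hw
  refine h1.congr ?_
  filter_upwards [h2, hC.isOpen_compl.mem_nhds hw] with v h3 h4 using (h3 h4).symm

theorem AnalyticOffAt.add (h : AnalyticOffAt C φ u) (h' : AnalyticOffAt C ψ u) :
    AnalyticOffAt C (fun w => φ w + ψ w) u := by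
  filter_upwards [h, h'] with w h1 h2 hw using (h1 hw).add (h2 hw)

theorem AnalyticOffAt.smul {s : ℂ → ℂ} (hs : AnalyticAt ℂ s u) (h : AnalyticOffAt C φ u) :
    AnalyticOffAt C (fun w => s w • φ w) u := by
  filter_upwards [h, hs.eventually_analyticAt] with w h1 h2 hw using h2.smul (h1 hw)

theorem AnalyticOffAt.comp {k : ℂ → ℂ} (h : AnalyticOffAt C φ (k u)) (hk : AnalyticAt ℂ k u)
    (hD : ∀ᶠ w in 𝓝 u, w ∉ D → k w ∉ C) : AnalyticOffAt D (fun w => φ (k w)) u := by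
  filter_upwards [hk.continuousAt.eventually h, hD, hk.eventually_analyticAt] with w h1 h2 h3 hw
    using (h1 (h2 hw)).fun_comp h3

theorem exists_extension_of_dense_compl {X E : Type*} [TopologicalSpace X]
    [NormedAddCommGroup E] {C : Set X} (hC : Dense Cᶜ) (φ : X → E) :
    ∃ ψ : X → E, (∀ p ∉ C, ψ p = φ p) ∧ ∀ (p : X) (h : X → E), (∀ᶠ q in 𝓝 p, ContinuousAt h q) →
      (∀ᶠ q in 𝓝 p, q ∉ C → φ q = h q) → ∀ᶠ q in 𝓝 p, ψ q = h q := by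
  classical
  refine ⟨fun p => if p ∈ C then Filter.limUnder (𝓝[Cᶜ] p) φ else φ p, fun p hp => if_neg hp,
    fun p h hcont heq => ?_⟩
  filter_upwards [hcont, heq.eventually_nhds, heq] with q h1 h2 h3
  by_cases hq : q ∈ C
  · rw [if_pos hq]
    have : (𝓝[Cᶜ] q).NeBot := mem_closure_iff_nhdsWithin_neBot.1 (hC q)
    refine Filter.Tendsto.limUnder_eq ((h1.tendsto.mono_left nhdsWithin_le_nhds).congr' ?_)
    filter_upwards [mem_nhdsWithin_of_mem_nhds h2, self_mem_nhdsWithin] with w h4 h5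
    exact (h4 h5).symm
  · rw [if_neg hq, h3 hq]

theorem exists_analytic_extension [CompleteSpace V] (hC : Dense Cᶜ) {Ω : Set ℂ}
    (hφ : ∀ z ∈ Ω, ExtAt C φ z) :
    ∃ ψ : ℂ → V, (∀ z ∈ Ω, AnalyticAt ℂ ψ z) ∧ ∀ z ∉ C, ψ z = φ z := by
  obtain ⟨ψ, h1, h2⟩ := exists_extension_of_dense_compl hC φ
  refine ⟨ψ, fun z hz => ?_, h1⟩
  obtain ⟨h, ha, he⟩ := hφ z hz
  refine ha.congr ?_
  filter_upwards [h2 z h (ha.eventually_analyticAt.mono fun _ hw => hw.continuousAt) he] with w hw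
    using hw.symm

theorem exists_piecewise_of_continuous {X E : Type*} [TopologicalSpace X] {k : X → ℝ}
    (hk : Continuous k) {S C : Set X} {f g : X → E}
    (hfg : ∀ u ∈ S, k u = 0 → ∀ᶠ w in 𝓝 u, w ∉ C → f w = g w) :
    ∃ F : X → E, (∀ u ∈ S, 0 ≤ k u → ∀ᶠ w in 𝓝 u, w ∉ C → F w = f w) ∧
      ∀ u ∈ S, k u ≤ 0 → ∀ᶠ w in 𝓝 u, w ∉ C → F w = g w := by
  classical
  refine ⟨fun w => if 0 ≤ k w then f w else g w, fun u hu hpos => ?_, fun u hu hneg => ?_⟩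
  · rcases hpos.eq_or_lt with h0 | h0
    · filter_upwards [hfg u hu h0.symm] with w h1 hw
      split_ifs
      exacts [rfl, (h1 hw).symm]
    · filter_upwards [hk.continuousAt.eventually_const_lt h0] with w h1 _ using if_pos h1.le
  · rcases hneg.eq_or_lt with h0 | h0
    · filter_upwards [hfg u hu h0] with w h1 hw
      split_ifs
      exacts [h1 hw, rfl]
    · filter_upwards [hk.continuousAt.eventually_lt_const h0] with w h1 _ using if_neg h1.not_ge

end Local

section Circle

variable {V : Type*} [NormedAddCommGroup V] [NormedSpace ℂ V]

/-- The unit circle. -/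
abbrev unitCircle : Set ℂ := {z | ‖z‖ = 1}

theorem isClosed_unitCircle : IsClosed unitCircle := isClosed_eq continuous_norm continuous_const

theorem eq_I_or_eq_neg_I {u : ℂ} (hu : ‖u‖ = 1) (h : u.re = 0) :
    u = Complex.I ∨ u = -Complex.I := by
  have him : |u.im| = 1 := by rw [← hu, ← Complex.re_add_im u, h]; simp
  exact (eq_or_eq_neg_of_abs_eq him).imp (fun h1 => Complex.ext (by simpa) (by simpa))
    fun h1 => Complex.ext (by simpa) (by simpa)

theorem norm_I_sub_neg_I : ‖(Complex.I - -Complex.I : ℂ)‖ = 2 := by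
  rw [sub_neg_eq_add, ← two_mul, norm_mul, Complex.norm_I]
  simp

/-- The four disjuncts of the splittings at `I` and `-I` are met on a closed half of the circle,
because either of these points is at distance `2` from the other. -/
theorem exists_circle_splitting [CompleteSpace V] {φ : ℂ → V}
    (h₁ : ExtAt unitCircle φ Complex.I) (h₂ : ExtAt unitCircle φ (-Complex.I)) :
    ∃ A B : ℂ → V, (∀ u ∈ unitCircle, u.re ≤ 0 → AnalyticAt ℂ A u) ∧
      (∀ u ∈ unitCircle, 0 ≤ u.re → AnalyticAt ℂ B u) ∧
      ∀ u ∈ unitCircle, u.re = 0 → ∀ᶠ w in 𝓝 u, w ∉ unitCircle → A w + B w = φ w := by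
  obtain ⟨d₁, hd₁, hφ₁⟩ := h₁
  obtain ⟨d₂, hd₂, hφ₂⟩ := h₂
  obtain ⟨A₁, B₁, hA₁, hB₁, hnear₁, hfar₁⟩ := exists_halfPlane_splitting hd₁ one_pos
  obtain ⟨A₂, B₂, hA₂, hB₂, hnear₂, hfar₂⟩ := exists_halfPlane_splitting hd₂ one_pos
  have hdist : (1 : ℝ) < ‖(Complex.I - -Complex.I : ℂ)‖ := by
    rw [norm_I_sub_neg_I]; norm_num
  have hdist' : (1 : ℝ) < ‖(-Complex.I - Complex.I : ℂ)‖ := by rwa [norm_sub_rev]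
  have hcont : ∀ a u : ℂ, ContinuousAt (fun w : ℂ => ‖w - a‖) u := fun a u => by fun_prop
  refine ⟨fun w => A₁ w + A₂ w, fun w => B₁ w + B₂ w, fun u hu hre => ?_, fun u hu hre => ?_,
    fun u hu hre => ?_⟩
  · rcases hre.lt_or_eq with h0 | h0
    · exact (hA₁ u (.inl (by simpa))).add (hA₂ u (.inl (by simpa)))
    · rcases eq_I_or_eq_neg_I hu h0 with rfl | rfl
      · exact (hA₁ _ (.inr (.inl rfl))).add (hA₂ _ (.inr (.inr hdist.le)))
      · exact (hA₁ _ (.inr (.inr hdist'.le))).add (hA₂ _ (.inr (.inl rfl)))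
  · rcases hre.lt_or_eq with h0 | h0
    · exact (hB₁ u (.inl (by simpa))).add (hB₂ u (.inl (by simpa)))
    · rcases eq_I_or_eq_neg_I hu h0.symm with rfl | rfl
      · exact (hB₁ _ (.inr (.inl rfl))).add (hB₂ _ (.inr (.inr hdist.le)))
      · exact (hB₁ _ (.inr (.inr hdist'.le))).add (hB₂ _ (.inr (.inl rfl)))
  · rcases eq_I_or_eq_neg_I hu hre with rfl | rfl
    · filter_upwards [hφ₁, hnear₁, (hcont _ _).eventually_const_lt hdist] with w h1 h2 h3 hw
      rw [h1 hw, ← h2, add_add_add_comm, hfar₂ w h3.le, add_zero]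
    · filter_upwards [hφ₂, hnear₂, (hcont _ _).eventually_const_lt hdist'] with w h1 h2 h3 hw
      rw [h1 hw, ← h2, add_add_add_comm, hfar₁ w h3.le, zero_add]

theorem exists_glue_on_circle [CompleteSpace V] {F₁ F₂ : ℂ → V}
    (h : ∀ u ∈ unitCircle, u ≠ 1 → u ≠ -1 → ExtAt unitCircle (fun w => F₁ w - F₂ w) u) :
    ∃ F : ℂ → V, (∀ u ∈ unitCircle, u ≠ -1 → ExtAt unitCircle (fun w => F w - F₁ w) u) ∧
      ∀ u ∈ unitCircle, u ≠ 1 → ExtAt unitCircle (fun w => F w - F₂ w) u := by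
  obtain ⟨A, B, hA, hB, hAB⟩ := exists_circle_splitting
    (h Complex.I (by simp) (fun e => by simpa using congrArg Complex.re e)
      fun e => by simpa using congrArg Complex.re e)
    (h (-Complex.I) (by simp) (fun e => by simpa using congrArg Complex.re e)
      fun e => by simpa using congrArg Complex.re e)
  obtain ⟨F, hF₁, hF₂⟩ := exists_piecewise_of_continuous Complex.continuous_re (S := unitCircle)
    (C := unitCircle) (f := fun w => F₁ w - B w) (g := fun w => F₂ w + A w) fun u hu hre => by
      filter_upwards [hAB u hu hre] with w h1 hw
      rw [sub_eq_iff_eq_add, add_assoc, h1 hw, add_sub_cancel]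
  refine ⟨F, fun u hu hu1 => ?_, fun u hu hu1 => ?_⟩
  · rcases le_or_gt 0 u.re with hre | hre
    · refine (ExtAt.of_analyticAt (hB u hu hre)).neg.congr ?_
      filter_upwards [hF₁ u hu hre] with w h1 hw
      rw [h1 hw, sub_sub_cancel_left]
    · have hu2 : u ≠ 1 := by rintro rfl; norm_num at hre
      refine ((ExtAt.of_analyticAt (hA u hu hre.le)).sub (h u hu hu2 hu1)).congr ?_
      filter_upwards [hF₂ u hu hre.le] with w h1 hw
      rw [h1 hw]
      abel
  · rcases le_or_gt u.re 0 with hre | hre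
    · refine (ExtAt.of_analyticAt (hA u hu hre)).congr ?_
      filter_upwards [hF₂ u hu hre] with w h1 hw
      rw [h1 hw, add_sub_cancel_left]
    · have hu2 : u ≠ -1 := by rintro rfl; norm_num at hre
      refine ((h u hu hu1 hu2).sub (ExtAt.of_analyticAt (hB u hu hre.le))).congr ?_
      filter_upwards [hF₁ u hu hre.le] with w h1 hw
      rw [h1 hw]
      abel

theorem exists_analyticOnNhd_of_eqOn_inter {f g : ℂ → V} {U W : Set ℂ} (hU : IsOpen U)
    (hW : IsOpen W) (hf : AnalyticOnNhd ℂ f U) (hg : AnalyticOnNhd ℂ g W)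
    (hfg : ∀ z ∈ U, z ∈ W → f z = g z) :
    ∃ h : ℂ → V, AnalyticOnNhd ℂ h (U ∪ W) ∧ U.EqOn h f ∧ W.EqOn h g := by
  classical
  have hEqU : U.EqOn (U.piecewise f g) f := U.piecewise_eqOn f g
  have hEqW : W.EqOn (U.piecewise f g) g := fun z hz => by
    by_cases hzU : z ∈ U
    · rw [hEqU hzU, hfg z hzU hz]
    · exact U.piecewise_eq_of_notMem f g hzU
  refine ⟨U.piecewise f g, ?_, hEqU, hEqW⟩
  rintro z (hz | hz)
  · exact hf.congr hU hEqU.symm z hz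
  · exact hg.congr hW hEqW.symm z hz

/-- The two parts of the Laurent decomposition are Cauchy integrals over circles of different
radii; where one of the integrals is not available, subtracting the other part from `G` continues
it. -/
theorem exists_laurent_splitting [CompleteSpace V] {c : ℂ} {r R : ℝ} (hR : 0 < R) (hrR : r < R)
    {G : ℂ → V} (hG : ∀ w, r < ‖w - c‖ → ‖w - c‖ < R → AnalyticAt ℂ G w) :
    ∃ P Q : ℂ → V, (∀ z, ‖z - c‖ < R → AnalyticAt ℂ P z) ∧
      (∀ z, r < ‖z - c‖ → AnalyticAt ℂ Q z) ∧
      Filter.Tendsto Q (Bornology.cobounded ℂ) (𝓝 0) ∧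
      ∀ z, r < ‖z - c‖ → ‖z - c‖ < R → P z + Q z = G z := by
  obtain ⟨r₁, hr₁, hr₁R⟩ := exists_between (max_lt hR hrR)
  obtain ⟨R₁, hrR₁, hR₁⟩ := exists_between hr₁R
  obtain ⟨hr₁0, hrr₁⟩ := max_lt_iff.1 hr₁
  have hcont : ∀ ρ, r < ρ → ρ < R → ContinuousOn G (Metric.sphere c ρ) := fun ρ h1 h2 w hw => by
    rw [mem_sphere_iff_norm] at hw
    exact (hG w (hw ▸ h1) (hw ▸ h2)).continuousAt.continuousWithinAt
  have hsub : ∀ z, r₁ < ‖z - c‖ → ‖z - c‖ < R₁ →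
      circleCauchy c R₁ G z - circleCauchy c r₁ G z = G z := fun z h1 h2 =>
    circleCauchy_sub_of_mem_annulus hr₁0 h1 h2 fun w h3 h4 =>
      hG w (hrr₁.trans_le h3) (h4.trans_lt hR₁)
  have hinner {z} (hz : ‖z - c‖ ≠ r₁) : AnalyticAt ℂ (circleCauchy c r₁ G) z :=
    analyticAt_circleCauchy hr₁0.le (hcont r₁ hrr₁ hr₁R) hz
  have houter {z} (hz : ‖z - c‖ ≠ R₁) : AnalyticAt ℂ (circleCauchy c R₁ G) z :=
    analyticAt_circleCauchy (hr₁0.trans hrR₁).le (hcont R₁ (hrr₁.trans hrR₁) hR₁) hz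
  have hlt (ρ : ℝ) : IsOpen {z : ℂ | ‖z - c‖ < ρ} := isOpen_lt (by fun_prop) continuous_const
  have hgt (ρ : ℝ) : IsOpen {z : ℂ | ρ < ‖z - c‖} := isOpen_lt continuous_const (by fun_prop)
  obtain ⟨P, hP, hP₁, hP₂⟩ := exists_analyticOnNhd_of_eqOn_inter (hlt R₁) ((hgt r₁).inter (hlt R))
    (fun z hz => houter hz.ne)
    (fun z hz => (hG z (hrr₁.trans hz.1) hz.2).add (hinner hz.1.ne'))
    fun z h1 h2 => by rw [Pi.add_apply, ← hsub z h2.1 h1, sub_add_cancel]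
  obtain ⟨Q, hQ, hQ₁, hQ₂⟩ := exists_analyticOnNhd_of_eqOn_inter (hgt r₁) ((hgt r).inter (hlt R₁))
    (fun z hz => (hinner hz.ne').neg)
    (fun z hz => (hG z hz.1 (hz.2.trans hR₁)).sub (houter hz.2.ne))
    fun z h1 h2 => by rw [Pi.neg_apply, Pi.sub_apply, ← hsub z h1 h2.2, sub_sub_cancel_left]
  refine ⟨P, Q, fun z hz => hP z ?_, fun z hz => hQ z ?_, ?_, fun z h1 h2 => ?_⟩
  · exact (lt_or_ge ‖z - c‖ R₁).imp id fun h => ⟨hrR₁.trans_le h, hz⟩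
  · exact (lt_or_ge r₁ ‖z - c‖).imp id fun h => ⟨hz, h.trans_lt hrR₁⟩
  · have hlim := (tendsto_circleCauchy_cobounded hr₁0.le (hcont r₁ hrr₁ hr₁R)).neg
    rw [neg_zero] at hlim
    refine hlim.congr' ?_
    filter_upwards [(Metric.tendsto_dist_right_cobounded_atTop c).eventually_gt_atTop r₁]
      with z hz using (hQ₁ (Set.mem_ofPred.2 (by rwa [← dist_eq_norm]))).symm
  · rcases lt_or_ge ‖z - c‖ R₁ with h | h
    · rw [hP₁ h, hQ₂ ⟨h1, h⟩, Pi.sub_apply, add_sub_cancel]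
    · rw [hP₂ ⟨hrR₁.trans_le h, h2⟩, hQ₁ (hrR₁.trans_le h), Pi.add_apply, Pi.neg_apply,
        add_neg_cancel_right]

theorem eventually_analyticAt_of_analyticOffAt_unitCircle {G : ℂ → V}
    (hG : ∀ u ∈ unitCircle, AnalyticOffAt unitCircle G u) :
    ∀ᶠ ρ in 𝓝 (1 : ℝ), ∀ w, ‖w‖ = ρ → w ∉ unitCircle → AnalyticAt ℂ G w := by
  have hclosed : IsClosedMap (norm : ℂ → ℝ) := by
    rw [show (norm : ℂ → ℝ) = dist 0 from funext fun z => (dist_zero_left z).symm]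
    exact isClosedMap_dist 0
  exact hclosed.eventually_nhds_fiber (p := fun w => w ∉ unitCircle → AnalyticAt ℂ G w) 1 hG

/-- With Laurent splittings `P₁ + Q₁` of `G` just inside and `P₂ + Q₂` just outside the circle, take
`P₁ - P₂` inside and `Q₂ - Q₁` outside: this differs from `G` by `P₂ + Q₁`, which is analytic across
the circle. -/
theorem exists_analytic_off_circle [CompleteSpace V] {G : ℂ → V}
    (hG : ∀ u ∈ unitCircle, AnalyticOffAt unitCircle G u) :
    ∃ F : ℂ → V, (∀ z ∉ unitCircle, AnalyticAt ℂ F z) ∧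
      Filter.Tendsto F (Bornology.cobounded ℂ) (𝓝 0) ∧
      ∀ u ∈ unitCircle, ExtAt unitCircle (fun w => F w - G w) u := by
  obtain ⟨r, R, ⟨hr, hR⟩, hG'⟩ := mem_nhds_iff_exists_Ioo_subset.1
    (eventually_analyticAt_of_analyticOffAt_unitCircle hG)
  obtain ⟨P₁, Q₁, hP₁, hQ₁, hQ₁0, hG₁⟩ := exists_laurent_splitting (c := 0) (G := G) one_pos hr
    fun w h1 h2 => by
      rw [sub_zero] at h1 h2
      exact hG' ⟨h1, h2.trans hR⟩ w rfl h2.ne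
  obtain ⟨P₂, Q₂, hP₂, hQ₂, hQ₂0, hG₂⟩ := exists_laurent_splitting (c := 0) (G := G)
    (one_pos.trans hR) hR fun w h1 h2 => by
      rw [sub_zero] at h1 h2
      exact hG' ⟨hr.trans h1, h2⟩ w rfl h1.ne'
  simp only [sub_zero] at hP₁ hQ₁ hG₁ hP₂ hQ₂ hG₂
  obtain ⟨F, hF, hF₁, hF₂⟩ := exists_analyticOnNhd_of_eqOn_inter
    (isOpen_lt continuous_norm continuous_const : IsOpen {z : ℂ | ‖z‖ < 1})
    (isOpen_lt continuous_const continuous_norm : IsOpen {z : ℂ | 1 < ‖z‖})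
    (fun z hz => (hP₁ z hz).sub (hP₂ z (hz.trans hR)))
    (fun z hz => (hQ₂ z hz).sub (hQ₁ z (hr.trans hz))) fun z h1 h2 =>
      (lt_asymm (Set.mem_ofPred.1 h1) h2).elim
  refine ⟨F, fun z hz => hF z (lt_or_gt_of_ne hz), ?_, fun u hu => ?_⟩
  · have hlim := hQ₂0.sub hQ₁0
    rw [sub_zero] at hlim
    refine hlim.congr' ?_
    filter_upwards [tendsto_norm_cobounded_atTop.eventually_gt_atTop 1] with z hz
      using (hF₂ hz).symm
  · have hu : ‖u‖ = 1 := hu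
    refine (ExtAt.of_analyticAt ((hQ₁ u (hu ▸ hr)).add (hP₂ u (hu ▸ hR)))).neg.congr ?_
    filter_upwards [continuous_norm.continuousAt.eventually_const_lt (hu ▸ hr),
      continuous_norm.continuousAt.eventually_lt_const (hu ▸ hR)] with w h1 h2 hw
    rcases lt_or_gt_of_ne hw with h | h
    · rw [hF₁ h, ← hG₁ w h1 h, Pi.sub_apply, Pi.add_apply]
      abel
    · rw [hF₂ h, ← hG₂ w h h2, Pi.sub_apply, Pi.add_apply]
      abel

end Circle

section RealAxis

variable {V : Type*} [NormedAddCommGroup V]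

/-- The real axis in the complex plane. -/
abbrev realAxis : Set ℂ := {z | z.im = 0}

theorem isClosed_realAxis : IsClosed realAxis :=
  isClosed_eq Complex.continuous_im continuous_const

theorem dense_realAxis_compl : Dense realAxisᶜ := by
  intro z
  by_cases hz : z.im = 0
  · refine mem_closure_of_tendsto (b := 𝓝[≠] (0 : ℝ)) (f := fun t : ℝ => z + t * Complex.I) ?_ ?_
    · have : Filter.Tendsto (fun t : ℝ => z + t * Complex.I) (𝓝 0) (𝓝 (z + (0 : ℝ) * Complex.I)) :=
        Continuous.tendsto (by fun_prop) 0
      simpa using this.mono_left nhdsWithin_le_nhds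
    · filter_upwards [self_mem_nhdsWithin] with t ht
      simpa [hz] using ht
  · exact subset_closure hz

instance comap_im_atTop_neBot : (Filter.comap Complex.im Filter.atTop).NeBot :=
  Filter.NeBot.comap_of_surj inferInstance fun y => ⟨y * Complex.I, by simp⟩

instance comap_im_atBot_neBot : (Filter.comap Complex.im Filter.atBot).NeBot :=
  Filter.NeBot.comap_of_surj inferInstance fun y => ⟨y * Complex.I, by simp⟩

theorem eventually_im_ne_zero_comap_atTop :
    ∀ᶠ z : ℂ in Filter.comap Complex.im Filter.atTop, z.im ≠ 0 :=
  (Filter.tendsto_comap.eventually_gt_atTop 0).mono fun _ h => h.ne'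

theorem eventually_im_ne_zero_comap_atBot :
    ∀ᶠ z : ℂ in Filter.comap Complex.im Filter.atBot, z.im ≠ 0 :=
  (Filter.tendsto_comap.eventually_lt_atBot 0).mono fun _ h => h.ne

theorem exists_bound_of_tendsto_im {f : ℂ → V} {v w : V}
    (h₁ : Filter.Tendsto f (Filter.comap Complex.im Filter.atTop) (𝓝 v))
    (h₂ : Filter.Tendsto f (Filter.comap Complex.im Filter.atBot) (𝓝 w)) :
    ∃ A C : ℝ, ∀ z : ℂ, A ≤ |z.im| → ‖f z‖ ≤ C := by
  have e₁ := h₁.norm.eventually (eventually_le_nhds (lt_add_one ‖v‖))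
  have e₂ := h₂.norm.eventually (eventually_le_nhds (lt_add_one ‖w‖))
  rw [Filter.eventually_comap, Filter.eventually_atTop] at e₁
  rw [Filter.eventually_comap, Filter.eventually_atBot] at e₂
  obtain ⟨a, ha⟩ := e₁
  obtain ⟨b, hb⟩ := e₂
  refine ⟨max a (-b), max (‖v‖ + 1) (‖w‖ + 1), fun z hz => ?_⟩
  rcases le_total 0 z.im with h0 | h0
  · rw [abs_of_nonneg h0] at hz
    exact (ha z.im ((le_max_left _ _).trans hz) z rfl).trans (le_max_left _ _)
  · rw [abs_of_nonpos h0] at hz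
    exact (hb z.im (by linarith [(le_max_right a (-b)).trans hz]) z rfl).trans (le_max_right _ _)

theorem isBounded_range_of_periodic {ψ : ℂ → V} {N : ℝ} (hN : 0 < N) (hψ : Continuous ψ)
    (hper : Function.Periodic ψ N) {A C : ℝ} (hAC : ∀ z : ℂ, A ≤ |z.im| → ‖ψ z‖ ≤ C) :
    Bornology.IsBounded (Set.range ψ) := by
  obtain ⟨M, hM⟩ := (isCompact_Icc.reProdIm isCompact_Icc : IsCompact
    (Set.Icc 0 N ×ℂ Set.Icc (-A) A)).exists_bound_of_continuousOn hψ.continuousOn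
  refine isBounded_iff_forall_norm_le.2 ⟨max C M, ?_⟩
  rintro _ ⟨z, rfl⟩
  rcases le_or_gt A |z.im| with h | h
  · exact (hAC z h).trans (le_max_left _ _)
  · have hper_re : Function.Periodic (fun x : ℝ => ψ (x + z.im * Complex.I)) N := fun x => by
      simpa [add_right_comm] using hper (x + z.im * Complex.I)
    obtain ⟨x, hx, hzx⟩ := hper_re.exists_mem_Ico₀ hN z.re
    rw [Complex.re_add_im] at hzx
    rw [hzx]
    refine (hM _ ⟨?_, ?_⟩).trans (le_max_right _ _)
    · simpa using Set.Ico_subset_Icc_self hx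
    · simpa using abs_le.1 h.le

variable [NormedSpace ℂ V]

theorem eq_zero_of_periodic_of_differentiable {ψ : ℂ → V} {N : ℝ} (hN : 0 < N) {v : V}
    (hψ : Differentiable ℂ ψ) (hper : Function.Periodic ψ N)
    (h₁ : Filter.Tendsto ψ (Filter.comap Complex.im Filter.atTop) (𝓝 v))
    (h₂ : Filter.Tendsto ψ (Filter.comap Complex.im Filter.atBot) (𝓝 (-v))) (z : ℂ) : ψ z = 0 := by
  obtain ⟨A, C, hAC⟩ := exists_bound_of_tendsto_im h₁ h₂
  have hconst : ∀ w, ψ w = ψ z := fun w =>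
    hψ.apply_eq_apply_of_bounded (isBounded_range_of_periodic hN hψ.continuous hper hAC) w z
  have e₁ : v = ψ z := tendsto_nhds_unique h₁ (tendsto_const_nhds.congr fun w => (hconst w).symm)
  have e₂ : -v = ψ z := tendsto_nhds_unique h₂ (tendsto_const_nhds.congr fun w => (hconst w).symm)
  rw [← e₁] at e₂ ⊢
  have : (2 : ℂ) • v = 0 := by rw [two_smul, ← neg_eq_iff_add_eq_zero, e₂]
  exact (smul_eq_zero.1 this).resolve_left two_ne_zero

theorem eq_zero_of_periodic_of_extAt [CompleteSpace V] {D : ℂ → V} {N : ℝ} (hN : 0 < N) {v : V}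
    (hD : ∀ z : ℂ, z.im ≠ 0 → AnalyticAt ℂ D z) (hx : ∀ x : ℝ, ExtAt realAxis D x)
    (hper : ∀ z : ℂ, z.im ≠ 0 → D (z + N) = D z)
    (h₁ : Filter.Tendsto D (Filter.comap Complex.im Filter.atTop) (𝓝 v))
    (h₂ : Filter.Tendsto D (Filter.comap Complex.im Filter.atBot) (𝓝 (-v))) :
    ∀ z : ℂ, z.im ≠ 0 → D z = 0 := by
  have hext : ∀ z ∈ Set.univ, ExtAt realAxis D z := fun z _ => by
    by_cases hz : z.im = 0
    · lift z to ℝ using hz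
      exact hx z
    · exact .of_analyticAt (hD z hz)
  obtain ⟨ψ, hψ, hψD⟩ := exists_analytic_extension dense_realAxis_compl hext
  have hdiff : Differentiable ℂ ψ := fun z => (hψ z trivial).differentiableAt
  have hψper : Function.Periodic ψ N := congrFun <|
    Continuous.ext_on dense_realAxis_compl (hdiff.continuous.comp (continuous_add_const _))
      hdiff.continuous fun z hz => by
        have hz' : z + (N : ℂ) ∉ realAxis := by simpa using hz
        simp only [hψD _ hz', hψD z hz, hper z hz]
  intro z hz
  rw [← hψD z hz]
  exact eq_zero_of_periodic_of_differentiable hN hdiff hψper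
    (h₁.congr' (eventually_im_ne_zero_comap_atTop.mono fun z hz => (hψD z hz).symm))
    (h₂.congr' (eventually_im_ne_zero_comap_atBot.mono fun z hz => (hψD z hz).symm)) z

end RealAxis

section QParam

open Function.Periodic

variable {V : Type*} [NormedAddCommGroup V] [NormedSpace ℂ V] {N : ℝ} {C : Set ℂ} {u : ℂ}
  {g G : ℂ → V} {k k₁ k₂ : ℂ → ℂ}

theorem qParam_mem_unitCircle_iff (hN : N ≠ 0) {z : ℂ} :
    qParam N z ∈ unitCircle ↔ z ∈ realAxis := by
  rw [Set.mem_ofPred, Set.mem_ofPred, norm_qParam, Real.exp_eq_one_iff]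
  simp [hN, Real.pi_ne_zero]

theorem analyticAt_qParam (z : ℂ) : AnalyticAt ℂ (qParam N) z := by
  unfold qParam
  fun_prop

theorem tendsto_qParam_atBot (hN : 0 < N) :
    Filter.Tendsto (qParam N) (Filter.comap Complex.im Filter.atBot) (Bornology.cobounded ℂ) := by
  rw [← tendsto_norm_atTop_iff_cobounded]
  simp only [norm_qParam]
  refine Real.tendsto_exp_atTop.comp (Filter.Tendsto.atTop_div_const hN
    (Filter.Tendsto.const_mul_atBot_of_neg ?_ Filter.tendsto_comap))
  linarith [Real.pi_pos]

theorem qParam_half_add (hN : N ≠ 0) (z : ℂ) : qParam N (N / 2 + z) = -qParam N z := by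
  have hN' : (N : ℂ) ≠ 0 := Complex.ofReal_ne_zero.2 hN
  have e : 2 * Real.pi * Complex.I * (N / 2 + z) / N =
      2 * Real.pi * Complex.I * z / N + Real.pi * Complex.I := by
    field_simp
    ring
  rw [qParam, qParam, e, Complex.exp_add, Complex.exp_pi_mul_I, mul_neg_one]

theorem qParam_eq_qParam_iff (hN : N ≠ 0) {z w : ℂ} :
    qParam N z = qParam N w ↔ ∃ n : ℤ, z = w + n * N := by
  have hN' : (N : ℂ) ≠ 0 := Complex.ofReal_ne_zero.2 hN
  have hpi := Complex.two_pi_I_ne_zero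
  rw [qParam, qParam, Complex.exp_eq_exp_iff_exists_int]
  refine exists_congr fun n => ?_
  have e : 2 * Real.pi * Complex.I * w / N + n * (2 * Real.pi * Complex.I) =
      2 * Real.pi * Complex.I * (w + n * N) / N := by
    field_simp
  rw [e, div_left_inj' hN', mul_right_inj' hpi]

theorem exists_eventually_eq_add_of_qParam_eq (hN : 0 < N) (hk₁ : ContinuousAt k₁ u)
    (hk₂ : ContinuousAt k₂ u) (h : ∀ᶠ w in 𝓝 u, qParam N (k₁ w) = qParam N (k₂ w)) :
    ∃ n : ℤ, ∀ᶠ w in 𝓝 u, k₁ w = k₂ w + n * N := by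
  obtain ⟨n, hn⟩ := (qParam_eq_qParam_iff hN.ne').1 h.self_of_nhds
  have hcont : ContinuousAt (fun w => ‖k₁ w - (k₂ w + n * N)‖) u := by fun_prop
  refine ⟨n, ?_⟩
  filter_upwards [h, hcont.eventually_lt_const (by simpa [hn] using hN)] with w hw hlt
  obtain ⟨m, hm⟩ := (qParam_eq_qParam_iff hN.ne').1 hw
  rw [hm, add_sub_add_left_eq_sub, ← sub_mul, norm_mul, Complex.norm_real,
    Real.norm_of_nonneg hN.le, mul_lt_iff_lt_one_left hN, ← Int.cast_sub, Complex.norm_intCast,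
    ← Int.cast_abs] at hlt
  have hmn : m - n = 0 := Int.abs_lt_one_iff.1 (by exact_mod_cast hlt)
  rw [hm, sub_eq_zero.1 hmn]

/-- The map `k` is near `u` an analytic right inverse of the coordinate `exp (2 * π * I * z / N)` on
the quotient of `ℂ` by translation by `N`. -/
def IsQParamSectionAt (N : ℝ) (k : ℂ → ℂ) (u : ℂ) : Prop :=
  AnalyticAt ℂ k u ∧ ∀ᶠ q in 𝓝 u, qParam N (k q) = q

theorem isQParamSectionAt_invQParam (hN : N ≠ 0) (hu : u ∈ unitCircle) (hu1 : u ≠ -1) :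
    IsQParamSectionAt N (invQParam N) u := by
  have hu0 : u ≠ 0 := by rintro rfl; simp at hu
  refine ⟨analyticAt_const.mul (analyticAt_clog ?_), ?_⟩
  · refine Complex.mem_slitPlane_iff_arg.2 ⟨fun harg => hu1 ?_, hu0⟩
    rw [← Complex.norm_mul_exp_arg_mul_I u, harg, Set.mem_ofPred.1 hu, Complex.exp_pi_mul_I]
    simp
  · filter_upwards [isOpen_ne.mem_nhds hu0] with q hq using qParam_right_inv hN hq

theorem isQParamSectionAt_half_add_invQParam_neg (hN : N ≠ 0) (hu : u ∈ unitCircle) (hu1 : u ≠ 1) :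
    IsQParamSectionAt N (fun q => N / 2 + invQParam N (-q)) u := by
  obtain ⟨hana, hsec⟩ := isQParamSectionAt_invQParam hN (u := -u) (by simpa using hu)
    (neg_injective.ne hu1)
  refine ⟨analyticAt_const.add (hana.fun_comp analyticAt_id.neg), ?_⟩
  filter_upwards [continuousAt_neg.eventually hsec] with q hq
  rw [qParam_half_add hN, hq, neg_neg]

theorem IsQParamSectionAt.eventually_notMem_realAxis (hN : N ≠ 0) (hk : IsQParamSectionAt N k u) :
    ∀ᶠ q in 𝓝 u, q ∉ unitCircle → k q ∉ realAxis := by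
  filter_upwards [hk.2] with q hq hq1 hk1
  exact hq1 (hq ▸ (qParam_mem_unitCircle_iff hN).2 hk1)

theorem IsQParamSectionAt.apply_mem_realAxis (hN : N ≠ 0) (hk : IsQParamSectionAt N k u)
    (hu : u ∈ unitCircle) : k u ∈ realAxis :=
  (qParam_mem_unitCircle_iff hN).1 (by rwa [hk.2.self_of_nhds])

theorem extAt_comp_sub_comp_of_qParam_eq (hN : 0 < N)
    (hper : ∀ (n : ℤ) (x : ℝ), ExtAt realAxis (fun z => g (z - n * N) - g z) x)
    (hk₁ : ContinuousAt k₁ u) (hk₂ : AnalyticAt ℂ k₂ u)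
    (h : ∀ᶠ w in 𝓝 u, qParam N (k₁ w) = qParam N (k₂ w)) (hu : k₂ u ∈ realAxis)
    (hC : ∀ᶠ w in 𝓝 u, w ∉ C → k₂ w ∉ realAxis) :
    ExtAt C (fun w => g (k₁ w) - g (k₂ w)) u := by
  obtain ⟨n, hn⟩ := exists_eventually_eq_add_of_qParam_eq hN hk₁ hk₂.continuousAt h
  have hper' : ExtAt realAxis (fun z => g (z - (-n : ℤ) * N) - g z) (k₂ u) := by
    obtain ⟨x, hx⟩ : ∃ x : ℝ, (x : ℂ) = k₂ u := ⟨_, Complex.ext rfl hu.symm⟩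
    exact hx ▸ hper (-n) x
  refine (hper'.comp hk₂ hC).congr ?_
  filter_upwards [hn] with w hw _
  rw [hw, Int.cast_neg, neg_mul, sub_neg_eq_add]

theorem extAt_comp_qParam_sub (hN : 0 < N)
    (hper : ∀ (n : ℤ) (x : ℝ), ExtAt realAxis (fun z => g (z - n * N) - g z) x) {x : ℝ}
    (hk : IsQParamSectionAt N k (qParam N x))
    (h : ExtAt unitCircle (fun q => G q - g (k q)) (qParam N x)) :
    ExtAt realAxis (fun z => G (qParam N z) - g z) x := by
  have hana := analyticAt_qParam (N := N) (x : ℂ)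
  have h₁ := h.comp hana (.of_forall fun w hw => mt (qParam_mem_unitCircle_iff hN.ne').1 hw)
  have h₂ : ExtAt realAxis (fun z => g (k (qParam N z)) - g z) x :=
    extAt_comp_sub_comp_of_qParam_eq (k₁ := fun z => k (qParam N z)) (k₂ := fun z => z) hN hper
      (hk.1.fun_comp hana).continuousAt analyticAt_id (hana.continuousAt.eventually hk.2)
      (Complex.ofReal_im x) (.of_forall fun _ => id)
  simpa only [sub_add_sub_cancel] using h₁.add h₂

/-- The principal logarithm gives a section off `-1`, its translate by `N / 2` one off `1`. -/
theorem exists_descent_to_unitCircle [CompleteSpace V] (hN : 0 < N)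
    (hg : ∀ x : ℝ, AnalyticOffAt realAxis g x)
    (hper : ∀ (n : ℤ) (x : ℝ), ExtAt realAxis (fun z => g (z - n * N) - g z) x) :
    ∃ G : ℂ → V, (∀ u ∈ unitCircle, AnalyticOffAt unitCircle G u) ∧
      ∀ x : ℝ, ExtAt realAxis (fun z => G (qParam N z) - g z) x := by
  have hsec₁ : ∀ u ∈ unitCircle, u ≠ -1 → IsQParamSectionAt N (invQParam N) u :=
    fun u hu hu1 => isQParamSectionAt_invQParam hN.ne' hu hu1
  have hsec₂ : ∀ u ∈ unitCircle, u ≠ 1 →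
      IsQParamSectionAt N (fun q => N / 2 + invQParam N (-q)) u :=
    fun u hu hu1 => isQParamSectionAt_half_add_invQParam_neg hN.ne' hu hu1
  have hdiff : ∀ u ∈ unitCircle, u ≠ 1 → u ≠ -1 →
      ExtAt unitCircle (fun q => g (invQParam N q) - g (N / 2 + invQParam N (-q))) u := by
    intro u hu hu1 hu2
    have hreal := (hsec₂ u hu hu1).apply_mem_realAxis hN.ne' hu
    refine extAt_comp_sub_comp_of_qParam_eq (k₂ := fun q => N / 2 + invQParam N (-q)) hN hper
      (hsec₁ u hu hu2).1.continuousAt (hsec₂ u hu hu1).1 ?_ hreal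
      ((hsec₂ u hu hu1).eventually_notMem_realAxis hN.ne')
    filter_upwards [(hsec₁ u hu hu2).2, (hsec₂ u hu hu1).2] with q h1 h2 using h1.trans h2.symm
  obtain ⟨G, hG₁, hG₂⟩ := exists_glue_on_circle (F₁ := fun q => g (invQParam N q))
    (F₂ := fun q => g (N / 2 + invQParam N (-q))) hdiff
  have hsec : ∀ u ∈ unitCircle, ∃ k, IsQParamSectionAt N k u ∧
      ExtAt unitCircle (fun q => G q - g (k q)) u := fun u hu => by
    by_cases hu1 : u = -1
    · have hu2 : u ≠ 1 := by rw [hu1]; norm_num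
      exact ⟨_, hsec₂ u hu hu2, hG₂ u hu hu2⟩
    · exact ⟨_, hsec₁ u hu hu1, hG₁ u hu hu1⟩
  refine ⟨G, fun u hu => ?_, fun x => ?_⟩
  · obtain ⟨k, hk, hGk⟩ := hsec u hu
    have hgk : AnalyticOffAt unitCircle (fun q => g (k q)) u := by
      refine AnalyticOffAt.comp ?_ hk.1 (hk.eventually_notMem_realAxis hN.ne')
      obtain ⟨x, hx⟩ : ∃ x : ℝ, (x : ℂ) = k u :=
        ⟨_, Complex.ext rfl (hk.apply_mem_realAxis hN.ne' hu).symm⟩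
      exact hx ▸ hg x
    simpa only [sub_add_cancel] using (hGk.analyticOffAt isClosed_unitCircle).add hgk
  · obtain ⟨k, hk, hGk⟩ := hsec (qParam N x) ((qParam_mem_unitCircle_iff hN.ne').2 (by simp))
    exact extAt_comp_qParam_sub hN hper hk hGk

/-- Descend to the circle, replace the descended function by one that is analytic off the circle and
vanishes at infinity, and subtract half of its value at the origin. -/
theorem exists_periodic_of_extAt [CompleteSpace V] (hN : 0 < N)
    (hg : ∀ x : ℝ, AnalyticOffAt realAxis g x)
    (hper : ∀ (n : ℤ) (x : ℝ), ExtAt realAxis (fun z => g (z - n * N) - g z) x) :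
    ∃ f : ℂ → V, (∀ z : ℂ, z.im ≠ 0 → AnalyticAt ℂ f z) ∧ Function.Periodic f N ∧
      (∃ v : V, Filter.Tendsto f (Filter.comap Complex.im Filter.atTop) (𝓝 v) ∧
        Filter.Tendsto f (Filter.comap Complex.im Filter.atBot) (𝓝 (-v))) ∧
      ∀ x : ℝ, ExtAt realAxis (fun z => f z - g z) x := by
  obtain ⟨G, hG, hGg⟩ := exists_descent_to_unitCircle hN hg hper
  obtain ⟨F, hF, hF0, hFG⟩ := exists_analytic_off_circle hG
  have hcircle : ∀ {z : ℂ}, z.im ≠ 0 → qParam N z ∉ unitCircle := fun hz =>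
    mt (qParam_mem_unitCircle_iff hN.ne').1 hz
  set v := (2⁻¹ : ℂ) • F 0 with hv
  have hv2 : F 0 - v = v := by
    rw [hv, sub_eq_iff_eq_add, ← add_smul, ← one_div, add_halves, one_smul]
  refine ⟨fun z => F (qParam N z) - v, fun z hz => ?_, fun z => ?_, ⟨v, ?_, ?_⟩, fun x => ?_⟩
  · exact ((hF _ (hcircle hz)).fun_comp (analyticAt_qParam z)).sub analyticAt_const
  · have hz : qParam N (z + N) = qParam N z :=
      (qParam_eq_qParam_iff hN.ne').2 ⟨1, by simp⟩
    simp only [hz]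
  · simpa only [hv2, Function.comp_def] using ((hF 0 (by simp)).continuousAt.tendsto.comp
      ((qParam_tendsto hN).mono_right nhdsWithin_le_nhds)).sub_const v
  · simpa only [zero_sub, Function.comp_def] using (hF0.comp (tendsto_qParam_atBot hN)).sub_const v
  · have h₁ := (hFG _ ((qParam_mem_unitCircle_iff hN.ne').2 (Complex.ofReal_im x))).comp
      (analyticAt_qParam x) (.of_forall fun w hw => hcircle hw)
    refine ((h₁.add (hGg x)).sub (.of_analyticAt (analyticAt_const (v := v)))).congr
      (.of_forall fun w _ => ?_)
    rw [sub_add_sub_cancel, sub_right_comm]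

end QParam

section ProjectiveLine

variable {V : Type*} [NormedAddCommGroup V] [NormedSpace ℂ V]

theorem coe_mem_realProj_iff {z : ℂ} : (z : OnePoint ℂ) ∈ realProj ↔ z.im = 0 := by
  constructor
  · rintro ⟨c, hc⟩
    cases c with
    | infty => exact absurd hc (OnePoint.infty_ne_coe z)
    | coe x =>
      have : (x : ℂ) = z := OnePoint.coe_injective hc
      rw [← this, Complex.ofReal_im]
  · intro h
    have e : ((z.re : ℝ) : ℂ) = z := Complex.ext rfl (by simp [h])
    exact ⟨(z.re : ℝ), congrArg (fun w : ℂ => (w : OnePoint ℂ)) e⟩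

theorem infty_mem_realProj : (∞ : OnePoint ℂ) ∈ realProj := ⟨∞, rfl⟩

theorem ofReal_mem_realProj (x : ℝ) : ((x : ℂ) : OnePoint ℂ) ∈ realProj :=
  coe_mem_realProj_iff.2 (Complex.ofReal_im x)

theorem eq_infty_or_ofReal_of_mem_realProj {p : OnePoint ℂ} (hp : p ∈ realProj) :
    p = ∞ ∨ ∃ x : ℝ, p = ((x : ℂ) : OnePoint ℂ) := by
  obtain ⟨c, rfl⟩ := hp
  cases c with
  | infty => exact .inl rfl
  | coe x => exact .inr ⟨x, rfl⟩

theorem exists_coe_of_notMem_realProj {p : OnePoint ℂ} (hp : p ∉ realProj) :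
    ∃ z : ℂ, z.im ≠ 0 ∧ p = z := by
  cases p with
  | infty => exact absurd infty_mem_realProj hp
  | coe z => exact ⟨z, fun h => hp (coe_mem_realProj_iff.2 h), rfl⟩

theorem chart_injective (p : OnePoint ℂ) : Function.Injective (chart p) := by
  cases p with
  | coe z => exact OnePoint.coe_injective
  | infty =>
    intro v w h
    change chartInfty v = chartInfty w at h
    unfold chartInfty at h
    split_ifs at h with hv hw hw
    · rw [hv, hw]
    · exact absurd h (OnePoint.infty_ne_coe _)
    · exact absurd h.symm (OnePoint.infty_ne_coe _)
    · exact inv_injective (OnePoint.coe_injective h)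

theorem preimage_chart_realProj (p : OnePoint ℂ) : chart p ⁻¹' realProj = realAxis := by
  ext w
  cases p with
  | coe z => exact coe_mem_realProj_iff
  | infty =>
    change chartInfty w ∈ realProj ↔ w.im = 0
    rcases eq_or_ne w 0 with rfl | hw
    · simp [chartInfty, infty_mem_realProj]
    · rw [chartInfty_of_ne hw, coe_mem_realProj_iff, Complex.inv_im, div_eq_zero_iff]
      simp [hw]

theorem dense_realProj_compl : Dense realProjᶜ := by
  intro p
  rw [mem_closure_iff_frequently, nhds_eq_map_chart, Filter.frequently_map]
  refine (mem_closure_iff_frequently.1 (dense_realAxis_compl (base p))).mono fun w hw => ?_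
  rwa [← preimage_chart_realProj p] at hw

theorem isClosed_realProj : IsClosed realProj := by
  refine isOpen_compl_iff.1 (isOpen_iff_mem_nhds.2 fun p hp => ?_)
  rw [nhds_eq_map_chart, Filter.mem_map, Set.preimage_compl, preimage_chart_realProj]
  refine isClosed_realAxis.isOpen_compl.mem_nhds ?_
  rwa [← preimage_chart_realProj p, Set.mem_compl_iff, Set.mem_preimage, chart_base]

theorem eventually_nhds_coe_iff {P : OnePoint ℂ → Prop} {z : ℂ} :
    (∀ᶠ q in 𝓝 (z : OnePoint ℂ), P q) ↔ ∀ᶠ w : ℂ in 𝓝 z, P w := by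
  rw [OnePoint.nhds_coe_eq, Filter.eventually_map]

theorem HolAt.continuousAt {f : OnePoint ℂ → V} {p : OnePoint ℂ} (h : HolAt f p) :
    ContinuousAt f p := by
  have hcont := (holAt_iff.1 h).continuousAt.tendsto
  rw [chart_base] at hcont
  rwa [ContinuousAt, nhds_eq_map_chart p, Filter.tendsto_map'_iff]

theorem HolAt.congr {f g : OnePoint ℂ → V} {p : OnePoint ℂ} (h : HolAt f p)
    (e : ∀ᶠ q in 𝓝 p, f q = g q) : HolAt g p := by
  rw [nhds_eq_map_chart p, Filter.eventually_map] at e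
  exact holAt_iff.2 ((holAt_iff.1 h).congr e)

/-- The analogue of `ExtAt` on the complex projective line: off the set `C`, the function `φ` agrees
near `p` with a function that is holomorphic near `p`. -/
def ExtHolAt (C : Set (OnePoint ℂ)) (φ : OnePoint ℂ → V) (p : OnePoint ℂ) : Prop :=
  ExtAt (chart p ⁻¹' C) (fun w => φ (chart p w)) (base p)

variable {C D : Set (OnePoint ℂ)} {φ ψ : OnePoint ℂ → V} {p : OnePoint ℂ}

theorem extHolAt_iff_exists_holAt : ExtHolAt C φ p ↔
    ∃ h : OnePoint ℂ → V, HolAt h p ∧ ∀ᶠ q in 𝓝 p, q ∉ C → φ q = h q := by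
  simp_rw [nhds_eq_map_chart p, Filter.eventually_map, holAt_iff]
  constructor
  · rintro ⟨k, hk, e⟩
    have hext w : Function.extend (chart p) k 0 (chart p w) = k w :=
      (chart_injective p).extend_apply k 0 w
    exact ⟨Function.extend (chart p) k 0, by simpa only [hext], by simpa only [hext]⟩
  · rintro ⟨h, hh, e⟩
    exact ⟨_, hh, e⟩

theorem HolAt.extHolAt (h : HolAt φ p) : ExtHolAt C φ p := .of_analyticAt (holAt_iff.1 h)

theorem ExtHolAt.congr (h : ExtHolAt C φ p) (e : ∀ᶠ q in 𝓝 p, q ∉ C → ψ q = φ q) :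
    ExtHolAt C ψ p := by
  rw [nhds_eq_map_chart p, Filter.eventually_map] at e
  exact ExtAt.congr h e

theorem ExtHolAt.smul {s : OnePoint ℂ → ℂ} (hs : HolAt s p) (h : ExtHolAt C φ p) :
    ExtHolAt C (fun q => s q • φ q) p :=
  ExtAt.smul (holAt_iff.1 hs) h

theorem ExtHolAt.neg (h : ExtHolAt C φ p) : ExtHolAt C (fun q => -φ q) p :=
  ExtAt.neg h

theorem ExtHolAt.sub (h : ExtHolAt C φ p) (h' : ExtHolAt C ψ p) :
    ExtHolAt C (fun q => φ q - ψ q) p :=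
  ExtAt.sub h h'

theorem ExtHolAt.linear [FiniteDimensional ℂ V] (L : V →ₗ[ℂ] V) (h : ExtHolAt C φ p) :
    ExtHolAt C (fun q => L (φ q)) p :=
  ExtAt.linear L h

theorem ExtHolAt.comp_smul {m : GL (Fin 2) ℂ} (h : ExtHolAt C φ (m • p))
    (hD : ∀ q ∉ D, m • q ∉ C) : ExtHolAt D (fun q => φ (m • q)) p := by
  obtain ⟨k, hk, e⟩ := extHolAt_iff_exists_holAt.1 h
  refine extHolAt_iff_exists_holAt.2 ⟨fun q => k (m • q), hk.comp_smul, ?_⟩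
  filter_upwards [(tendsto_smul m p).eventually e] with q h1 hq using h1 (hD q hq)

theorem ExtHolAt.eventually_holAt [FiniteDimensional ℂ V] (hC : IsClosed C)
    (h : ExtHolAt C φ p) : ∀ᶠ q in 𝓝 p, q ∉ C → HolAt φ q := by
  obtain ⟨k, hk, e⟩ := extHolAt_iff_exists_holAt.1 h
  filter_upwards [hk.eventually, e.eventually_nhds] with q hkq eq hq
  refine hkq.congr ?_
  filter_upwards [eq, hC.isOpen_compl.mem_nhds hq] with r er hr using (er hr).symm

theorem extHolAt_coe_iff {z : ℂ} : ExtHolAt C φ (z : OnePoint ℂ) ↔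
    ExtAt ((fun w : ℂ => (w : OnePoint ℂ)) ⁻¹' C) (fun w : ℂ => φ w) z :=
  Iff.rfl

theorem extHolAt_realProj_coe_iff {z : ℂ} : ExtHolAt realProj φ (z : OnePoint ℂ) ↔
    ExtAt realAxis (fun w : ℂ => φ w) z := by
  rw [ExtHolAt, preimage_chart_realProj]
  rfl

section Hyperfunction

variable {Ω : Set (OnePoint ℂ)} {F G : OnePoint ℂ → V}

theorem mem_boundaryFunctions_iff :
    F ∈ boundaryFunctions Ω V ↔ ∀ p ∈ Ω, ∀ᶠ q in 𝓝 p, q ∉ realProj → HolAt F q :=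
  eventually_nhdsSet_iff_forall

variable [FiniteDimensional ℂ V]

theorem mem_extendableFunctions_iff :
    F ∈ extendableFunctions Ω V ↔ ∀ p ∈ Ω, ExtHolAt realProj F p := by
  constructor
  · rintro ⟨h, hh, e⟩ p hp
    exact extHolAt_iff_exists_holAt.2 ⟨h, hh p hp, eventually_nhdsSet_iff_forall.1 e p hp⟩
  · intro hF
    obtain ⟨k, hk, hk'⟩ := exists_extension_of_dense_compl dense_realProj_compl F
    refine ⟨k, fun p hp => ?_, .of_forall fun q hq => (hk q hq).symm⟩
    obtain ⟨h, hh, e⟩ := extHolAt_iff_exists_holAt.1 (hF p hp)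
    have hcont : ∀ᶠ q in 𝓝 p, ContinuousAt h q := hh.eventually.mono fun _ => HolAt.continuousAt
    exact hh.congr ((hk' p h hcont e).mono fun q hq => hq.symm)

theorem hyperfunction_mk_eq_iff (hF : F ∈ boundaryFunctions Ω V) (hG : G ∈ boundaryFunctions Ω V) :
    (Submodule.Quotient.mk ⟨F, hF⟩ : Hyperfunction Ω V) = Submodule.Quotient.mk ⟨G, hG⟩ ↔
      ∀ p ∈ Ω, ExtHolAt realProj (fun q => F q - G q) p := by
  rw [Submodule.Quotient.eq, ← mem_extendableFunctions_iff]
  rfl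

theorem hyperfunction_mk_eq_zero_iff (hF : F ∈ boundaryFunctions Ω V) :
    (Submodule.Quotient.mk ⟨F, hF⟩ : Hyperfunction Ω V) = 0 ↔
      ∀ p ∈ Ω, ExtHolAt realProj F p := by
  rw [Submodule.Quotient.mk_eq_zero, ← mem_extendableFunctions_iff]
  rfl

end Hyperfunction

end ProjectiveLine

section AutomorphyFactor

theorem mul_cpow_of_re_pos {x y : ℂ} (hx : 0 < x.re) (hy : 0 < y.re) (s : ℂ) :
    (x * y) ^ s = x ^ s * y ^ s := by
  have hx0 : x ≠ 0 := fun h => by simp [h] at hx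
  have hy0 : y ≠ 0 := fun h => by simp [h] at hy
  have hargx := abs_lt.1 (Complex.abs_arg_lt_pi_div_two_iff.2 (.inl hx))
  have hargy := abs_lt.1 (Complex.abs_arg_lt_pi_div_two_iff.2 (.inl hy))
  rw [Complex.cpow_def_of_ne_zero (mul_ne_zero hx0 hy0), Complex.cpow_def_of_ne_zero hx0,
    Complex.cpow_def_of_ne_zero hy0, Complex.log_mul hx0 hy0 ⟨by linarith, by linarith⟩, add_mul,
    Complex.exp_add]

theorem sq_add_sq_pos_of_det_eq_one {a b c d : ℝ} (h : a * d - b * c = 1) : 0 < c ^ 2 + d ^ 2 := by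
  have hcop : IsCoprime c d := ⟨-b, a, by linarith⟩
  exact hcop.sq_add_sq_ne_zero.symm.lt_of_le (by positivity)

theorem SL2_det_eq (g : SL(2, ℝ)) : g 0 0 * g 1 1 - g 0 1 * g 1 0 = 1 :=
  (Matrix.det_fin_two _).symm.trans g.det_coe

variable (g h : SL(2, ℝ)) {p : OnePoint ℂ} {z : ℂ}

theorem autFactor_infty : autFactor g ∞ = 1 / ((g 1 0 : ℂ) ^ 2 + (g 1 1 : ℂ) ^ 2) := rfl

theorem autFactor_coe (z : ℂ) : autFactor g (z : OnePoint ℂ) =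
    (1 + z ^ 2) / (((g 1 0 : ℂ) * z - g 0 0) ^ 2 + ((g 1 1 : ℂ) * z - g 0 1) ^ 2) := rfl

theorem autFactor_re_pos (hp : p ∈ realProj) : 0 < (autFactor g p).re := by
  have hdet := SL2_det_eq g
  rcases eq_infty_or_ofReal_of_mem_realProj hp with rfl | ⟨x, rfl⟩
  · have hpos := sq_add_sq_pos_of_det_eq_one hdet
    have e : autFactor g ∞ = ((1 / (g 1 0 ^ 2 + g 1 1 ^ 2) : ℝ) : ℂ) := by
      rw [autFactor_infty]
      push_cast
      rfl
    rw [e, Complex.ofReal_re]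
    positivity
  · have hpos : 0 < (g 1 0 * x - g 0 0) ^ 2 + (g 1 1 * x - g 0 1) ^ 2 :=
      sq_add_sq_pos_of_det_eq_one (a := g 1 0) (b := g 1 1) (by linear_combination hdet)
    have e : autFactor g ((x : ℂ) : OnePoint ℂ) =
        (((1 + x ^ 2) / ((g 1 0 * x - g 0 0) ^ 2 + (g 1 1 * x - g 0 1) ^ 2) : ℝ) : ℂ) := by
      rw [autFactor_coe]
      push_cast
      rfl
    rw [e, Complex.ofReal_re]
    positivity

theorem eventually_autFactor_re_pos (hp : p ∈ realProj) : ∀ᶠ q in 𝓝 p, 0 < (autFactor g q).re := by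
  have hcont := (holAt_autFactor_cpow 1 g hp).continuousAt
  simp only [Complex.cpow_one] at hcont
  exact (Complex.continuous_re.continuousAt.comp hcont).eventually_const_lt (autFactor_re_pos g hp)

theorem inv_smul_coe_of_im_ne_zero (hz : z.im ≠ 0) :
    -(g 1 0 : ℂ) * z + g 0 0 ≠ 0 ∧ (Matrix.SpecialLinearGroup.mapGL ℂ g)⁻¹ • (z : OnePoint ℂ) =
      ((((g 1 1 : ℂ) * z - g 0 1) / (-(g 1 0 : ℂ) * z + g 0 0) : ℂ) : OnePoint ℂ) := by
  have hne : -(g 1 0 : ℂ) * z + g 0 0 ≠ 0 := by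
    intro hzero
    have hc : g 1 0 = 0 := by
      simpa [hz] using congrArg Complex.im hzero
    have ha : g 0 0 = 0 := by
      simpa [hc] using hzero
    simpa [ha, hc] using SL2_det_eq g
  exact ⟨hne, by rw [inv_smul_coe, if_neg hne]⟩

theorem inv_smul_infty : (Matrix.SpecialLinearGroup.mapGL ℂ g)⁻¹ • (∞ : OnePoint ℂ) =
    if -(g 1 0 : ℂ) = 0 then ∞ else (((g 1 1 : ℂ) / -(g 1 0 : ℂ) : ℂ) : OnePoint ℂ) := by
  have e (i j : Fin 2) : (Matrix.SpecialLinearGroup.mapGL ℂ g⁻¹) i j = ((g⁻¹ i j : ℝ) : ℂ) := rfl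
  have e00 : g⁻¹ 0 0 = g 1 1 := by rw [Matrix.SpecialLinearGroup.SL2_inv_expl]; rfl
  have e10 : g⁻¹ 1 0 = -g 1 0 := by rw [Matrix.SpecialLinearGroup.SL2_inv_expl]; rfl
  rw [← map_inv, OnePoint.smul_infty_eq_ite]
  simp only [e, e00, e10, Complex.ofReal_neg]

variable {g}

theorem inv_smul_infty_eq_ofReal (hg : g 1 0 ≠ 0) :
    ∃ x : ℝ, (Matrix.SpecialLinearGroup.mapGL ℂ g)⁻¹ • (∞ : OnePoint ℂ) =
      ((x : ℂ) : OnePoint ℂ) := by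
  refine ⟨g 1 1 / -g 1 0, ?_⟩
  rw [inv_smul_infty, if_neg (neg_ne_zero.2 (by exact_mod_cast hg))]
  push_cast
  rfl

theorem autFactor_eq_one_of_rotation (h₁ : g 0 0 = g 1 1) (h₂ : g 0 1 = -g 1 0)
    (hp : autFactor g p ≠ 0) : autFactor g p = 1 := by
  have hdet : (g 1 0 : ℂ) ^ 2 + (g 1 1 : ℂ) ^ 2 = 1 := by
    have := SL2_det_eq g
    rw [h₁, h₂] at this
    exact_mod_cast (by linear_combination this : g 1 0 ^ 2 + g 1 1 ^ 2 = 1)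
  cases p with
  | infty => rw [autFactor_infty, hdet, div_one]
  | coe z =>
    have hden : ((g 1 0 : ℂ) * z - g 0 0) ^ 2 + ((g 1 1 : ℂ) * z - g 0 1) ^ 2 = 1 + z ^ 2 := by
      rw [h₁, h₂]
      push_cast
      linear_combination (1 + z ^ 2) * hdet
    rw [autFactor_coe, hden] at hp ⊢
    exact div_self (div_ne_zero_iff.1 hp).1

theorem autFactor_mul (hz : z.im ≠ 0) (hg : autFactor g (z : OnePoint ℂ) ≠ 0) :
    autFactor (g * h) (z : OnePoint ℂ) = autFactor g (z : OnePoint ℂ) *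
      autFactor h ((Matrix.SpecialLinearGroup.mapGL ℂ g)⁻¹ • (z : OnePoint ℂ)) := by
  obtain ⟨hne, e⟩ := inv_smul_coe_of_im_ne_zero g hz
  rw [autFactor_coe] at hg
  have hden := (div_ne_zero_iff.1 hg).2
  have hmul (i j : Fin 2) : (g * h) i j = g i 0 * h 0 j + g i 1 * h 1 j := by
    simp [Matrix.mul_apply, Fin.sum_univ_two]
  rw [e, autFactor_coe, autFactor_coe, autFactor_coe]
  simp only [hmul]
  push_cast
  generalize (g 0 0 : ℂ) = a at *
  generalize (g 0 1 : ℂ) = b at *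
  generalize (g 1 0 : ℂ) = c at *
  generalize (g 1 1 : ℂ) = d at *
  have hnum : 1 + ((d * z - b) / (-c * z + a)) ^ 2 =
      ((c * z - a) ^ 2 + (d * z - b) ^ 2) / (-c * z + a) ^ 2 := by
    rw [eq_div_iff (pow_ne_zero 2 hne), add_mul, ← mul_pow, div_mul_cancel₀ _ hne]
    ring
  have hlin (u v : ℂ) : u * ((d * z - b) / (-c * z + a)) - v =
      ((c * v + d * u) * z - (a * v + b * u)) / (-c * z + a) := by
    rw [eq_div_iff hne, sub_mul, mul_assoc, div_mul_cancel₀ _ hne]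
    ring
  rw [hnum, hlin, hlin, div_pow, div_pow, ← add_div, div_div_div_cancel_right₀ (pow_ne_zero 2 hne),
    div_mul_div_cancel₀ hden]

end AutomorphyFactor

section Slash

variable {V : Type*} [NormedAddCommGroup V] [NormedSpace ℂ V]
  (ν : ℂ) (η : Representation ℂ PSL(2, ℤ) V)

/-- The image of `γ` in `SL(2, ℝ)`. -/
abbrev toSLReal (γ : SL(2, ℤ)) : SL(2, ℝ) :=
  Matrix.SpecialLinearGroup.map (Int.castRingHom ℝ) γ

/-- The operator `f ↦ η(γ) π_ν(γ) f` on functions. It is multiplicative in `γ` only near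
`ℙ¹(ℝ)`, where the principal powers are. -/
noncomputable def slashFun (γ : SL(2, ℤ)) (F : OnePoint ℂ → V) : OnePoint ℂ → V :=
  fun p => η (cls γ) (principalSeriesFun ν (toSLReal γ) F p)

variable {p : OnePoint ℂ} {F : OnePoint ℂ → V}

theorem slashFun_apply (γ : SL(2, ℤ)) (F : OnePoint ℂ → V) (p : OnePoint ℂ) :
    slashFun ν η γ F p = autFactor (toSLReal γ) p ^ (ν + 1 / 2) •
      η (cls γ) (F ((Matrix.SpecialLinearGroup.mapGL ℂ (toSLReal γ))⁻¹ • p)) := by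
  simp [slashFun, principalSeriesFun]

theorem eventually_slashFun_one (F : OnePoint ℂ → V) (hp : p ∈ realProj) :
    ∀ᶠ q in 𝓝 p, slashFun ν η 1 F q = F q := by
  filter_upwards [eventually_autFactor_re_pos (toSLReal 1) hp] with q hq
  have hne : autFactor (toSLReal 1) q ≠ 0 := fun h0 => hq.ne' (by rw [h0, Complex.zero_re])
  have hcls : cls 1 = 1 := rfl
  rw [slashFun_apply, autFactor_eq_one_of_rotation (by simp) (by simp) hne, hcls]
  simp

theorem eventually_slashFun_mul (γ δ : SL(2, ℤ)) (F : OnePoint ℂ → V) (hp : p ∈ realProj) :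
    ∀ᶠ q in 𝓝 p, q ∉ realProj →
      slashFun ν η (γ * δ) F q = slashFun ν η γ (slashFun ν η δ F) q := by
  have hδ := eventually_autFactor_re_pos (toSLReal δ)
    ((inv_smul_mem_realProj_iff (toSLReal γ)).2 hp)
  filter_upwards [(tendsto_smul _ p).eventually hδ, eventually_autFactor_re_pos (toSLReal γ) hp]
    with q hδq hγq hq
  obtain ⟨z, hz, rfl⟩ := exists_coe_of_notMem_realProj hq
  have hne : autFactor (toSLReal γ) (z : OnePoint ℂ) ≠ 0 := fun h0 => by simp [h0] at hγq
  have hSL : toSLReal (γ * δ) = toSLReal γ * toSLReal δ := map_mul _ _ _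
  have hcls : cls (γ * δ) = cls γ * cls δ := rfl
  rw [slashFun_apply, slashFun_apply, slashFun_apply, hSL, autFactor_mul _ hz hne,
    mul_cpow_of_re_pos hγq hδq, hcls, map_mul, map_mul, mul_inv_rev, mul_smul, mul_smul, map_smul]
  rfl

variable [FiniteDimensional ℂ V]

theorem slashFun_mem_boundaryFunctions (γ : SL(2, ℤ)) (hF : F ∈ boundaryFunctions realProj V) :
    slashFun ν η γ F ∈ boundaryFunctions realProj V := by
  have hmem := mem_boundaryFunctions_iff.1 (principalSeriesFun_boundary ν (toSLReal γ) hF)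
  refine mem_boundaryFunctions_iff.2 fun p hp => ?_
  filter_upwards [hmem p hp] with q h1 hq using (h1 hq).linear _

theorem ExtHolAt.slashFun {γ : SL(2, ℤ)} (hp : p ∈ realProj)
    (h : ExtHolAt realProj F ((Matrix.SpecialLinearGroup.mapGL ℂ (toSLReal γ))⁻¹ • p)) :
    ExtHolAt realProj (slashFun ν η γ F) p := by
  have hcomp := h.comp_smul (D := realProj) fun q hq hq' =>
    hq ((inv_smul_mem_realProj_iff _).1 hq')
  exact ((hcomp.linear (η (cls γ))).smul
    (holAt_autFactor_cpow (ν + 1 / 2) (toSLReal γ) hp)).congr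
      (.of_forall fun q _ => slashFun_apply ν η γ F q)

theorem hyperfunction_mk_eq_of_eventually_eq {Ω : Set (OnePoint ℂ)} {F G : OnePoint ℂ → V}
    (hF : F ∈ boundaryFunctions Ω V) (hG : G ∈ boundaryFunctions Ω V)
    (h : ∀ p ∈ Ω, ∀ᶠ q in 𝓝 p, q ∉ realProj → F q = G q) :
    (Submodule.Quotient.mk ⟨F, hF⟩ : Hyperfunction Ω V) = Submodule.Quotient.mk ⟨G, hG⟩ := by
  refine (hyperfunction_mk_eq_iff hF hG).2 fun p hp => (HolAt.zero p).extHolAt.congr ?_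
  filter_upwards [h p hp] with q hFG hq
  rw [hFG hq, sub_self, Pi.zero_apply]

/-- The representation `γ ↦ η(γ) π_ν(γ)` on hyperfunctions, whose invariants are the
automorphic hyperfunctions. -/
noncomputable def slash : Representation ℂ SL(2, ℤ) (Hyperfunction realProj V) where
  toFun γ := valueMap (η (cls γ)) ∘ₗ principalSeries V ν (toSLReal γ)
  map_one' := LinearMap.ext fun α => by
    obtain ⟨⟨F, hF⟩, rfl⟩ := Submodule.Quotient.mk_surjective _ α
    exact hyperfunction_mk_eq_of_eventually_eq (slashFun_mem_boundaryFunctions ν η 1 hF) hF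
      fun p hp => (eventually_slashFun_one ν η F hp).mono fun _ h _ => h
  map_mul' γ δ := LinearMap.ext fun α => by
    obtain ⟨⟨F, hF⟩, rfl⟩ := Submodule.Quotient.mk_surjective _ α
    have hδF := slashFun_mem_boundaryFunctions ν η δ hF
    exact hyperfunction_mk_eq_of_eventually_eq (slashFun_mem_boundaryFunctions ν η (γ * δ) hF)
      (slashFun_mem_boundaryFunctions ν η γ hδF) fun p hp => eventually_slashFun_mul ν η γ δ F hp

theorem slash_mk (γ : SL(2, ℤ)) (hF : F ∈ boundaryFunctions realProj V) :
    slash ν η γ (Submodule.Quotient.mk ⟨F, hF⟩) =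
      Submodule.Quotient.mk ⟨slashFun ν η γ F, slashFun_mem_boundaryFunctions ν η γ hF⟩ :=
  rfl

variable {ν η}

theorem mem_automorphicHyperfunctions_iff {α : Hyperfunction realProj V} :
    α ∈ automorphicHyperfunctions ν η ↔ ∀ γ, slash ν η γ α = α :=
  Iff.rfl

theorem slash_mk_eq_self_iff {γ : SL(2, ℤ)} (hF : F ∈ boundaryFunctions realProj V) :
    slash ν η γ (Submodule.Quotient.mk ⟨F, hF⟩) = Submodule.Quotient.mk ⟨F, hF⟩ ↔
      ∀ p ∈ realProj, ExtHolAt realProj (fun q => slashFun ν η γ F q - F q) p := by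
  rw [slash_mk, hyperfunction_mk_eq_iff]

end Slash

section Generators

open ModularGroup (S T)

theorem cls_neg (γ : SL(2, ℤ)) : cls (-γ) = cls γ := by
  refine QuotientGroup.eq.2 (Subgroup.mem_center_iff.2 fun g => ?_)
  have hinv : (-γ)⁻¹ * γ = -1 := by
    rw [inv_mul_eq_iff_eq_mul, neg_mul_neg, mul_one]
  rw [hinv, mul_neg_one, neg_one_mul]

theorem cls_S : cls S = modS := by
  have hS : S = -⟨!![0, 1; -1, 0], by simp [Matrix.det_fin_two]⟩ := by
    ext i j
    fin_cases i <;> fin_cases j <;> rfl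
  rw [hS]
  exact cls_neg _

theorem S_mul_S : S * S = -1 := by
  ext i j
  fin_cases i <;> fin_cases j <;> rfl

theorem modS_mul_modS : modS * modS = 1 := by
  have hmul : modS * modS = cls (S * S) := by
    rw [← cls_S]
    rfl
  rw [hmul, S_mul_S]
  exact cls_neg 1

theorem cls_T_zpow (n : ℤ) : cls (T ^ n) = modT ^ n := rfl

theorem toSLReal_S_apply : (toSLReal S) 0 0 = 0 ∧ (toSLReal S) 0 1 = -1 ∧
    (toSLReal S) 1 0 = 1 ∧ (toSLReal S) 1 1 = 0 := by
  have e (i j : Fin 2) : (toSLReal S) i j = ((S.1 i j : ℤ) : ℝ) := rfl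
  simp [e, ModularGroup.coe_S]

theorem toSLReal_T_zpow_apply (n : ℤ) :
    (toSLReal (T ^ n)) 0 0 = 1 ∧ (toSLReal (T ^ n)) 0 1 = n ∧
      (toSLReal (T ^ n)) 1 0 = 0 ∧ (toSLReal (T ^ n)) 1 1 = 1 := by
  have e (i j : Fin 2) : (toSLReal (T ^ n)) i j = (((T ^ n : SL(2, ℤ)).1 i j : ℤ) : ℝ) := rfl
  rw [e, e, e, e, ModularGroup.coe_T_zpow]
  simp

/-- The transformation `z ↦ -1/z` of the projective line. -/
noncomputable abbrev negInv : GL (Fin 2) ℂ :=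
  (Matrix.SpecialLinearGroup.mapGL ℂ (toSLReal S))⁻¹

theorem negInv_smul_coe (z : ℂ) : negInv • (z : OnePoint ℂ) =
    if z = 0 then ∞ else ((-1 / z : ℂ) : OnePoint ℂ) := by
  obtain ⟨h1, h2, h3, h4⟩ := toSLReal_S_apply
  rw [inv_smul_coe, h1, h2, h3, h4]
  by_cases hz : z = 0
  · simp [hz]
  · simp [hz, div_neg, neg_div]

theorem negInv_smul_zero : negInv • ((0 : ℂ) : OnePoint ℂ) = ∞ := by
  rw [negInv_smul_coe, if_pos rfl]

theorem negInv_smul_of_ne_zero {z : ℂ} (hz : z ≠ 0) :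
    negInv • (z : OnePoint ℂ) = ((-1 / z : ℂ) : OnePoint ℂ) := by
  rw [negInv_smul_coe, if_neg hz]

theorem negInv_smul_infty : negInv • (∞ : OnePoint ℂ) = ((0 : ℂ) : OnePoint ℂ) := by
  obtain ⟨-, -, h3, h4⟩ := toSLReal_S_apply
  rw [inv_smul_infty, h3, h4]
  simp

theorem negInv_smul_negInv_smul (p : OnePoint ℂ) : negInv • negInv • p = p := by
  cases p with
  | infty => rw [negInv_smul_infty, negInv_smul_zero]
  | coe z =>
    by_cases hz : z = 0
    · rw [hz, negInv_smul_zero, negInv_smul_infty]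
    · rw [negInv_smul_of_ne_zero hz, negInv_smul_of_ne_zero (by simpa using hz)]
      congr 1
      field_simp

end Generators

section Weight

theorem one_add_sq_re_pos (x : ℝ) : 0 < (1 + (x : ℂ) ^ 2).re := by
  have hre : 1 + (x : ℂ) ^ 2 = ((1 + x ^ 2 : ℝ) : ℂ) := by push_cast; rfl
  rw [hre, Complex.ofReal_re]
  positivity

theorem eventually_one_add_sq_re_pos (x : ℝ) : ∀ᶠ z : ℂ in 𝓝 (x : ℂ), 0 < (1 + z ^ 2).re := by
  have hcont : ContinuousAt (fun z : ℂ => (1 + z ^ 2).re) x := by fun_prop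
  exact hcont.eventually_const_lt (one_add_sq_re_pos x)

theorem cpow_ne_zero_of_re_pos {z : ℂ} (hz : 0 < z.re) (s : ℂ) : z ^ s ≠ 0 := fun h => by
  rw [Complex.cpow_eq_zero_iff] at h
  simp [h.1] at hz

theorem analyticAt_weight {z : ℂ} (hz : 0 < (1 + z ^ 2).re) (s : ℂ) :
    AnalyticAt ℂ (fun z : ℂ => (1 + z ^ 2) ^ s) z :=
  AnalyticAt.cpow (by fun_prop) analyticAt_const (Or.inl hz)

theorem analyticAt_weight_inv {z : ℂ} (hz : 0 < (1 + z ^ 2).re) (s : ℂ) :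
    AnalyticAt ℂ (fun z : ℂ => ((1 + z ^ 2) ^ s)⁻¹) z :=
  (analyticAt_weight hz s).inv (cpow_ne_zero_of_re_pos hz s)

theorem div_cpow_mul_cpow {z w : ℂ} (hzw : 0 < (z / w).re) (hw : 0 < w.re) (s : ℂ) :
    (z / w) ^ s * w ^ s = z ^ s := by
  have hw0 : w ≠ 0 := fun h => by simp [h] at hw
  rw [← mul_cpow_of_re_pos hzw hw, div_mul_cancel₀ _ hw0]

theorem eventually_T_zpow_re_pos (n : ℤ) (x : ℝ) : ∀ᶠ z : ℂ in 𝓝 (x : ℂ),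
    0 < ((1 + z ^ 2) / (1 + (z - n) ^ 2)).re ∧ 0 < (1 + (z - n) ^ 2).re := by
  have hden : 0 < (1 + ((x : ℂ) - n) ^ 2).re := by
    exact_mod_cast one_add_sq_re_pos (x - n)
  have hquot : 0 < ((1 + (x : ℂ) ^ 2) / (1 + ((x : ℂ) - n) ^ 2)).re := by
    have hre : (1 + (x : ℂ) ^ 2) / (1 + ((x : ℂ) - n) ^ 2) =
        (((1 + x ^ 2) / (1 + (x - n) ^ 2) : ℝ) : ℂ) := by
      push_cast
      rfl
    rw [hre, Complex.ofReal_re]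
    positivity
  have hne : 1 + ((x : ℂ) - n) ^ 2 ≠ 0 := fun h => by simp [h] at hden
  have hcden : ContinuousAt (fun z : ℂ => (1 + (z - n) ^ 2).re) x := by fun_prop
  have hcquot : ContinuousAt (fun z : ℂ => ((1 + z ^ 2) / (1 + (z - n) ^ 2)).re) x :=
    Complex.continuous_re.continuousAt.comp (ContinuousAt.div (by fun_prop) (by fun_prop) hne)
  exact (hcquot.eventually_const_lt hquot).and (hcden.eventually_const_lt hden)

theorem im_neg_one_div_ne_zero {z : ℂ} (hz : z.im ≠ 0) : (-1 / z).im ≠ 0 := by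
  have hz0 : z ≠ 0 := fun h => hz (by simp [h])
  rw [neg_div, one_div, Complex.neg_im, Complex.inv_im, neg_ne_zero, div_ne_zero_iff, neg_ne_zero]
  exact ⟨hz, by simpa using hz0⟩

theorem analyticAt_neg_one_div {z : ℂ} (hz : z ≠ 0) : AnalyticAt ℂ (fun w : ℂ => -1 / w) z :=
  analyticAt_const.div analyticAt_id hz

theorem weight_mul_cpow {z : ℂ} (hz : 0 < z.re) (hzz : 0 < (z * z).re)
    (hinv : 0 < (1 + (-1 / z) ^ 2).re) (ν : ℂ) :
    (1 + z ^ 2) ^ (ν + 1 / 2) * z ^ (-2 * ν - 1) = (1 + (-1 / z) ^ 2) ^ (ν + 1 / 2) := by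
  have hz0 : z ≠ 0 := fun h => by simp [h] at hz
  have hsplit : 1 + z ^ 2 = z * z * (1 + (-1 / z) ^ 2) := by
    field_simp
    ring
  have hexp : -2 * ν - 1 = -((ν + 1 / 2) + (ν + 1 / 2)) := by ring
  have hpow := cpow_ne_zero_of_re_pos hz (ν + 1 / 2)
  rw [hsplit, mul_cpow_of_re_pos hzz hinv, mul_cpow_of_re_pos hz hz, hexp, Complex.cpow_neg,
    Complex.cpow_add (ν + 1 / 2) (ν + 1 / 2) hz0, mul_right_comm,
    mul_inv_cancel₀ (mul_ne_zero hpow hpow), one_mul]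

theorem eventually_weight_mul_cpow {x : ℝ} (hx : 0 < x) (ν : ℂ) : ∀ᶠ z : ℂ in 𝓝 (x : ℂ),
    0 < (1 + (-1 / z) ^ 2).re ∧ (1 + z ^ 2) ^ (ν + 1 / 2) * z ^ (-2 * ν - 1) =
      (1 + (-1 / z) ^ 2) ^ (ν + 1 / 2) := by
  have htendsto : Filter.Tendsto (fun z : ℂ => -1 / z) (𝓝 (x : ℂ)) (𝓝 ((-1 / x : ℝ) : ℂ)) := by
    simpa using (analyticAt_neg_one_div (Complex.ofReal_ne_zero.2 hx.ne')).continuousAt.tendsto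
  have hinv : ∀ᶠ z : ℂ in 𝓝 (x : ℂ), 0 < (1 + (-1 / z) ^ 2).re :=
    htendsto.eventually (eventually_one_add_sq_re_pos (-1 / x))
  have hre : ∀ᶠ z : ℂ in 𝓝 (x : ℂ), 0 < z.re :=
    Complex.continuous_re.continuousAt.eventually_const_lt (by simpa using hx)
  have hcont : ContinuousAt (fun z : ℂ => (z * z).re) x := by fun_prop
  have hmul : ∀ᶠ z : ℂ in 𝓝 (x : ℂ), 0 < (z * z).re :=
    hcont.eventually_const_lt (by simp [hx])
  filter_upwards [hinv, hre, hmul] with z hinv hre hmul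
  exact ⟨hinv, weight_mul_cpow hre hmul hinv ν⟩

end Weight

section LocalFormulas

open ModularGroup (S T)

variable {V : Type*} [NormedAddCommGroup V] [NormedSpace ℂ V]
  (ν : ℂ) (η : Representation ℂ PSL(2, ℤ) V)

/-- The function `z ↦ (1 + z²)^(-ν - 1/2) F(z)` on the affine line, inverse to `weighted` near
the real axis. -/
noncomputable def unweighted (F : OnePoint ℂ → V) (z : ℂ) : V :=
  ((1 + z ^ 2) ^ (ν + 1 / 2))⁻¹ • F z

theorem weighted_coe (f : ℂ → V) (z : ℂ) :
    weighted ν f (z : OnePoint ℂ) = (1 + z ^ 2) ^ (ν + 1 / 2) • f z := rfl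

theorem eventually_slashFun_S (F : OnePoint ℂ → V) {p : OnePoint ℂ} (hp : p ∈ realProj) :
    ∀ᶠ q in 𝓝 p, slashFun ν η S F q = η modS (F (negInv • q)) := by
  obtain ⟨h1, h2, h3, h4⟩ := toSLReal_S_apply
  filter_upwards [eventually_autFactor_re_pos (toSLReal S) hp] with q hq
  have hne : autFactor (toSLReal S) q ≠ 0 := fun h0 => by simp [h0] at hq
  rw [slashFun_apply, autFactor_eq_one_of_rotation (h1.trans h4.symm) (by rw [h2, h3]) hne,
    Complex.one_cpow, one_smul, cls_S]

theorem slashFun_T_zpow_coe (n : ℤ) (F : OnePoint ℂ → V) {z : ℂ} (hz : z.im ≠ 0) :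
    slashFun ν η (T ^ n) F (z : OnePoint ℂ) =
      ((1 + z ^ 2) / (1 + (z - n) ^ 2)) ^ (ν + 1 / 2) •
        η (modT ^ n) (F ((z - n : ℂ) : OnePoint ℂ)) := by
  obtain ⟨h1, h2, h3, h4⟩ := toSLReal_T_zpow_apply n
  have hsmul := (inv_smul_coe_of_im_ne_zero (toSLReal (T ^ n)) hz).2
  rw [h1, h2, h3, h4] at hsmul
  have hden : ((0 : ℝ) * z - (1 : ℝ) : ℂ) ^ 2 + ((1 : ℝ) * z - (n : ℝ)) ^ 2 =
      1 + (z - n) ^ 2 := by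
    push_cast
    ring
  have hshift : ((1 : ℝ) * z - (n : ℝ)) / (-(0 : ℝ) * z + (1 : ℝ)) = z - n := by
    push_cast
    ring
  rw [slashFun_apply, autFactor_coe, h1, h2, h3, h4, hden, hsmul, hshift, cls_T_zpow]

theorem extAt_unweighted_T {F : OnePoint ℂ → V} {n : ℤ} {x : ℝ}
    (h : ExtHolAt realProj (fun q => slashFun ν η (T ^ n) F q - F q) (x : ℂ)) :
    ExtAt realAxis (fun z => η (modT ^ n) (unweighted ν F (z - n)) - unweighted ν F z) x := by
  have hext := (extHolAt_realProj_coe_iff.1 h).smul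
    (analyticAt_weight_inv (one_add_sq_re_pos x) (ν + 1 / 2))
  refine hext.congr ?_
  filter_upwards [eventually_T_zpow_re_pos n x] with z ⟨hquot, hshift⟩ him
  have hne := cpow_ne_zero_of_re_pos hquot (ν + 1 / 2)
  rw [slashFun_T_zpow_coe ν η n F him, smul_sub, smul_smul, unweighted, unweighted, map_smul,
    ← div_cpow_mul_cpow hquot hshift, mul_inv, mul_right_comm, inv_mul_cancel₀ hne, one_mul]

theorem extAt_unweighted_S {F : OnePoint ℂ → V} {x : ℝ} (hx : 0 < x)
    (h : ExtHolAt realProj (fun q => slashFun ν η S F q - F q) (x : ℂ)) :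
    ExtAt realAxis (fun z => z ^ (-2 * ν - 1) •
      η modS (unweighted ν F (-1 / z)) - unweighted ν F z) x := by
  have hext := (extHolAt_realProj_coe_iff.1 h).smul
    (analyticAt_weight_inv (one_add_sq_re_pos x) (ν + 1 / 2))
  refine hext.congr ?_
  filter_upwards [eventually_weight_mul_cpow hx ν,
    eventually_nhds_coe_iff.1 (eventually_slashFun_S ν η F (ofReal_mem_realProj x))]
    with z ⟨hinv, hweight⟩ hslash him
  have hz0 : z ≠ 0 := fun h => him (by simp [h])
  have hpow : z ^ (-2 * ν - 1) ≠ 0 := fun h0 =>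
    cpow_ne_zero_of_re_pos hinv (ν + 1 / 2) (by rw [← hweight, h0, mul_zero])
  rw [hslash, negInv_smul_of_ne_zero hz0, smul_sub, unweighted, unweighted, map_smul, smul_smul,
    ← hweight, mul_inv, mul_comm (_⁻¹) (_⁻¹), mul_inv_cancel_left₀ hpow]

end LocalFormulas

section PeriodicHyperfunctions

variable {V : Type*} [NormedAddCommGroup V] [NormedSpace ℂ V]
  {ν : ℂ} {η : Representation ℂ PSL(2, ℤ) V}

theorem weighted_add (ν : ℂ) (f g : ℂ → V) : weighted ν (f + g) = weighted ν f + weighted ν g := by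
  ext p
  cases p with
  | infty => exact (add_zero 0).symm
  | coe z => exact smul_add _ _ _

theorem weighted_smul (ν c : ℂ) (f : ℂ → V) : weighted ν (c • f) = c • weighted ν f := by
  ext p
  cases p with
  | infty => exact (smul_zero c).symm
  | coe z => exact smul_comm _ _ _

theorem extAt_weighted_sub_iff {F : OnePoint ℂ → V} {f : ℂ → V} {x : ℝ} :
    ExtAt realAxis (fun z : ℂ => weighted ν f z - F z) x ↔
      ExtAt realAxis (fun z => f z - unweighted ν F z) x := by
  have hpos := one_add_sq_re_pos x
  constructor <;> intro h
  · refine (h.smul (analyticAt_weight_inv hpos (ν + 1 / 2))).congr ?_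
    filter_upwards [eventually_one_add_sq_re_pos x] with z hz _
    rw [weighted_coe, smul_sub, smul_smul, inv_mul_cancel₀ (cpow_ne_zero_of_re_pos hz _), one_smul,
      unweighted]
  · refine (h.smul (analyticAt_weight hpos (ν + 1 / 2))).congr ?_
    filter_upwards [eventually_one_add_sq_re_pos x] with z hz _
    rw [weighted_coe, smul_sub, unweighted, smul_smul,
      mul_inv_cancel₀ (cpow_ne_zero_of_re_pos hz _), one_smul]

theorem analyticOffAt_unweighted {F : OnePoint ℂ → V} (hF : F ∈ boundaryFunctions realProj V)
    (x : ℝ) : AnalyticOffAt realAxis (unweighted ν F) x := by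
  refine AnalyticOffAt.smul (analyticAt_weight_inv (one_add_sq_re_pos x) (ν + 1 / 2)) ?_
  have hHol := eventually_nhds_coe_iff.1 (mem_boundaryFunctions_iff.1 hF _ (ofReal_mem_realProj x))
  filter_upwards [hHol] with z h hz using h fun h0 => hz (coe_mem_realProj_iff.1 h0)

theorem apply_add_natCast {f : ℂ → V} (hf : ∀ z : ℂ, z.im ≠ 0 → f (z + 1) = η modT (f z)) (n : ℕ) :
    ∀ z : ℂ, z.im ≠ 0 → f (z + n) = η (modT ^ n) (f z) := by
  induction n with
  | zero => simp
  | succ n ih =>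
    intro z hz
    rw [Nat.cast_succ, ← add_assoc, hf _ (by simpa using hz), ih z hz, pow_succ', map_mul]
    rfl

variable [FiniteDimensional ℂ V]

theorem analyticAt_of_mem_periodicFunctions {f : ℂ → V} (hf : f ∈ periodicFunctions ν η) {z : ℂ}
    (hz : z.im ≠ 0) : AnalyticAt ℂ f z := by
  have := FiniteDimensional.complete ℂ V
  exact hf.2.1.analyticAt (isClosed_realAxis.isOpen_compl.mem_nhds hz)

theorem weighted_mem_boundaryFunctions {f : ℂ → V} (hf : f ∈ periodicFunctions ν η) :
    weighted ν f ∈ boundaryFunctions realLine V := by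
  refine mem_boundaryFunctions_iff.2 (Set.forall_mem_range.2 fun x => ?_)
  rw [eventually_nhds_coe_iff]
  filter_upwards [eventually_one_add_sq_re_pos x] with z hz hmem
  have him : z.im ≠ 0 := fun h => hmem (coe_mem_realProj_iff.2 h)
  exact holAt_coe.2 ((analyticAt_weight hz _).smul (analyticAt_of_mem_periodicFunctions hf him))

variable (ν η) in
/-- The linear map sending `f` in `periodicFunctions ν η` to the hyperfunction on `ℝ` represented
by `z ↦ (1 + z²)^(ν + 1/2) f(z)`. -/
noncomputable def weightedHyp : periodicFunctions ν η →ₗ[ℂ] Hyperfunction realLine V where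
  toFun f := Submodule.Quotient.mk ⟨weighted ν f, weighted_mem_boundaryFunctions f.2⟩
  map_add' f g := congrArg Submodule.Quotient.mk (Subtype.ext (weighted_add ν (f : ℂ → V) g))
  map_smul' c f := congrArg Submodule.Quotient.mk (Subtype.ext (weighted_smul ν c (f : ℂ → V)))

theorem represents_weighted_iff (f : periodicFunctions ν η) {β : Hyperfunction realLine V} :
    Represents (weighted ν (f : ℂ → V)) β ↔ weightedHyp ν η f = β :=
  ⟨fun ⟨_, h⟩ => h, fun h => ⟨weighted_mem_boundaryFunctions f.2, h⟩⟩

theorem weightedHyp_eq_restrictHyp_mk_iff (f : periodicFunctions ν η) {F : OnePoint ℂ → V}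
    (hF : F ∈ boundaryFunctions realProj V) :
    weightedHyp ν η f =
        restrictHyp V realLine_subset_realProj (Submodule.Quotient.mk ⟨F, hF⟩) ↔
      ∀ x : ℝ, ExtAt realAxis (fun z => (f : ℂ → V) z - unweighted ν F z) x := by
  have hF' : F ∈ boundaryFunctions realLine V :=
    hF.filter_mono (nhdsSet_mono realLine_subset_realProj)
  refine (hyperfunction_mk_eq_iff (weighted_mem_boundaryFunctions f.2) hF').trans ?_
  rw [realLine, Set.forall_mem_range]
  exact forall_congr' fun x => extHolAt_realProj_coe_iff.trans extAt_weighted_sub_iff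

theorem weightedHyp_injective {N : ℕ} (hN : 0 < N) (hη : η (modT ^ N) = 1) :
    Function.Injective (weightedHyp ν η) := by
  have := FiniteDimensional.complete ℂ V
  refine (injective_iff_map_eq_zero _).2 fun ⟨f, hf⟩ hzero => Subtype.ext (funext fun z => ?_)
  have hext : ∀ x : ℝ, ExtAt realAxis f x := fun x => by
    have h := (weightedHyp_eq_restrictHyp_mk_iff ⟨f, hf⟩
      (zero_mem (boundaryFunctions realProj V))).1 hzero x
    exact h.congr (.of_forall fun z _ => by simp [unweighted])
  obtain ⟨hreal, -, hT, -, ⟨v, w, hv, hw, hvw⟩, -⟩ := id hf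
  rw [eq_neg_of_add_eq_zero_right hvw] at hw
  by_cases hz : z.im = 0
  · lift z to ℝ using hz
    exact hreal z
  · refine eq_zero_of_periodic_of_extAt (N := N) (by exact_mod_cast hN)
      (fun z hz => analyticAt_of_mem_periodicFunctions hf hz) hext (fun z hz => ?_) hv hw z hz
    rw [Complex.ofReal_natCast, apply_add_natCast hT N z hz, hη]
    rfl

end PeriodicHyperfunctions

section PeriodicOfAutomorphic

open ModularGroup (S T)

variable {V : Type*} [NormedAddCommGroup V] [NormedSpace ℂ V] [FiniteDimensional ℂ V]
  {ν : ℂ} {η : Representation ℂ PSL(2, ℤ) V}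

theorem tendsto_linear {ι : Type*} {l : Filter ι} {f : ι → V} {v : V} (L : V →ₗ[ℂ] V)
    (hf : Filter.Tendsto f l (𝓝 v)) : Filter.Tendsto (fun i => L (f i)) l (𝓝 (L v)) :=
  ((LinearMap.toContinuousLinearMap L).continuous.tendsto v).comp hf

theorem tendsto_add_one_comap_im (l : Filter ℝ) :
    Filter.Tendsto (fun z : ℂ => z + 1) (Filter.comap Complex.im l)
      (Filter.comap Complex.im l) := by
  have him : Complex.im ∘ (fun z : ℂ => z + 1) = Complex.im := funext fun z => by simp
  rw [Filter.tendsto_comap_iff, him]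
  exact Filter.tendsto_comap

theorem apply_add_one_eq_of_extAt {f g : ℂ → V} {L : V →ₗ[ℂ] V} {N : ℝ} (hN : 0 < N) {v : V}
    (hf : ∀ z : ℂ, z.im ≠ 0 → AnalyticAt ℂ f z) (hper : Function.Periodic f N)
    (hv₁ : Filter.Tendsto f (Filter.comap Complex.im Filter.atTop) (𝓝 v))
    (hv₂ : Filter.Tendsto f (Filter.comap Complex.im Filter.atBot) (𝓝 (-v)))
    (hfg : ∀ x : ℝ, ExtAt realAxis (fun z => f z - g z) x)
    (hg : ∀ x : ℝ, ExtAt realAxis (fun z => L (g (z - 1)) - g z) x) {z : ℂ} (hz : z.im ≠ 0) :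
    f (z + 1) = L (f z) := by
  have := FiniteDimensional.complete ℂ V
  have hshift {φ : ℂ → V} {x : ℝ} (h : ∀ x : ℝ, ExtAt realAxis φ x) :
      ExtAt realAxis (fun z => φ (z + 1)) x :=
    ExtAt.comp (C := realAxis) (k := fun z => z + 1) (by simpa using h (x + 1)) (by fun_prop)
      (.of_forall fun z hz => by simpa using hz)
  have hanalytic : ∀ z : ℂ, z.im ≠ 0 → AnalyticAt ℂ (fun z => f (z + 1) - L (f z)) z :=
    fun z hz => ((hf (z + 1) (by simpa using hz)).fun_comp (f := fun z => z + 1) (by fun_prop)).sub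
      (((LinearMap.toContinuousLinearMap L).analyticAt _).fun_comp (hf z hz))
  have hext : ∀ x : ℝ, ExtAt realAxis (fun z => f (z + 1) - L (f z)) x := fun x => by
    refine (((hshift hfg).sub (hshift hg)).sub ((hfg x).linear L)).congr (.of_forall fun z _ => ?_)
    rw [map_sub, add_sub_cancel_right]
    abel
  refine sub_eq_zero.1 (eq_zero_of_periodic_of_extAt hN hanalytic hext (v := v - L v)
    (fun z _ => ?_) ?_ ?_ z hz)
  · rw [add_right_comm, hper, hper]
  · exact (hv₁.comp (tendsto_add_one_comap_im _)).sub (tendsto_linear L hv₁)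
  · have hbot := (hv₂.comp (tendsto_add_one_comap_im _)).sub (tendsto_linear L hv₂)
    rwa [map_neg, ← neg_sub'] at hbot

theorem exists_equivariant_of_extAt {g : ℂ → V} {N : ℕ} (hN : 0 < N) (hη : η (modT ^ N) = 1)
    (hg : ∀ x : ℝ, AnalyticOffAt realAxis g x)
    (hT : ∀ (n : ℤ) (x : ℝ), ExtAt realAxis (fun z => η (modT ^ n) (g (z - n)) - g z) x) :
    ∃ f : ℂ → V, (∀ z : ℂ, z.im ≠ 0 → AnalyticAt ℂ f z) ∧
      (∀ z : ℂ, z.im ≠ 0 → f (z + 1) = η modT (f z)) ∧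
      (∃ v : V, Filter.Tendsto f (Filter.comap Complex.im Filter.atTop) (𝓝 v) ∧
        Filter.Tendsto f (Filter.comap Complex.im Filter.atBot) (𝓝 (-v))) ∧
      ∀ x : ℝ, ExtAt realAxis (fun z => f z - g z) x := by
  have := FiniteDimensional.complete ℂ V
  have hN' : (0 : ℝ) < N := by exact_mod_cast hN
  have hηN (n : ℤ) : η (modT ^ (n * N)) = 1 := by
    have hmem : (modT ^ N) ^ n ∈ MonoidHom.ker η := zpow_mem (MonoidHom.mem_ker.2 hη) n
    rwa [mul_comm, zpow_mul, zpow_natCast, ← MonoidHom.mem_ker]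
  have hshift : ∀ (n : ℤ) (x : ℝ),
      ExtAt realAxis (fun z => g (z - n * (N : ℝ)) - g z) x := fun n x => by
    have h := hT (n * N) x
    rw [hηN] at h
    simpa using h
  obtain ⟨f, hf, hper, ⟨v, hv₁, hv₂⟩, hfg⟩ := exists_periodic_of_extAt hN' hg hshift
  have hT₁ : ∀ x : ℝ, ExtAt realAxis (fun z => η modT (g (z - 1)) - g z) x := by
    simpa using hT 1
  exact ⟨f, hf, fun z hz => apply_add_one_eq_of_extAt hN' hf hper hv₁ hv₂ hfg hT₁ hz,
    ⟨v, hv₁, hv₂⟩, hfg⟩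

theorem extAt_sub_cpow_smul {f g : ℂ → V} {L : V →ₗ[ℂ] V} {s : ℂ}
    (hf : ∀ z : ℂ, z.im ≠ 0 → AnalyticAt ℂ f z)
    (hfg : ∀ x : ℝ, ExtAt realAxis (fun z => f z - g z) x)
    (hg : ∀ x : ℝ, 0 < x → ExtAt realAxis (fun z => z ^ s • L (g (-1 / z)) - g z) x)
    {z : ℂ} (hz : z ∈ Complex.slitPlane) :
    ExtAt realAxis (fun z => f z - z ^ s • L (f (-1 / z))) z := by
  have hinv := analyticAt_neg_one_div (Complex.slitPlane_ne_zero hz)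
  have hpow : AnalyticAt ℂ (fun z : ℂ => z ^ s) z := analyticAt_id.cpow analyticAt_const hz
  have hinv_off : ∀ᶠ w : ℂ in 𝓝 z, w ∉ realAxis → -1 / w ∉ realAxis :=
    .of_forall fun w hw => im_neg_one_div_ne_zero hw
  by_cases him : z.im = 0
  · lift z to ℝ using him
    have hx : 0 < z := Complex.ofReal_mem_slitPlane.1 hz
    have hfg_inv : ExtAt realAxis (fun w => f (-1 / w) - g (-1 / w)) z :=
      ExtAt.comp (φ := fun w => f w - g w) (by simpa using hfg (-1 / z)) hinv hinv_off
    refine (((hfg z).sub ((hfg_inv.linear L).smul hpow)).sub (hg z hx)).congr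
      (.of_forall fun w _ => ?_)
    rw [map_sub, smul_sub]
    abel
  · have hf_inv : ExtAt realAxis (fun w => f (-1 / w)) z :=
      .of_analyticAt ((hf _ (im_neg_one_div_ne_zero him)).fun_comp hinv)
    exact (ExtAt.of_analyticAt (hf z him)).sub ((hf_inv.linear L).smul hpow)

theorem indicator_mem_periodicFunctions {f : ℂ → V} {v : V}
    (hf : ∀ z : ℂ, z.im ≠ 0 → AnalyticAt ℂ f z)
    (hT : ∀ z : ℂ, z.im ≠ 0 → f (z + 1) = η modT (f z))
    (hv₁ : Filter.Tendsto f (Filter.comap Complex.im Filter.atTop) (𝓝 v))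
    (hv₂ : Filter.Tendsto f (Filter.comap Complex.im Filter.atBot) (𝓝 (-v)))
    (hS : ∀ z ∈ Complex.slitPlane,
      ExtAt realAxis (fun z => f z - z ^ (-2 * ν - 1) • η modS (f (-1 / z))) z) :
    realAxisᶜ.indicator f ∈ periodicFunctions ν η := by
  have := FiniteDimensional.complete ℂ V
  obtain ⟨ψ, hψ, hψf⟩ := exists_analytic_extension dense_realAxis_compl hS
  have heq {z : ℂ} (hz : z.im ≠ 0) : realAxisᶜ.indicator f z = f z :=
    Set.indicator_of_mem (s := realAxisᶜ) hz f
  have hv₁' := hv₁.congr' (eventually_im_ne_zero_comap_atTop.mono fun z hz => (heq hz).symm)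
  have hv₂' := hv₂.congr' (eventually_im_ne_zero_comap_atBot.mono fun z hz => (heq hz).symm)
  refine ⟨fun x => Set.indicator_of_notMem (by simp) f, fun z hz => ?_, fun z hz => ?_,
    exists_bound_of_tendsto_im hv₁' hv₂', ⟨v, -v, hv₁', hv₂', add_neg_cancel v⟩, ψ,
    fun z hz => (hψ z hz).differentiableAt.differentiableWithinAt, fun z hz => ?_⟩
  · exact ((hf z hz).differentiableAt.differentiableWithinAt).congr (fun w hw => heq hw) (heq hz)
  · rw [heq hz, heq (by simpa using hz), hT z hz]
  · rw [hψf z hz, heq hz, heq (im_neg_one_div_ne_zero hz)]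

theorem exists_weightedHyp_eq_restrictHyp {N : ℕ} (hN : 0 < N) (hη : η (modT ^ N) = 1)
    {α : Hyperfunction realProj V} (hα : α ∈ automorphicHyperfunctions ν η) :
    ∃ f, weightedHyp ν η f = restrictHyp V realLine_subset_realProj α := by
  obtain ⟨⟨F, hF⟩, rfl⟩ := Submodule.Quotient.mk_surjective _ α
  have hinv (γ : SL(2, ℤ)) : ∀ p ∈ realProj,
      ExtHolAt realProj (fun q => slashFun ν η γ F q - F q) p :=
    (slash_mk_eq_self_iff hF).1 (mem_automorphicHyperfunctions_iff.1 hα γ)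
  obtain ⟨f, hf, hT, ⟨v, hv₁, hv₂⟩, hfF⟩ := exists_equivariant_of_extAt hN hη
    (analyticOffAt_unweighted hF)
    fun n x => extAt_unweighted_T ν η (hinv (T ^ n) _ (ofReal_mem_realProj x))
  have hS : ∀ z ∈ Complex.slitPlane,
      ExtAt realAxis (fun z => f z - z ^ (-2 * ν - 1) • η modS (f (-1 / z))) z :=
    fun z hz => extAt_sub_cpow_smul hf hfF
      (fun x hx => extAt_unweighted_S ν η hx (hinv S _ (ofReal_mem_realProj x))) hz
  refine ⟨⟨realAxisᶜ.indicator f, indicator_mem_periodicFunctions hf hT hv₁ hv₂ hS⟩,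
    (weightedHyp_eq_restrictHyp_mk_iff _ hF).2 fun x => (hfF x).congr (.of_forall fun z hz => ?_)⟩
  exact congrArg (· - unweighted ν F z) (Set.indicator_of_mem (s := realAxisᶜ) hz f)

end PeriodicOfAutomorphic

section Cayley

variable {V : Type*} [NormedAddCommGroup V] [NormedSpace ℂ V]

/-- The Cayley transformation `z ↦ (iz + 1) / (-iz + 1)`, which maps the real projective line to
the unit circle. -/
noncomputable def cayley : GL (Fin 2) ℂ :=
  Matrix.GeneralLinearGroup.mkOfDetNeZero !![Complex.I, 1; -Complex.I, 1] <| by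
    rw [Matrix.det_fin_two_of]
    simp [← two_mul]

/-- The unit circle in the complex projective line. -/
abbrev projCircle : Set (OnePoint ℂ) := (fun w : ℂ => (w : OnePoint ℂ)) '' unitCircle

theorem preimage_projCircle : (fun w : ℂ => (w : OnePoint ℂ)) ⁻¹' projCircle = unitCircle :=
  Set.preimage_image_eq _ OnePoint.coe_injective

theorem cayley_smul_coe (z : ℂ) : cayley • (z : OnePoint ℂ) =
    if -Complex.I * z + 1 = 0 then ∞
    else (((Complex.I * z + 1) / (-Complex.I * z + 1) : ℂ) : OnePoint ℂ) := by
  rw [OnePoint.smul_some_eq_ite]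
  rfl

theorem cayley_smul_infty : cayley • (∞ : OnePoint ℂ) = ((-1 : ℂ) : OnePoint ℂ) := by
  have h₁ : cayley 1 0 = -Complex.I := rfl
  have h₀ : cayley 0 0 = Complex.I := rfl
  rw [OnePoint.smul_infty_eq_ite, h₁, h₀, if_neg (neg_ne_zero.2 Complex.I_ne_zero), div_neg,
    div_self Complex.I_ne_zero]

theorem cayley_smul_zero : cayley • ((0 : ℂ) : OnePoint ℂ) = ((1 : ℂ) : OnePoint ℂ) := by
  rw [cayley_smul_coe]
  simp

theorem norm_I_mul_add_one_eq_iff {z : ℂ} :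
    ‖Complex.I * z + 1‖ = ‖-Complex.I * z + 1‖ ↔ z.im = 0 := by
  have hsq : Complex.normSq (Complex.I * z + 1) - Complex.normSq (-Complex.I * z + 1) =
      -4 * z.im := by
    simp only [Complex.normSq_apply, Complex.add_re, Complex.add_im, Complex.mul_re,
      Complex.mul_im, Complex.neg_re, Complex.neg_im, Complex.I_re, Complex.I_im, Complex.one_re,
      Complex.one_im]
    ring
  rw [← sq_eq_sq₀ (norm_nonneg _) (norm_nonneg _), Complex.sq_norm, Complex.sq_norm,
    ← sub_eq_zero, hsq, mul_eq_zero_iff_left (by norm_num)]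

theorem cayley_smul_mem_iff {p : OnePoint ℂ} : cayley • p ∈ projCircle ↔ p ∈ realProj := by
  cases p with
  | infty =>
    rw [cayley_smul_infty]
    exact iff_of_true ⟨-1, by simp, rfl⟩ infty_mem_realProj
  | coe z =>
    rw [coe_mem_realProj_iff, cayley_smul_coe]
    split_ifs with hden
    · refine iff_of_false (fun ⟨w, _, hw⟩ => OnePoint.coe_ne_infty w hw) fun hz => ?_
      simpa [hz] using congrArg Complex.re hden
    · have hmem : (((Complex.I * z + 1) / (-Complex.I * z + 1) : ℂ) : OnePoint ℂ) ∈ projCircle ↔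
          ‖(Complex.I * z + 1) / (-Complex.I * z + 1)‖ = 1 :=
        Set.ext_iff.1 preimage_projCircle _
      rw [hmem, norm_div, div_eq_one_iff_eq (norm_ne_zero_iff.2 hden), norm_I_mul_add_one_eq_iff]

theorem extHolAt_projCircle_iff {φ : OnePoint ℂ → V} {u : ℂ} :
    ExtHolAt projCircle φ (u : OnePoint ℂ) ↔ ExtAt unitCircle (fun w : ℂ => φ w) u := by
  rw [extHolAt_coe_iff, preimage_projCircle]

theorem extHolAt_realProj_iff_extHolAt_projCircle {φ : OnePoint ℂ → V} {p : OnePoint ℂ} :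
    ExtHolAt realProj φ p ↔ ExtHolAt projCircle (fun q => φ (cayley⁻¹ • q)) (cayley • p) := by
  constructor <;> intro h
  · refine ExtHolAt.comp_smul (C := realProj) (by rwa [inv_smul_smul]) fun q hq hmem => hq ?_
    rwa [← cayley_smul_mem_iff, smul_inv_smul] at hmem
  · simpa only [inv_smul_smul] using
      h.comp_smul (D := realProj) fun q hq hmem => hq (cayley_smul_mem_iff.1 hmem)

theorem exists_glue_on_realProj [CompleteSpace V] {F₁ F₂ : OnePoint ℂ → V}
    (h : ∀ p ∈ realProj, p ≠ ∞ → p ≠ ((0 : ℂ) : OnePoint ℂ) →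
      ExtHolAt realProj (fun q => F₁ q - F₂ q) p) :
    ∃ F : OnePoint ℂ → V,
      (∀ p ∈ realProj, p ≠ ∞ → ExtHolAt realProj (fun q => F q - F₁ q) p) ∧
      ∀ p ∈ realProj, p ≠ ((0 : ℂ) : OnePoint ℂ) →
        ExtHolAt realProj (fun q => F q - F₂ q) p := by
  obtain ⟨G, hG₁, hG₂⟩ := exists_glue_on_circle
    (F₁ := fun w : ℂ => F₁ (cayley⁻¹ • (w : OnePoint ℂ)))
    (F₂ := fun w : ℂ => F₂ (cayley⁻¹ • (w : OnePoint ℂ))) fun u hu hu₁ hu₂ => by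
      obtain ⟨p, hp⟩ : ∃ p, cayley • p = (u : OnePoint ℂ) := ⟨_, smul_inv_smul cayley _⟩
      have hmem : p ∈ realProj := cayley_smul_mem_iff.1 (hp ▸ ⟨u, hu, rfl⟩)
      refine extHolAt_projCircle_iff.1
        (hp ▸ extHolAt_realProj_iff_extHolAt_projCircle.1 (h p hmem ?_ ?_)) <;> rintro rfl
      · exact hu₂ (OnePoint.coe_injective (hp.symm.trans cayley_smul_infty))
      · exact hu₁ (OnePoint.coe_injective (hp.symm.trans cayley_smul_zero))
  have htransport {F' : OnePoint ℂ → V} {p : OnePoint ℂ} {u : ℂ}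
      (hp : (u : OnePoint ℂ) = cayley • p)
      (hu : ExtAt unitCircle (fun w : ℂ => G w - F' (cayley⁻¹ • (w : OnePoint ℂ))) u) :
      ExtHolAt realProj (fun q => (cayley • q).elim 0 G - F' q) p := by
    rw [extHolAt_realProj_iff_extHolAt_projCircle, ← hp, extHolAt_projCircle_iff]
    simp only [smul_inv_smul]
    exact hu
  refine ⟨fun q => (cayley • q).elim 0 G, fun p hp hp' => ?_, fun p hp hp' => ?_⟩
  all_goals obtain ⟨u, hu, hup⟩ := cayley_smul_mem_iff.2 hp
  · refine htransport hup (hG₁ u hu fun hu' => hp' (smul_left_cancel cayley ?_))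
    rw [← hup, hu', cayley_smul_infty]
  · refine htransport hup (hG₂ u hu fun hu' => hp' (smul_left_cancel cayley ?_))
    rw [← hup, hu', cayley_smul_zero]

end Cayley

section Germs

open ModularGroup (S T)

variable {V : Type*} [NormedAddCommGroup V] [NormedSpace ℂ V]

variable (V) in
/-- The hyperfunctions on `ℙ¹(ℝ)` whose germ at `p` is zero. -/
noncomputable def vanishingAt {p : OnePoint ℂ} (hp : p ∈ realProj) :
    Submodule ℂ (Hyperfunction realProj V) :=
  LinearMap.ker (restrictHyp V (Set.singleton_subset_iff.2 hp))

variable [FiniteDimensional ℂ V] {ν : ℂ} {η : Representation ℂ PSL(2, ℤ) V}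
  {β : Hyperfunction realProj V}

theorem restrictHyp_mk_eq_zero_iff {Ω Ω' : Set (OnePoint ℂ)} (hΩ : Ω' ⊆ Ω) {F : OnePoint ℂ → V}
    (hF : F ∈ boundaryFunctions Ω V) :
    restrictHyp V hΩ (Submodule.Quotient.mk ⟨F, hF⟩) = 0 ↔ ∀ p ∈ Ω', ExtHolAt realProj F p :=
  hyperfunction_mk_eq_zero_iff (hF.filter_mono (nhdsSet_mono hΩ))

theorem mk_mem_vanishingAt_iff {p : OnePoint ℂ} (hp : p ∈ realProj) {F : OnePoint ℂ → V}
    (hF : F ∈ boundaryFunctions realProj V) :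
    (Submodule.Quotient.mk ⟨F, hF⟩ : Hyperfunction realProj V) ∈ vanishingAt V hp ↔
      ExtHolAt realProj F p :=
  (restrictHyp_mk_eq_zero_iff _ hF).trans forall_eq

theorem restrictHyp_realLine_eq_zero_iff : restrictHyp V realLine_subset_realProj β = 0 ↔
    ∀ x : ℝ, β ∈ vanishingAt V (ofReal_mem_realProj x) := by
  obtain ⟨⟨F, hF⟩, rfl⟩ := Submodule.Quotient.mk_surjective _ β
  simp_rw [restrictHyp_mk_eq_zero_iff, mk_mem_vanishingAt_iff, realLine, Set.forall_mem_range]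

theorem eq_zero_of_forall_mem_vanishingAt (hinfty : β ∈ vanishingAt V infty_mem_realProj)
    (hreal : ∀ x : ℝ, β ∈ vanishingAt V (ofReal_mem_realProj x)) : β = 0 := by
  obtain ⟨⟨F, hF⟩, rfl⟩ := Submodule.Quotient.mk_surjective _ β
  refine (hyperfunction_mk_eq_zero_iff hF).2 fun p hp => (mk_mem_vanishingAt_iff hp hF).1 ?_
  rcases eq_infty_or_ofReal_of_mem_realProj hp with rfl | ⟨x, rfl⟩
  exacts [hinfty, hreal x]

theorem slash_mem_vanishingAt {p q : OnePoint ℂ} {hp : p ∈ realProj} {hq : q ∈ realProj}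
    {γ : SL(2, ℤ)} (hγ : (Matrix.SpecialLinearGroup.mapGL ℂ (toSLReal γ))⁻¹ • p = q)
    (hβ : β ∈ vanishingAt V hq) : slash ν η γ β ∈ vanishingAt V hp := by
  subst hγ
  obtain ⟨⟨F, hF⟩, rfl⟩ := Submodule.Quotient.mk_surjective _ β
  rw [slash_mk, mk_mem_vanishingAt_iff]
  exact ExtHolAt.slashFun ν η hp ((mk_mem_vanishingAt_iff hq hF).1 hβ)

theorem slash_mem_vanishingAt_infty (hβ : ∀ x : ℝ, β ∈ vanishingAt V (ofReal_mem_realProj x))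
    {γ : SL(2, ℤ)} (hγ : γ 1 0 ≠ 0) : slash ν η γ β ∈ vanishingAt V infty_mem_realProj := by
  obtain ⟨x, hx⟩ := inv_smul_infty_eq_ofReal (g := toSLReal γ) (by simpa using hγ)
  exact slash_mem_vanishingAt hx (hβ x)

theorem restrictHyp_injOn_automorphicHyperfunctions : Set.InjOn
    (restrictHyp V realLine_subset_realProj) (automorphicHyperfunctions ν η) := by
  refine fun α hα β hβ h => ?_
  have hmem : α - β ∈ automorphicHyperfunctions ν η := sub_mem hα hβ
  have hreal := restrictHyp_realLine_eq_zero_iff.1 ((map_sub _ α β).trans (sub_eq_zero.2 h))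
  refine sub_eq_zero.1 (eq_zero_of_forall_mem_vanishingAt ?_ hreal)
  rw [← mem_automorphicHyperfunctions_iff.1 hmem S]
  exact slash_mem_vanishingAt_infty hreal (by simp [ModularGroup.coe_S])

theorem mem_automorphicHyperfunctions_of_S_T {α : Hyperfunction realProj V}
    (hS : slash ν η S α = α) (hT : slash ν η T α = α) : α ∈ automorphicHyperfunctions ν η := by
  rw [mem_automorphicHyperfunctions_iff]
  intro γ
  have hγ : γ ∈ Subgroup.closure {S, T} := SpecialLinearGroup.SL2Z_generators ▸ Subgroup.mem_top γ
  induction hγ using Subgroup.closure_induction with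
  | mem γ hγ =>
    rcases hγ with rfl | rfl
    exacts [hS, hT]
  | one => rw [map_one, Module.End.one_apply]
  | mul γ δ _ _ hγ hδ => rw [map_mul, Module.End.mul_apply, hδ, hγ]
  | inv γ _ hγ => rw [← hγ, Representation.inv_self_apply, hγ]

theorem sum_pow_sub_self_eq_zero {k G M : Type*} [CommRing k] [Group G] [AddCommGroup M]
    [Module k M] (ρ : Representation k G M) {u : G} {n : ℕ} (hu : u ^ n = 1) (m : M) :
    ∑ i ∈ Finset.range n, ρ (u ^ i) (ρ u m - m) = 0 := by
  have hstep (i : ℕ) : ρ (u ^ i) (ρ u m - m) = ρ (u ^ (i + 1)) m - ρ (u ^ i) m := by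
    rw [map_sub, ← Module.End.mul_apply, ← map_mul, ← pow_succ]
  simp_rw [hstep]
  rw [Finset.sum_range_sub (fun i => ρ (u ^ i) m), hu, pow_zero, sub_self]

/-- Since `α` is invariant under `S`, the relation `(T S⁻¹)³ = 1` expresses the germ at `∞` of
`T α - α` by its germs at the points `(T S⁻¹)⁻¹ ∞` and `(T S⁻¹)⁻² ∞` of the real line. -/
theorem mem_automorphicHyperfunctions_of_S_of_forall_real {α : Hyperfunction realProj V}
    (hS : slash ν η S α = α)
    (hT : ∀ x : ℝ, slash ν η T α - α ∈ vanishingAt V (ofReal_mem_realProj x)) :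
    α ∈ automorphicHyperfunctions ν η := by
  have hU : slash ν η (T * S⁻¹) α = slash ν η T α := by
    conv_lhs => rw [← hS, map_mul, Module.End.mul_apply, Representation.inv_self_apply]
  have hcube : (T * S⁻¹) ^ 3 = 1 := by decide
  have hsum := sum_pow_sub_self_eq_zero (slash ν η) hcube α
  rw [Finset.sum_range_succ, Finset.sum_range_succ, Finset.sum_range_one, hU, pow_zero, pow_one,
    map_one, Module.End.one_apply, add_assoc, add_eq_zero_iff_eq_neg] at hsum
  have hinfty : slash ν η T α - α ∈ vanishingAt V infty_mem_realProj := by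
    rw [hsum]
    exact neg_mem (add_mem (slash_mem_vanishingAt_infty hT (by decide))
      (slash_mem_vanishingAt_infty hT (by decide)))
  exact mem_automorphicHyperfunctions_of_S_T hS
    (sub_eq_zero.1 (eq_zero_of_forall_mem_vanishingAt hinfty hT))

end Germs

section Inversion

variable {V : Type*} [NormedAddCommGroup V] [NormedSpace ℂ V] {ν : ℂ}
  {η : Representation ℂ PSL(2, ℤ) V} {φ ψ : OnePoint ℂ → V} {p : OnePoint ℂ}

variable (η) in
/-- The operator `η(S) π_ν(S)` on functions near `ℙ¹(ℝ)`. It does not depend on `ν`, since the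
automorphy factor of `S` is `1`. -/
noncomputable def inversion (φ : OnePoint ℂ → V) : OnePoint ℂ → V :=
  fun q => η modS (φ (negInv • q))

theorem inversion_inversion (φ : OnePoint ℂ → V) : inversion η (inversion η φ) = φ := by
  ext q
  rw [inversion, inversion, ← Module.End.mul_apply, ← map_mul, modS_mul_modS, map_one,
    Module.End.one_apply, negInv_smul_negInv_smul]

theorem inversion_sub (φ ψ : OnePoint ℂ → V) (q : OnePoint ℂ) :
    inversion η (fun r => φ r - ψ r) q = inversion η φ q - inversion η ψ q :=
  map_sub _ _ _

variable [FiniteDimensional ℂ V]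

theorem ExtHolAt.inversion (h : ExtHolAt realProj φ (negInv • p)) :
    ExtHolAt realProj (inversion η φ) p :=
  (h.comp_smul fun _ hq => (inv_smul_mem_realProj_iff _).not.2 hq).linear (η modS)

theorem ExtHolAt.sub_inversion_of_negInv_smul
    (h : ExtHolAt realProj (fun q => φ q - LewisHyp.inversion η φ q) (negInv • p)) :
    ExtHolAt realProj (fun q => φ q - LewisHyp.inversion η φ q) p := by
  refine (h.inversion (η := η)).neg.congr (.of_forall fun q _ => ?_)
  rw [inversion_sub, inversion_inversion, neg_sub]

theorem extHolAt_sub_inversion_of_pos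
    (h : ∀ x : ℝ, 0 < x → ExtHolAt realProj (fun q => φ q - inversion η φ q) (x : ℂ))
    (hp : p ∈ realProj) (hp_infty : p ≠ ∞) (hp_zero : p ≠ ((0 : ℂ) : OnePoint ℂ)) :
    ExtHolAt realProj (fun q => φ q - inversion η φ q) p := by
  obtain rfl | ⟨x, rfl⟩ := eq_infty_or_ofReal_of_mem_realProj hp
  · exact absurd rfl hp_infty
  have hx : x ≠ 0 := fun hx => hp_zero (by rw [hx, Complex.ofReal_zero])
  rcases hx.lt_or_gt with hneg | hpos
  · refine ExtHolAt.sub_inversion_of_negInv_smul ?_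
    rw [negInv_smul_of_ne_zero (Complex.ofReal_ne_zero.2 hx)]
    exact_mod_cast h (-1 / x) (div_pos_of_neg_of_neg neg_one_lt_zero hneg)
  · exact h x hpos

theorem mem_boundaryFunctions_of_inversion {F : OnePoint ℂ → V}
    (hφ : φ ∈ boundaryFunctions realLine V)
    (hreal : ∀ x : ℝ, ExtHolAt realProj (fun q => F q - φ q) (x : ℂ))
    (hinfty : ExtHolAt realProj (fun q => F q - inversion η φ q) ∞) :
    F ∈ boundaryFunctions realProj V := by
  have hdiff {ψ : OnePoint ℂ → V} {p : OnePoint ℂ}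
      (h : ExtHolAt realProj (fun q => F q - ψ q) p) (hψ : ∀ᶠ q in 𝓝 p, q ∉ realProj → HolAt ψ q) :
      ∀ᶠ q in 𝓝 p, q ∉ realProj → HolAt F q := by
    filter_upwards [h.eventually_holAt isClosed_realProj, hψ] with q hq hψq hmem
    exact ((hq hmem).add (hψq hmem)).congr (.of_forall fun r => sub_add_cancel _ _)
  have hφreal (x : ℝ) : ∀ᶠ q in 𝓝 ((x : ℂ) : OnePoint ℂ), q ∉ realProj → HolAt φ q :=
    mem_boundaryFunctions_iff.1 hφ _ ⟨x, rfl⟩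
  refine mem_boundaryFunctions_iff.2 fun p hp => ?_
  obtain rfl | ⟨x, rfl⟩ := eq_infty_or_ofReal_of_mem_realProj hp
  · refine hdiff hinfty ?_
    have hzero := hφreal 0
    rw [Complex.ofReal_zero, ← negInv_smul_infty] at hzero
    filter_upwards [(tendsto_smul negInv ∞).eventually hzero] with q hq hmem
    exact (hq ((inv_smul_mem_realProj_iff _).not.2 hmem)).comp_smul.linear (η modS)
  · exact hdiff (hreal x) (hφreal x)

/-- The function is glued from `φ` around `ℝ` and its image under the inversion around `∞`. -/
theorem exists_inversion_invariant (hφ : φ ∈ boundaryFunctions realLine V)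
    (hpos : ∀ x : ℝ, 0 < x → ExtHolAt realProj (fun q => φ q - inversion η φ q) (x : ℂ)) :
    ∃ F ∈ boundaryFunctions realProj V,
      (∀ x : ℝ, ExtHolAt realProj (fun q => F q - φ q) (x : ℂ)) ∧
      ∀ p ∈ realProj, ExtHolAt realProj (fun q => F q - inversion η F q) p := by
  have := FiniteDimensional.complete ℂ V
  obtain ⟨F, hFφ, hFinv⟩ := exists_glue_on_realProj fun p => extHolAt_sub_inversion_of_pos hpos
  have hreal (x : ℝ) : ExtHolAt realProj (fun q => F q - φ q) (x : ℂ) :=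
    hFφ _ (ofReal_mem_realProj x) (OnePoint.coe_ne_infty _)
  have hinfty := hFinv ∞ infty_mem_realProj (OnePoint.infty_ne_coe 0)
  have hsymm {p : OnePoint ℂ} (hp : p ∈ realProj) (hp0 : p ≠ ((0 : ℂ) : OnePoint ℂ)) :
      ExtHolAt realProj (fun q => F q - inversion η F q) p := by
    have hne : negInv • p ≠ ∞ := fun h =>
      hp0 (by rw [← negInv_smul_negInv_smul p, h, negInv_smul_infty])
    have hφp := (hFφ _ ((inv_smul_mem_realProj_iff _).2 hp) hne).inversion (η := η)
    refine ((hFinv p hp hp0).sub hφp).congr (.of_forall fun q _ => ?_)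
    rw [inversion_sub, sub_sub_sub_cancel_right]
  refine ⟨F, mem_boundaryFunctions_of_inversion hφ hreal hinfty, hreal, fun p hp => ?_⟩
  obtain rfl | hp0 := eq_or_ne p ((0 : ℂ) : OnePoint ℂ)
  · refine ExtHolAt.sub_inversion_of_negInv_smul ?_
    rw [negInv_smul_zero]
    exact hsymm infty_mem_realProj (OnePoint.infty_ne_coe 0)
  · exact hsymm hp hp0

end Inversion

section AutomorphicOfPeriodic

open ModularGroup (S T)

variable {V : Type*} [NormedAddCommGroup V] [NormedSpace ℂ V]
  {ν : ℂ} {η : Representation ℂ PSL(2, ℤ) V}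

theorem extHolAt_weighted_sub_inversion {f ψ : ℂ → V} {x : ℝ} (hx : 0 < x)
    (hψ : AnalyticAt ℂ ψ x)
    (hψf : ∀ z : ℂ, z.im ≠ 0 → ψ z = f z - z ^ (-2 * ν - 1) • η modS (f (-1 / z))) :
    ExtHolAt realProj (fun q => weighted ν f q - inversion η (weighted ν f) q) (x : ℂ) := by
  rw [extHolAt_realProj_coe_iff]
  refine (ExtAt.of_analyticAt ((analyticAt_weight (one_add_sq_re_pos x) (ν + 1 / 2)).smul
    hψ)).congr ?_
  filter_upwards [eventually_weight_mul_cpow hx ν] with z ⟨_, hz⟩ him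
  have hz0 : z ≠ 0 := fun h => him (by simp [h])
  rw [inversion, negInv_smul_of_ne_zero hz0, weighted_coe, weighted_coe, map_smul, Pi.smul_apply',
    hψf z him, smul_sub, smul_smul, hz]

theorem eventually_slashFun_T_weighted {f : ℂ → V}
    (hper : ∀ z : ℂ, z.im ≠ 0 → f (z + 1) = η modT (f z)) (x : ℝ) :
    ∀ᶠ q in 𝓝 ((x : ℂ) : OnePoint ℂ), q ∉ realProj →
      slashFun ν η T (weighted ν f) q = weighted ν f q := by
  rw [eventually_nhds_coe_iff]
  filter_upwards [eventually_T_zpow_re_pos 1 x] with z ⟨hquot, hshift⟩ hz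
  have him : z.im ≠ 0 := coe_mem_realProj_iff.not.1 hz
  have hslash := slashFun_T_zpow_coe ν η 1 (weighted ν f) him
  rw [zpow_one, zpow_one, weighted_coe, map_smul, smul_smul,
    div_cpow_mul_cpow hquot hshift] at hslash
  rw [hslash, weighted_coe, Int.cast_one, ← hper _ (by simpa using him), sub_add_cancel]

theorem inv_T_smul_ofReal (x : ℝ) :
    (Matrix.SpecialLinearGroup.mapGL ℂ (toSLReal T))⁻¹ • ((x : ℂ) : OnePoint ℂ) =
      ((x - 1 : ℝ) : ℂ) := by
  obtain ⟨h1, h2, h3, h4⟩ := toSLReal_T_zpow_apply 1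
  rw [zpow_one] at h1 h2 h3 h4
  rw [inv_smul_coe, h1, h2, h3, h4]
  simp

variable [FiniteDimensional ℂ V]

theorem ExtHolAt.slashFun_sub_of_sub {γ : SL(2, ℤ)} {F G : OnePoint ℂ → V} {p : OnePoint ℂ}
    (hp : p ∈ realProj) (hFG : ExtHolAt realProj (fun q => F q - G q) p)
    (hγ : ExtHolAt realProj (fun q => F q - G q)
      ((Matrix.SpecialLinearGroup.mapGL ℂ (toSLReal γ))⁻¹ • p))
    (hG : ∀ᶠ q in 𝓝 p, q ∉ realProj → LewisHyp.slashFun ν η γ G q = G q) :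
    ExtHolAt realProj (fun q => LewisHyp.slashFun ν η γ F q - F q) p := by
  refine ((ExtHolAt.slashFun (ν := ν) (η := η) hp hγ).sub hFG).congr ?_
  filter_upwards [hG] with q hq hmem
  rw [slashFun_apply, slashFun_apply, map_sub, smul_sub, ← slashFun_apply, ← slashFun_apply,
    hq hmem, sub_sub_sub_cancel_right]

theorem exists_mem_automorphicHyperfunctions_weightedHyp_eq (f : periodicFunctions ν η) :
    ∃ α ∈ automorphicHyperfunctions ν η,
      weightedHyp ν η f = restrictHyp V realLine_subset_realProj α := by
  have := FiniteDimensional.complete ℂ V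
  obtain ⟨-, -, hper, -, -, ψ, hψ, hψf⟩ := f.2
  have hpos (x : ℝ) (hx : 0 < x) := extHolAt_weighted_sub_inversion hx (hψ.analyticAt
    (Complex.isOpen_slitPlane.mem_nhds (Complex.ofReal_mem_slitPlane.2 hx))) hψf
  obtain ⟨F, hF, hFf, hFS⟩ := exists_inversion_invariant (weighted_mem_boundaryFunctions f.2) hpos
  have hS : slash ν η S (Submodule.Quotient.mk ⟨F, hF⟩) = Submodule.Quotient.mk ⟨F, hF⟩ := by
    refine (slash_mk_eq_self_iff hF).2 fun p hp => (hFS p hp).neg.congr ?_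
    filter_upwards [eventually_slashFun_S ν η F hp] with q hq _
    rw [hq, neg_sub, inversion]
  have hT (x : ℝ) : ExtHolAt realProj (fun q => slashFun ν η T F q - F q) (x : ℂ) :=
    ExtHolAt.slashFun_sub_of_sub (ofReal_mem_realProj x) (hFf x)
      (by rw [inv_T_smul_ofReal]; exact hFf (x - 1)) (eventually_slashFun_T_weighted hper x)
  refine ⟨Submodule.Quotient.mk ⟨F, hF⟩, mem_automorphicHyperfunctions_of_S_of_forall_real hS
    fun x => (mk_mem_vanishingAt_iff _ _).2 (hT x), ?_⟩
  refine (weightedHyp_eq_restrictHyp_mk_iff f hF).2 fun x => extAt_weighted_sub_iff.1 ?_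
  refine (extHolAt_realProj_coe_iff.1 (hFf x)).neg.congr (.of_forall fun z _ => ?_)
  rw [neg_sub]

end AutomorphicOfPeriodic

section Main

open ModularGroup (T)

theorem exists_pow_modT_eq_one {k W : Type*} [CommSemiring k] [AddCommMonoid W] [Module k W]
    {Γ : Subgroup PSL(2, ℤ)} (hΓ : Γ.FiniteIndex) {η : Representation k PSL(2, ℤ) W}
    (hpar : ∀ γ ∈ parabolicSubgroup Γ, η γ = 1) : ∃ N : ℕ, 0 < N ∧ η (modT ^ N) = 1 := by
  obtain ⟨N, hN, -, hmem⟩ := Subgroup.exists_pow_mem_of_index_ne_zero hΓ.index_ne_zero modT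
  refine ⟨N, hN, hpar _ (Subgroup.subset_closure ⟨hmem, T ^ N, rfl, ?_⟩)⟩
  rw [← zpow_natCast, ModularGroup.coe_T_zpow]
  refine ⟨?_, by simp [Matrix.discr_fin_two, Matrix.trace_fin_two, Matrix.det_fin_two]⟩
  rintro ⟨c, hc⟩
  have hoff : (0 : ℤ) = N := by
    simpa [Matrix.intCast_apply] using congrFun (congrFun hc 0) 1
  omega

theorem existsUnique_linearEquiv_of_range_eq {R M N P : Type*} [Ring R] [AddCommGroup M]
    [AddCommGroup N] [AddCommGroup P] [Module R M] [Module R N] [Module R P] {f : M →ₗ[R] P}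
    {g : N →ₗ[R] P} (hf : Function.Injective f) (hg : Function.Injective g)
    (h : LinearMap.range f = LinearMap.range g) :
    ∃! e : M ≃ₗ[R] N, ∀ m, g (e m) = f m := by
  let e := (LinearEquiv.ofInjective f hf).trans
    ((LinearEquiv.ofEq _ _ h).trans (LinearEquiv.ofInjective g hg).symm)
  have he (m : M) : g (e m) = f m :=
    congrArg Subtype.val ((LinearEquiv.ofInjective g hg).apply_symm_apply _)
  exact ⟨e, he, fun e' he' => LinearEquiv.ext fun m => hg ((he' m).trans (he m).symm)⟩

end Main

end LewisHyp

theorem mainTheorem4_general {V : Type*} [NormedAddCommGroup V] [NormedSpace ℂ V]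
    [FiniteDimensional ℂ V] (η : Representation ℂ PSL(2, ℤ) V) {N : ℕ} (hN : 0 < N)
    (hη : η (LewisHyp.modT ^ N) = 1) (ν : ℂ) :
    ∃! e : LewisHyp.automorphicHyperfunctions ν η ≃ₗ[ℂ] LewisHyp.periodicFunctions ν η,
      ∀ α : LewisHyp.automorphicHyperfunctions ν η,
        LewisHyp.Represents (LewisHyp.weighted ν (e α : ℂ → V))
          (LewisHyp.restrictHyp V LewisHyp.realLine_subset_realProj
            (α : LewisHyp.Hyperfunction LewisHyp.realProj V)) := by
  simp_rw [LewisHyp.represents_weighted_iff]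
  let restrict := LewisHyp.restrictHyp V LewisHyp.realLine_subset_realProj ∘ₗ
    (LewisHyp.automorphicHyperfunctions ν η).subtype
  have hrestrict : Function.Injective restrict := fun α β h =>
    Subtype.ext (LewisHyp.restrictHyp_injOn_automorphicHyperfunctions α.2 β.2 h)
  refine LewisHyp.existsUnique_linearEquiv_of_range_eq (f := restrict)
    hrestrict (LewisHyp.weightedHyp_injective hN hη) (le_antisymm ?_ ?_)
  · rintro _ ⟨α, rfl⟩
    exact LewisHyp.exists_weightedHyp_eq_restrictHyp hN hη α.2
  · rintro _ ⟨f, rfl⟩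
    obtain ⟨α, hα, h⟩ := LewisHyp.exists_mem_automorphicHyperfunctions_weightedHyp_eq f
    exact ⟨⟨α, hα⟩, h.symm⟩

theorem mainTheorem4 {V : Type*} [NormedAddCommGroup V] [NormedSpace ℂ V] [FiniteDimensional ℂ V]
    (Γ : Subgroup PSL(2, ℤ)) (hΓn : Γ.Normal) (hΓi : Γ.FiniteIndex)
    (hΓt : ∀ γ ∈ Γ, IsOfFinOrder γ → γ = 1)
    (η : Representation ℂ PSL(2, ℤ) V)
    (hpar : ∀ γ ∈ LewisHyp.parabolicSubgroup Γ, η γ = 1)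
    (q : ℕ) (hq : LewisHyp.IsUnipotentOn η Γ q) (ν : ℂ) :
    ∃! e : LewisHyp.automorphicHyperfunctions ν η ≃ₗ[ℂ] LewisHyp.periodicFunctions ν η,
      ∀ α : LewisHyp.automorphicHyperfunctions ν η,
        LewisHyp.Represents (LewisHyp.weighted ν (e α : ℂ → V))
          (LewisHyp.restrictHyp V LewisHyp.realLine_subset_realProj
            (α : LewisHyp.Hyperfunction LewisHyp.realProj V)) := by
  obtain ⟨N, hN, hη⟩ := LewisHyp.exists_pow_modT_eq_one hΓi hpar
  exact mainTheorem4_general η hN hη ν
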